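/- **Setting.** Let $T>0$ and let $\Omega\subset\mathbb R^3$ be a bounded open set with smooth or piecewise smooth boundary: $\partial\Omega$ has finite area and, outside a set contained in finitely many Lipschitz arcs (edges and vertices), it is locally a $C^1$ surface with $\Omega$ on one side. Let $n=(n_1,n_2,n_3)$ be the outward unit normal and $dS$ the surface measure, and write $\Omega_T=\Omega\times(0,T)$. Let $f(p_1,p_2,p_3,p_4,x,y,z,t)$ be real-valued and continuous on $\mathbb R^4\times\Omega_T$, let $A_1,A_2\in L^2(\Omega)$ and $A_3\in L^2(\partial\Omega\times(0,T))$ be real-valued, and consider, for $u\in C^1(\Omega_T)$, $$u_t=f(u,u_x,u_y,u_z,x,y,z,t)\ \text{ on }\Omega_T,\qquad u|_{t=0}=A_1,\quad u|_{t=T}=A_2,\quad u|_{\partial\Omega\times(0,T)}=A_3. \tag{1}$$ The values are taken as limits almost everywhere: $u(x,t)\to A_1(x)$ as $t\to0^+$ and $u(x,t)\to A_2(x)$ as $t\to T^-$ for a.e. $x\in\Omega$; and for every $e\in\mathbb R^3$, for a.e. $(p,t)\in\partial\Omega\times(0,T)$ with $e\cdot n(p)<0$, $u(p+se,t)\to A_3(p,t)$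 as $s\to0^+$. **Symbols.** For real $a,b,c,d$ and $\xi'=(\xi_0,\xi_1,\xi_2,\xi_3)\in\mathbb R^4$ put $a_1=a+b\,i\xi_1+c\,i\xi_2+d\,i\xi_3-i\xi_0$, $C=\{\xi': a_1=0\}$, $$B_1=\begin{pmatrix} i\xi_0-a&-b&-c&-d\\ i\xi_1&-1&0&0\\ i\xi_2&0&-1&0\\ i\xi_3&0&0&-1\end{pmatrix},\quad B_2=(1,0,0,0)^T,\quad \beta_1=-(f_0,f_1,f_2,f_3)^T,$$ so that $\det B_1=a_1$, where $$f_0=\int_\Omega (A_2e^{-iT\xi_0}-A_1)\,e^{-ix\xi_1-iy\xi_2-iz\xi_3}\,dx\,dy\,dz,\qquad f_k=\int_0^T\!\!\int_{\partial\Omega}A_3\,n_k\,e^{-it\xi_0-ix\xi_1-iy\xi_2-iz\xi_3}\,dS\,dt\quad(k=1,2,3).$$ For a function $h$ on $\mathbb R^4$, the inverse Fourier transform $F^{-1}h$ exists if there is a tempered distribution $F^{-1}h$ such that, for every Schwartz function $\varphi$, $h\,F^{-1}\varphi$ is integrable and $\langle F^{-1}h,\varphi\rangle=\int h\,F^{-1}\varphi\,d\xi'$,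 where $F^{-1}\varphi(\xi')=(2\pi)^{-4}\int\varphi\,e^{it\xi_0+ix\xi_1+iy\xi_2+iz\xi_3}\,dx\,dy\,dz\,dt$. For $Z_1=(z_1,z_2,z_3,z_4)$ put $$\psi(Z_1)=f(Z_1,x,y,z,t)-az_1-bz_2-cz_3-dz_4 .$$ **Theorem.** Let $a,b,c,d\in\mathbb R$ be such that $F^{-1}(a_1^{-1})$ exists. Then $$w_1=F^{-1}\big[B_1^{-1}\beta_1(1-I_C)\big],\qquad w_2=F^{-1}\big(B_1^{-1}B_2\big)$$ exist (componentwise), and for every $Z_1=(z_1,z_2,z_3,z_4)\in C(\Omega_T;\mathbb R^4)\cap L^2(\Omega_T;\mathbb R^4)$ with $\psi(Z_1)\in L^2(\Omega_T)$ the following are equivalent: 1. $Z_1=(u,u_x,u_y,u_z)$ on $\Omega_T$ for a solution $u\in C^1(\Omega_T)$ of (1); 2. $Z_1 I_{\Omega_T}=w_1+w_2*\big(\psi(Z_1)I_{\Omega_T}\big)$ as tempered distributions on $\mathbb R^4$, where $\langle w*g,\varphi\rangle=\int g(p)\,\langle w,\varphi(\cdot+p)\rangle\,dp$. -/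

import Mathlib

open MeasureTheory Set Filter Topology
open scoped SchwartzMap NNReal ENNReal

namespace FirstOrderPDE

noncomputable section

/-- Physical space `ℝ³`. -/
abbrev E3 : Type := EuclideanSpace ℝ (Fin 3)

/-- Space-time `ℝ³ × ℝ`, a point being `((x, y, z), t)`. The dual variable `ξ'` is written in the
same way: `ξ.1 = (ξ₁, ξ₂, ξ₃)` is dual to `(x, y, z)` and `ξ.2 = ξ₀` is dual to `t`. -/
abbrev SpaceTime : Type := E3 × ℝ

/-- The space-time cylinder `Ω × (0, T)`. -/
def cyl (Ω : Set E3) (T : ℝ) : Set SpaceTime := Ω ×ˢ Ioo 0 T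

/-! ### Domains with smooth or piecewise smooth boundary -/

/-- `n` is the outward unit normal of `Ω` at the boundary point `p`, and `∂Ω` is a `C¹` surface near
`p` with `Ω` on one side of it: near `p` the set `Ω` is `{ρ < 0}` for a `C¹` function `ρ` whose
gradient does not vanish at `p`, and `n = ∇ρ(p) / |∇ρ(p)|`. -/
def IsOutwardNormal (Ω : Set E3) (p n : E3) : Prop :=
  p ∈ frontier Ω ∧ ∃ ρ : E3 → ℝ, ContDiffAt ℝ 1 ρ p ∧ gradient ρ p ≠ 0 ∧
    (∀ᶠ q in 𝓝 p, (q ∈ Ω ↔ ρ q < 0)) ∧ n = ‖gradient ρ p‖⁻¹ • gradient ρ p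

lemma apply_eq_zero_of_mem_frontier {Ω : Set E3} {p : E3} {ρ : E3 → ℝ} (hp : p ∈ frontier Ω)
    (hρ : ContinuousAt ρ p) (h : ∀ᶠ q in 𝓝 p, (q ∈ Ω ↔ ρ q < 0)) : ρ p = 0 := by
  rcases lt_trichotomy (ρ p) 0 with h1 | h1 | h1
  · exfalso
    have h2 : Ω ∈ 𝓝 p := by
      filter_upwards [h, hρ.eventually (gt_mem_nhds h1)] with q hq hq'
      exact hq.2 hq'
    exact hp.2 (mem_interior_iff_mem_nhds.2 h2)
  · exact h1
  · exfalso
    have h2 : ∀ᶠ q in 𝓝 p, q ∉ Ω := by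
      filter_upwards [h, hρ.eventually (lt_mem_nhds h1)] with q hq hq' hqΩ
      exact absurd (hq.1 hqΩ) (not_lt.2 hq'.le)
    have h3 := mem_closure_iff_frequently.1 hp.1
    exact h3 h2

/-- The outward unit normal is unique, so that `outwardNormal` below is well defined. -/
lemma IsOutwardNormal.unique {Ω : Set E3} {p n m : E3} (hn : IsOutwardNormal Ω p n)
    (hm : IsOutwardNormal Ω p m) : n = m := by
  obtain ⟨hp, ρ, hρ, hρ0, hρΩ, rfl⟩ := hn
  obtain ⟨-, σ, hσ, hσ0, hσΩ, rfl⟩ := hm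
  have key : ∀ (τ : E3 → ℝ), ContDiffAt ℝ 1 τ p → ∀ v : E3,
      HasDerivAt (fun s : ℝ => τ (p + s • v)) (inner ℝ (gradient τ p) v) 0 := by
    intro τ hτ v
    have h1 : HasFDerivAt τ (fderiv ℝ τ p) (p + (0 : ℝ) • v) := by
      simpa using (hτ.differentiableAt (by simp)).hasFDerivAt
    have h2 : HasDerivAt (fun s : ℝ => p + s • v) v 0 := by
      simpa using ((hasDerivAt_id (0 : ℝ)).smul_const v).const_add p
    have h3 := h1.comp_hasDerivAt (0 : ℝ) h2
    have h4 : inner ℝ (gradient τ p) v = fderiv ℝ τ p v := by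
      simp [gradient]
    rw [h4]
    exact h3
  have hρp := apply_eq_zero_of_mem_frontier hp hρ.continuousAt hρΩ
  have hσp := apply_eq_zero_of_mem_frontier hp hσ.continuousAt hσΩ
  by_contra hne
  set n := ‖gradient ρ p‖⁻¹ • gradient ρ p with hn
  set m := ‖gradient σ p‖⁻¹ • gradient σ p with hm
  have hn1 : ‖n‖ = 1 := by
    rw [hn, norm_smul, norm_inv, norm_norm, inv_mul_cancel₀ (norm_ne_zero_iff.2 hρ0)]
  have hm1 : ‖m‖ = 1 := by
    rw [hm, norm_smul, norm_inv, norm_norm, inv_mul_cancel₀ (norm_ne_zero_iff.2 hσ0)]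
  have hgn : gradient ρ p = ‖gradient ρ p‖ • n := by
    rw [hn, smul_smul, mul_inv_cancel₀ (norm_ne_zero_iff.2 hρ0), one_smul]
  have hgm : gradient σ p = ‖gradient σ p‖ • m := by
    rw [hm, smul_smul, mul_inv_cancel₀ (norm_ne_zero_iff.2 hσ0), one_smul]
  have hlt : inner ℝ n m < 1 := (inner_lt_one_iff_real_of_norm_eq_one hn1 hm1).2 hne
  have ha : inner ℝ (gradient ρ p) (m - n) < 0 := by
    rw [hgn, inner_smul_left, inner_sub_right, real_inner_self_eq_norm_sq, hn1]
    have := norm_pos_iff.2 hρ0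
    simp only [conj_trivial]
    nlinarith
  have hb : 0 < inner ℝ (gradient σ p) (m - n) := by
    rw [hgm, inner_smul_left, inner_sub_right, real_inner_self_eq_norm_sq, hm1,
      real_inner_comm]
    have := norm_pos_iff.2 hσ0
    simp only [conj_trivial]
    nlinarith
  have hline : Tendsto (fun s : ℝ => p + s • (m - n)) (𝓝[>] 0) (𝓝 p) := by
    have : Continuous (fun s : ℝ => p + s • (m - n)) := by fun_prop
    simpa using (this.tendsto 0).mono_left (nhdsWithin_le_nhds (s := Ioi 0))
  have e1 : ∀ᶠ s in 𝓝[>] (0 : ℝ), ρ (p + s • (m - n)) < 0 := by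
    have := ((key ρ hρ (m - n)).tendsto_slope_zero_right).eventually (gt_mem_nhds ha)
    filter_upwards [this, self_mem_nhdsWithin] with s hs hs0
    simp only [zero_add, zero_smul, add_zero, hρp, sub_zero, smul_eq_mul] at hs
    have hs0' : (0 : ℝ) < s := hs0
    by_contra hcon
    exact absurd hs (not_lt.2 (mul_nonneg (inv_nonneg.2 hs0'.le) (not_lt.1 hcon)))
  have e2 : ∀ᶠ s in 𝓝[>] (0 : ℝ), 0 < σ (p + s • (m - n)) := by
    have := ((key σ hσ (m - n)).tendsto_slope_zero_right).eventually (lt_mem_nhds hb)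
    filter_upwards [this, self_mem_nhdsWithin] with s hs hs0
    simp only [zero_add, zero_smul, add_zero, hσp, sub_zero, smul_eq_mul] at hs
    have hs0' : (0 : ℝ) < s := hs0
    exact pos_of_mul_pos_right hs (inv_nonneg.2 hs0'.le)
  obtain ⟨s, h1, h2, h3, h4⟩ :=
    (e1.and (e2.and ((hline.eventually hρΩ).and (hline.eventually hσΩ)))).exists
  exact absurd (h4.1 (h3.2 h1)) (not_lt.2 h2.le)

open Classical in
/-- The outward unit normal of `Ω` at the points where `∂Ω` is `C¹` (and `0` elsewhere). -/
def outwardNormal (Ω : Set E3) (p : E3) : E3 :=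
  if h : ∃ n, IsOutwardNormal Ω p n then h.choose else 0

/-- `∂Ω` is smooth or piecewise smooth: it has finite area, and it is a `C¹` surface with `Ω` on one
side of it away from a set of edges and vertices that is contained in finitely many Lipschitz arcs
(`m = 0`: no edges, the whole boundary is `C¹`). -/
def HasPiecewiseSmoothBoundary (Ω : Set E3) : Prop :=
  μHE[2] (frontier Ω) < ∞ ∧
  ∃ (m : ℕ) (γ : Fin m → ℝ → E3) (K : ℝ≥0), (∀ i, LipschitzOnWith K (γ i) (Icc 0 1)) ∧
    ∀ p ∈ frontier Ω, (∀ i, p ∉ γ i '' Icc 0 1) → ∃ n, IsOutwardNormal Ω p n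

/-- The surface measure `dS` on `∂Ω`: two-dimensional Hausdorff measure (normalized to be area). -/
def surfaceMeasure (Ω : Set E3) : Measure E3 := μHE[2].restrict (frontier Ω)

/-- The measure `dS dt` on the lateral boundary `∂Ω × (0, T)`. -/
def lateralMeasure (Ω : Set E3) (T : ℝ) : Measure SpaceTime :=
  (surfaceMeasure Ω).prod (volume.restrict (Ioo 0 T))

/-! ### The differential equation with its data -/

/-- `∂u/∂x`, `∂u/∂y`, `∂u/∂z` for `k = 0, 1, 2`. -/
def dx (k : Fin 3) (u : SpaceTime → ℝ) (p : SpaceTime) : ℝ :=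
  fderiv ℝ u p (EuclideanSpace.single k 1, 0)

/-- `∂u/∂t`. -/
def dt (u : SpaceTime → ℝ) (p : SpaceTime) : ℝ := fderiv ℝ u p (0, 1)

/-- The vector `(u, u_x, u_y, u_z)`. -/
def jet (u : SpaceTime → ℝ) (p : SpaceTime) : Fin 4 → ℝ := ![u p, dx 0 u p, dx 1 u p, dx 2 u p]

/-- `u|_{t=0} = A₁`: for almost every `x ∈ Ω`, `u(x, t) → A₁(x)` as `t → 0+`. -/
def HasInitialValue (Ω : Set E3) (u : SpaceTime → ℝ) (A₁ : E3 → ℝ) : Prop :=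
  ∀ᵐ x ∂(volume.restrict Ω), Tendsto (fun t : ℝ => u (x, t)) (𝓝[>] 0) (𝓝 (A₁ x))

/-- `u|_{t=T} = A₂`: for almost every `x ∈ Ω`, `u(x, t) → A₂(x)` as `t → T-`. -/
def HasTerminalValue (Ω : Set E3) (T : ℝ) (u : SpaceTime → ℝ) (A₂ : E3 → ℝ) : Prop :=
  ∀ᵐ x ∂(volume.restrict Ω), Tendsto (fun t : ℝ => u (x, t)) (𝓝[<] T) (𝓝 (A₂ x))

/-- `u|_{∂Ω×(0,T)} = A₃`: along every direction `e`, for almost every lateral boundary point `(p, t)`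
at which `e` points strictly into `Ω`, `u(p + s e, t) → A₃(p, t)` as `s → 0+`. -/
def HasLateralValue (Ω : Set E3) (T : ℝ) (u : SpaceTime → ℝ) (A₃ : SpaceTime → ℝ) : Prop :=
  ∀ e : E3, ∀ᵐ q ∂(lateralMeasure Ω T), inner ℝ e (outwardNormal Ω q.1) < 0 →
    Tendsto (fun s : ℝ => u (q.1 + s • e, q.2)) (𝓝[>] 0) (𝓝 (A₃ q))

/-- `u` is a `C¹` solution of `u_t = f(u, u_x, u_y, u_z, x, y, z, t)` on `Ω × (0, T)` with the values
`u|_{t=0} = A₁`, `u|_{t=T} = A₂`, `u|_{∂Ω×(0,T)} = A₃`. -/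
structure IsSolution (Ω : Set E3) (T : ℝ) (f : (Fin 4 → ℝ) → SpaceTime → ℝ)
    (A₁ A₂ : E3 → ℝ) (A₃ : SpaceTime → ℝ) (u : SpaceTime → ℝ) : Prop where
  contDiffOn : ContDiffOn ℝ 1 u (cyl Ω T)
  eqn : ∀ p ∈ cyl Ω T, dt u p = f (jet u p) p
  initial : HasInitialValue Ω u A₁
  terminal : HasTerminalValue Ω T u A₂
  lateral : HasLateralValue Ω T u A₃

/-- `ψ(Z₁) = f(Z₁, x, y, z, t) - a z₁ - b z₂ - c z₃ - d z₄`. -/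
def psi (f : (Fin 4 → ℝ) → SpaceTime → ℝ) (a b c d : ℝ) (Z : SpaceTime → Fin 4 → ℝ)
    (p : SpaceTime) : ℝ :=
  f (Z p) p - a * Z p 0 - b * Z p 1 - c * Z p 2 - d * Z p 3

/-! ### Fourier transforms and tempered distributions -/

/-- The phase `x ξ₁ + y ξ₂ + z ξ₃ + t ξ₀`. -/
def phase (p ξ : SpaceTime) : ℝ := (∑ k, p.1 k * ξ.1 k) + p.2 * ξ.2

/-- `F⁻¹φ(ξ) = (2π)⁻⁴ ∫ φ(p) e^{i p·ξ} dp` for a Schwartz function `φ`; it inverts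
`F φ(ξ) = ∫ φ(p) e^{-i p·ξ} dp`. -/
def invFourierSchwartz (φ : 𝓢(SpaceTime, ℂ)) (ξ : SpaceTime) : ℂ :=
  ((2 * Real.pi : ℝ) : ℂ)⁻¹ ^ 4 * ∫ p, φ p * Complex.exp (Complex.I * (phase p ξ : ℂ))

/-- The inverse Fourier transform of the function `h` exists and is the tempered distribution `W`:
`h` acts on Schwartz functions by (absolutely convergent) integration, and
`⟨W, φ⟩ = ⟨h, F⁻¹φ⟩ = ∫ h(ξ) F⁻¹φ(ξ) dξ` for all `φ`. -/
def HasInvFourier (h : SpaceTime → ℂ) (W : 𝓢'(SpaceTime, ℂ)) : Prop :=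
  ∀ φ : 𝓢(SpaceTime, ℂ), Integrable (fun ξ => h ξ * invFourierSchwartz φ ξ) ∧
    W φ = ∫ ξ, h ξ * invFourierSchwartz φ ξ

/-- The function `g I_S` as a distribution: `⟨g I_S, φ⟩ = ∫_S g φ`. -/
def indicatorPairing (S : Set SpaceTime) (g : SpaceTime → ℝ) (φ : 𝓢(SpaceTime, ℂ)) : ℂ :=
  ∫ p in S, (g p : ℂ) * φ p

/-- The convolution of a tempered distribution `W` with the function `g I_S`:
`⟨W ∗ (g I_S), φ⟩ = ∫_S g(p) ⟨W, φ(· + p)⟩ dp`. -/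
def convPairing (W : 𝓢'(SpaceTime, ℂ)) (S : Set SpaceTime) (g : SpaceTime → ℝ)
    (φ : 𝓢(SpaceTime, ℂ)) : ℂ :=
  ∫ p in S, (g p : ℂ) * W (SchwartzMap.compSubConstCLM ℂ (-p) φ)

/-! ### The symbols -/

/-- `a₁ = a + b iξ₁ + c iξ₂ + d iξ₃ - iξ₀`. -/
def symbolA (a b c d : ℝ) (ξ : SpaceTime) : ℂ :=
  a + b * (Complex.I * ξ.1 0) + c * (Complex.I * ξ.1 1) + d * (Complex.I * ξ.1 2) - Complex.I * ξ.2

/-- The matrix `B₁`, whose determinant is `a₁`. -/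
def matB₁ (a b c d : ℝ) (ξ : SpaceTime) : Matrix (Fin 4) (Fin 4) ℂ :=
  !![Complex.I * ξ.2 - a, -b, -c, -d;
     Complex.I * ξ.1 0, -1, 0, 0;
     Complex.I * ξ.1 1, 0, -1, 0;
     Complex.I * ξ.1 2, 0, 0, -1]

/-- The vector `B₂ = (1, 0, 0, 0)ᵀ`. -/
def vecB₂ : Fin 4 → ℂ := ![1, 0, 0, 0]

/-- `f₀ = ∫_Ω (A₂ e^{-iTξ₀} - A₁) e^{-ixξ₁-iyξ₂-izξ₃} dx dy dz`. -/
def dataTime (Ω : Set E3) (T : ℝ) (A₁ A₂ : E3 → ℝ) (ξ : SpaceTime) : ℂ :=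
  ∫ x in Ω, ((A₂ x : ℂ) * Complex.exp (-(Complex.I * (T * ξ.2))) - A₁ x) *
    Complex.exp (-(Complex.I * (phase (x, 0) ξ : ℂ)))

/-- `f_k = ∫₀ᵀ ∫_{∂Ω} A₃ n_k e^{-itξ₀-ixξ₁-iyξ₂-izξ₃} dS dt`, `k = 1, 2, 3`. -/
def dataLateral (Ω : Set E3) (T : ℝ) (A₃ : SpaceTime → ℝ) (k : Fin 3) (ξ : SpaceTime) : ℂ :=
  ∫ q, (A₃ q : ℂ) * (outwardNormal Ω q.1 k : ℂ) * Complex.exp (-(Complex.I * (phase q ξ : ℂ)))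
    ∂(lateralMeasure Ω T)

/-- `β₁ = (-f₀, -f₁, -f₂, -f₃)ᵀ`. -/
def beta₁ (Ω : Set E3) (T : ℝ) (A₁ A₂ : E3 → ℝ) (A₃ : SpaceTime → ℝ) (ξ : SpaceTime) :
    Fin 4 → ℂ :=
  ![-dataTime Ω T A₁ A₂ ξ, -dataLateral Ω T A₃ 0 ξ, -dataLateral Ω T A₃ 1 ξ,
    -dataLateral Ω T A₃ 2 ξ]

/-- `B₁⁻¹ β₁ (1 - I_C)` with `C = {ξ | a₁(ξ) = 0}`; its inverse Fourier transform is `w₁`. -/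
def symbolW₁ (Ω : Set E3) (T : ℝ) (A₁ A₂ : E3 → ℝ) (A₃ : SpaceTime → ℝ) (a b c d : ℝ)
    (k : Fin 4) : SpaceTime → ℂ :=
  {ξ | symbolA a b c d ξ = 0}ᶜ.indicator
    (fun ξ => ((matB₁ a b c d ξ)⁻¹.mulVec (beta₁ Ω T A₁ A₂ A₃ ξ)) k)

/-- `B₁⁻¹ B₂`; its inverse Fourier transform is `w₂`. -/
def symbolW₂ (a b c d : ℝ) (k : Fin 4) (ξ : SpaceTime) : ℂ :=
  ((matB₁ a b c d ξ)⁻¹.mulVec vecB₂) k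

/-- The integral equation `Z₁ I_{Ω×(0,T)} = w₁ + w₂ ∗ (ψ(Z₁) I_{Ω×(0,T)})`, an equality of
`ℂ⁴`-valued tempered distributions on the whole of `ℝ³ × ℝ`. -/
def IntegralEquation (Ω : Set E3) (T : ℝ) (f : (Fin 4 → ℝ) → SpaceTime → ℝ) (a b c d : ℝ)
    (w₁ w₂ : Fin 4 → 𝓢'(SpaceTime, ℂ)) (Z : SpaceTime → Fin 4 → ℝ) : Prop :=
  ∀ (k : Fin 4) (φ : 𝓢(SpaceTime, ℂ)),
    indicatorPairing (cyl Ω T) (fun p => Z p k) φ =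
      w₁ k φ + convPairing (w₂ k) (cyl Ω T) (psi f a b c d Z) φ

end

end FirstOrderPDE

open FirstOrderPDE

namespace FirstOrderPDE

noncomputable section

/-! ### Flowing a surface in a transversal direction -/

/-! The hypothesis on `F⁻¹(1/a₁)` forces `a ≠ 0`: for `a = 0` the function `1/|a₁|` is the inverse
distance to a hyperplane up to a constant, which is not locally integrable
(`ne_zero_of_hasInvFourier`). Since `Re a₁ = a`, one then has `|a₁| ≥ |a| > 0`, the set `C` is empty
and `B₁` is invertible for every `ξ`. For a bounded vector `r` the first component of `B₁⁻¹ r` is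
bounded and the others are `iξ_k` times it minus `r_k`, so their inverse transforms exist as
tempered distributions and derivatives of such (`exists_hasInvFourier_inv_mulVec`).

On the Fourier side the integral equation is the linear system `B₁ Ẑ = β₁ + ψ̂ B₂`. All functions in
it are continuous in `ξ`, because they are transforms of integrable functions or finite measures
with bounded support, so equality of distributions is equality at each `ξ` (`integralEquation_iff`).
Row by row the system says that `(f(Z), Z₁, Z₂, Z₃)` is the gradient of `Z₀` on the cylinder, with
boundary terms given by `A₁, A₂, A₃`, tested against plane waves (`fourierIdentities_iff`). Since
Schwartz functions are superpositions of plane waves, this is passed on to all Schwartz test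
functions (`weakIdentities_of_fourierIdentities`).

What remains is real analysis: classical solutions with almost everywhere boundary limits correspond
to these weak identities. From weak to classical, test functions supported inside the cylinder show
that `Z₀` is `C¹` with the right gradient (`hasFDerivAt_of_weak`), and test functions that reach the
boundary identify the limits. From classical to weak, the time identity is the fundamental theorem
of calculus on lines, and the lateral one is Green's identity (`GreenData.greenIdentity`) for a
function known at the boundary only through limits along lines.

Both lateral arguments use coordinates `x = p + r e` near a regular boundary point, with `e`
pointing strictly into `Ω`. In them Lebesgue measure is `|e · n| dS dr`
(`IsTransversalPatch.map_flow`), so that everything reduces to one-dimensional integration in `r`. A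
general direction is a difference of two inward ones, a partition of unity patches the local
identities together, and cutoffs remove the edges: their gradients have size `k` on a tube of volume
`O(k⁻²)`, which is harmless for `u ∈ L²`. -/

lemma euclideanHausdorffMeasure_image_le {X Y : Type*} [EMetricSpace X] [EMetricSpace Y]
    [MeasurableSpace X] [BorelSpace X] [MeasurableSpace Y] [BorelSpace Y] {K : ℝ≥0} {f : X → Y}
    {s : Set X} (h : LipschitzOnWith K f s) (d : ℕ) :
    μHE[d] (f '' s) ≤ (K : ℝ≥0∞) ^ d * μHE[d] s := by
  simp only [Measure.euclideanHausdorffMeasure_def, Measure.smul_apply, ENNReal.smul_def,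
    smul_eq_mul]
  have h1 := h.hausdorffMeasure_image_le (d := d) (Nat.cast_nonneg d)
  rw [ENNReal.rpow_natCast] at h1
  rw [mul_left_comm]
  gcongr

/-- The flow `(p, r) ↦ p + r e`. -/
def flow (e : E3) (q : E3 × ℝ) : E3 := q.1 + q.2 • e

lemma continuous_flow (e : E3) : Continuous (flow e) := by unfold flow; fun_prop

/-- The projection along `e` onto the plane orthogonal to `n`. -/
def obliqueProj (n e : E3) (x : E3) : E3 := x - (inner ℝ n x / inner ℝ n e) • e

/-- The line `p + ℝ e` meets the plane of height `c` over `n` exactly once, at `r = (c - n·p) /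
(n·e)`. The point reached is the oblique projection of `p` shifted by a vector that does not depend
on `p`. -/
lemma slice_flow_image {n e : E3} (hn : ‖n‖ = 1) (hne : inner ℝ n e ≠ 0) (A : Set E3) (I : Set ℝ)
    (c : ℝ) :
    flow e '' (A ×ˢ I) ∩ (AffineSubspace.mk' (c • n +ᵥ (0 : E3)) (ℝ ∙ n)ᗮ : Set E3) =
      (fun y => y + (c / inner ℝ n e) • e) ''
        (obliqueProj n e '' {p ∈ A | (c - inner ℝ n p) / inner ℝ n e ∈ I}) := by
  have hmem : ∀ y : E3, y ∈ (AffineSubspace.mk' (c • n +ᵥ (0 : E3)) (ℝ ∙ n)ᗮ : Set E3) ↔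
      inner ℝ n y = c := by
    intro y
    rw [SetLike.mem_coe, AffineSubspace.mem_mk', Submodule.mem_orthogonal_singleton_iff_inner_right]
    simp only [vadd_eq_add, add_zero, vsub_eq_sub, inner_sub_right, inner_smul_right,
      real_inner_self_eq_norm_sq, hn]
    constructor <;> intro h <;> linarith
  have hid : ∀ p : E3, obliqueProj n e p + (c / inner ℝ n e) • e =
      p + ((c - inner ℝ n p) / inner ℝ n e) • e := by
    intro p
    rw [obliqueProj, sub_div, sub_smul]
    abel
  ext y
  simp only [mem_inter_iff, hmem]
  constructor
  · rintro ⟨⟨⟨p, r⟩, ⟨hp, hr⟩, rfl⟩, h⟩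
    simp only [flow, inner_add_right, inner_smul_right] at h
    have hr' : r = (c - inner ℝ n p) / inner ℝ n e := by
      rw [eq_div_iff hne]; linarith
    refine ⟨_, ⟨p, ⟨hp, hr' ▸ hr⟩, rfl⟩, ?_⟩
    simp only [hid, flow, hr']
  · rintro ⟨_, ⟨p, ⟨hp, hr⟩, rfl⟩, rfl⟩
    simp only [hid]
    refine ⟨⟨(p, _), ⟨hp, hr⟩, rfl⟩, ?_⟩
    rw [inner_add_right, inner_smul_right, div_mul_cancel₀ _ hne]
    ring

/-- Cavalieri's principle in the direction `n`; the shift of each slice drops out because Hausdorff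
measure is invariant under isometries. -/
lemma volume_flow_image_eq {n e : E3} (hn : ‖n‖ = 1) (hne : inner ℝ n e ≠ 0) {A : Set E3}
    {I : Set ℝ} (hm : MeasurableSet (flow e '' (A ×ˢ I))) :
    volume (flow e '' (A ×ˢ I)) =
      ∫⁻ c : ℝ, μHE[2] (obliqueProj n e '' {p ∈ A | (c - inner ℝ n p) / inner ℝ n e ∈ I}) := by
  have hn0 : n ≠ 0 := by
    rintro rfl
    simp at hn
  have h := EuclideanGeometry.euclideanHausdorffMeasure_eq_lintegral (0 : E3) hn0 hm
  have h3 : Module.finrank ℝ E3 = 3 := by simp [E3]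
  rw [InnerProductSpace.euclideanHausdorffMeasure_eq_volume, h3] at h
  rw [h, show ‖n‖ₑ = 1 by rw [← ofReal_norm, hn, ENNReal.ofReal_one], one_mul]
  refine lintegral_congr fun c => ?_
  rw [slice_flow_image hn hne]
  exact (IsometryEquiv.addRight ((c / inner ℝ n e) • e)).isometry.euclideanHausdorffMeasure_image _

/-- Tonelli on `A × ℝ`: for fixed `p` the admissible heights `c` form an affine image of `I`, of
length `|n·e|` times that of `I`. -/
lemma lintegral_slice {n e : E3} (hne : inner ℝ n e ≠ 0) {A : Set E3}
    (hAfin : μHE[2] A ≠ ∞) {I : Set ℝ} (hI : MeasurableSet I) :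
    ∫⁻ c : ℝ, μHE[2] {p ∈ A | (c - inner ℝ n p) / inner ℝ n e ∈ I} =
      ENNReal.ofReal |inner ℝ n e| * volume I * μHE[2] A := by
  have : IsFiniteMeasure ((μHE[2] : Measure E3).restrict A) :=
    ⟨by rw [Measure.restrict_apply_univ]; exact hAfin.lt_top⟩
  have hW : MeasurableSet {q : E3 × ℝ | (q.2 - inner ℝ n q.1) / inner ℝ n e ∈ I} := by
    have : Measurable fun q : E3 × ℝ => (q.2 - inner ℝ n q.1) / inner ℝ n e :=
      Continuous.measurable (by fun_prop)
    exact this hI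
  have h1 := Measure.prod_apply (μ := (μHE[2] : Measure E3).restrict A) (ν := volume) hW
  have h2 := Measure.prod_apply_symm (μ := (μHE[2] : Measure E3).restrict A) (ν := volume) hW
  rw [h1] at h2
  have h3 : ∀ c : ℝ, μHE[2] {p ∈ A | (c - inner ℝ n p) / inner ℝ n e ∈ I} =
      (μHE[2] : Measure E3).restrict A ((fun x => (x, c)) ⁻¹'
        {q : E3 × ℝ | (q.2 - inner ℝ n q.1) / inner ℝ n e ∈ I}) := by
    intro c
    rw [Measure.restrict_apply (measurable_prodMk_right hW)]
    congr 1
    ext p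
    simp [and_comm]
  simp only [h3]
  rw [← h2]
  have h4 : ∀ p : E3, volume (Prod.mk p ⁻¹'
      {q : E3 × ℝ | (q.2 - inner ℝ n q.1) / inner ℝ n e ∈ I}) =
      ENNReal.ofReal |inner ℝ n e| * volume I := by
    intro p
    have : Prod.mk p ⁻¹' {q : E3 × ℝ | (q.2 - inner ℝ n q.1) / inner ℝ n e ∈ I} =
        (fun c => c + -(inner ℝ n p)) ⁻¹' ((fun c => c * (inner ℝ n e)⁻¹) ⁻¹' I) := by
      ext c
      simp [div_eq_mul_inv, sub_eq_add_neg]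
    rw [this, measure_preimage_add_right, Real.volume_preimage_mul_right (inv_ne_zero hne), inv_inv]
  simp only [h4, lintegral_const, Measure.restrict_apply_univ]

lemma volume_flow_image_le {n e : E3} (hn : ‖n‖ = 1) (hne : inner ℝ n e ≠ 0) {A : Set E3}
    (hAfin : μHE[2] A ≠ ∞) {I : Set ℝ} (hI : MeasurableSet I)
    (hm : MeasurableSet (flow e '' (A ×ˢ I))) {L : ℝ≥0}
    (hL : LipschitzOnWith L (obliqueProj n e) A) :
    volume (flow e '' (A ×ˢ I)) ≤
      (L : ℝ≥0∞) ^ 2 * (ENNReal.ofReal |inner ℝ n e| * volume I * μHE[2] A) := by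
  rw [volume_flow_image_eq hn hne hm, ← lintegral_slice hne hAfin hI,
    ← lintegral_const_mul' _ _ (by simp)]
  exact lintegral_mono fun c =>
    euclideanHausdorffMeasure_image_le (hL.mono fun p hp => hp.1) 2

/-- The hypothesis makes the projection injective on every slice with an `L`-Lipschitz inverse, so
areas shrink by a factor of at most `L²` under projection. Together with `volume_flow_image_le` this
pins the volume down as `L` tends to `1`. -/
lemma le_volume_flow_image {n e : E3} (hn : ‖n‖ = 1) (hne : inner ℝ n e ≠ 0) {A : Set E3}
    (hAfin : μHE[2] A ≠ ∞) {I : Set ℝ} (hI : MeasurableSet I)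
    (hm : MeasurableSet (flow e '' (A ×ˢ I))) {L : ℝ≥0}
    (hL : ∀ x ∈ A, ∀ y ∈ A, dist x y ≤ L * dist (obliqueProj n e x) (obliqueProj n e y)) :
    ENNReal.ofReal |inner ℝ n e| * volume I * μHE[2] A ≤
      (L : ℝ≥0∞) ^ 2 * volume (flow e '' (A ×ˢ I)) := by
  rw [volume_flow_image_eq hn hne hm, ← lintegral_slice hne hAfin hI,
    ← lintegral_const_mul' _ _ (by simp)]
  refine lintegral_mono fun c => ?_
  set B := {p ∈ A | (c - inner ℝ n p) / inner ℝ n e ∈ I} with hB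
  have hinj : InjOn (obliqueProj n e) B := by
    intro x hx y hy hxy
    have := hL x hx.1 y hy.1
    rw [hxy, dist_self, mul_zero] at this
    exact dist_le_zero.1 this
  have hinv : LipschitzOnWith L (Function.invFunOn (obliqueProj n e) B) (obliqueProj n e '' B) := by
    refine LipschitzOnWith.of_dist_le_mul ?_
    rintro _ ⟨x, hx, rfl⟩ _ ⟨y, hy, rfl⟩
    rw [hinj.leftInvOn_invFunOn hx, hinj.leftInvOn_invFunOn hy]
    exact hL x hx.1 y hy.1
  have := euclideanHausdorffMeasure_image_le hinv 2
  rwa [hinj.leftInvOn_invFunOn.image_image] at this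

/-- A measure inequality that holds locally on a set holds on the set. -/
lemma measure_le_of_locally_le {X : Type*} [TopologicalSpace X] [SecondCountableTopology X]
    [MeasurableSpace X] [OpensMeasurableSpace X] {μ ν : Measure X} {S : Set X}
    (h : ∀ x ∈ S, ∃ U : Set X, IsOpen U ∧ x ∈ U ∧ ∀ A, MeasurableSet A → A ⊆ S ∩ U → μ A ≤ ν A)
    {A : Set X} (hA : MeasurableSet A) (hAS : A ⊆ S) : μ A ≤ ν A := by
  choose! U hUo hxU hU using h
  obtain ⟨t, htS, htc, hcov⟩ := TopologicalSpace.countable_cover_nhdsWithin (f := U) (s := S)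
    (fun x hx => mem_nhdsWithin_of_mem_nhds ((hUo x hx).mem_nhds (hxU x hx)))
  rcases t.eq_empty_or_nonempty with rfl | hne
  · have : A = ∅ := by
      have := hAS.trans hcov
      simpa using this
    simp [this]
  obtain ⟨g, rfl⟩ := htc.exists_eq_range hne
  have hg : ∀ i, g i ∈ S := fun i => htS (mem_range_self i)
  have hVm : ∀ i, MeasurableSet (disjointed (fun i => U (g i)) i) := fun i =>
    MeasurableSet.disjointed (fun i => (hUo _ (hg i)).measurableSet) i
  have hAeq : A = ⋃ i, A ∩ disjointed (fun i => U (g i)) i := by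
    rw [← inter_iUnion, iUnion_disjointed, eq_comm, inter_eq_left]
    refine (hAS.trans hcov).trans ?_
    simp
  have hd : Pairwise (Function.onFun Disjoint fun i => A ∩ disjointed (fun i => U (g i)) i) :=
    fun i j hij => (disjoint_disjointed (fun i => U (g i)) hij).mono inter_subset_right
      inter_subset_right
  rw [hAeq, measure_iUnion hd fun i => hA.inter (hVm i),
    measure_iUnion hd fun i => hA.inter (hVm i)]
  refine ENNReal.tsum_le_tsum fun i => hU _ (hg i) _ (hA.inter (hVm i)) ?_
  exact fun x hx => ⟨hAS hx.1, disjointed_subset (fun i => U (g i)) i hx.2⟩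

/-- The flux density `|e · n| dS` on the surface `S` with normal field `N`. -/
def fluxMeasure (S : Set E3) (N : E3 → E3) (e : E3) : Measure E3 :=
  ((μHE[2] : Measure E3).restrict S).withDensity fun p => ENNReal.ofReal |inner ℝ (N p) e|

/-- A piece of surface of finite area with continuous unit normal field `N`, on which the flow along
the transversal direction `e` is injective. -/
structure IsTransversalPatch (S : Set E3) (N : E3 → E3) (e : E3) : Prop where
  measurableSet : MeasurableSet S
  measure_ne_top : μHE[2] S ≠ ∞
  injOn : InjOn (flow e) (S ×ˢ univ)
  norm_eq_one : ∀ p ∈ S, ‖N p‖ = 1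
  inner_ne_zero : ∀ p ∈ S, inner ℝ (N p) e ≠ 0
  continuousOn : ContinuousOn N S
  -- Chords of `S` near `p` are orthogonal to `N p` up to a small relative error. This is what makes
  -- `N` the normal field, and it avoids any parametrization of the surface.
  flat : ∀ p ∈ S, ∀ δ > 0, ∃ U ∈ 𝓝 p, ∀ x ∈ S ∩ U, ∀ y ∈ S ∩ U,
    |inner ℝ (N p) (x - y)| ≤ δ * ‖x - y‖

section

variable {S : Set E3} {N : E3 → E3} {e : E3}

lemma obliqueProj_sub (n e x y : E3) :
    obliqueProj n e x - obliqueProj n e y = (x - y) - (inner ℝ n (x - y) / inner ℝ n e) • e := by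
  simp only [obliqueProj, inner_sub_right, sub_div, sub_smul]
  abel

lemma IsTransversalPatch.measurable_density (h : IsTransversalPatch S N e) :
    AEMeasurable (fun p => ENNReal.ofReal |inner ℝ (N p) e|)
      ((μHE[2] : Measure E3).restrict S) := by
  have h1 : ContinuousOn (fun p => |inner ℝ (N p) e|) S :=
    (h.continuousOn.inner continuousOn_const).abs
  exact (h1.aemeasurable h.measurableSet).ennreal_ofReal

lemma IsTransversalPatch.fluxMeasure_apply {A : Set E3} (hA : MeasurableSet A) (hAS : A ⊆ S) :
    fluxMeasure S N e A = ∫⁻ p in A, ENNReal.ofReal |inner ℝ (N p) e| ∂μHE[2] := by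
  rw [fluxMeasure, withDensity_apply _ hA, Measure.restrict_restrict hA, inter_eq_left.2 hAS]

lemma IsTransversalPatch.measurableSet_flow_image (h : IsTransversalPatch S N e) {A : Set E3}
    (hA : MeasurableSet A) (hAS : A ⊆ S) {I : Set ℝ} (hI : MeasurableSet I) :
    MeasurableSet (flow e '' (A ×ˢ I)) :=
  (hA.prod hI).image_of_continuousOn_injOn (continuous_flow e).continuousOn
    (h.injOn.mono (prod_mono hAS (subset_univ _)))

/-- Near `p` chords are almost orthogonal to `N p`, so the projection along `e` distorts lengths by
a factor of at most `L`, and by continuity the density `|N·e|` also varies by a factor of at most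
`L`. Area contributes `L²` and the density one more `L`. -/
lemma IsTransversalPatch.locally_comparable (h : IsTransversalPatch S N e) {p : E3} (hp : p ∈ S)
    {L : ℝ≥0} (hL : 1 < L) :
    ∃ U : Set E3, IsOpen U ∧ p ∈ U ∧ ∀ A, MeasurableSet A → A ⊆ S ∩ U → ∀ I, MeasurableSet I →
      volume (flow e '' (A ×ˢ I)) ≤ (L : ℝ≥0∞) ^ 3 * (fluxMeasure S N e A * volume I) ∧
      fluxMeasure S N e A * volume I ≤ (L : ℝ≥0∞) ^ 3 * volume (flow e '' (A ×ˢ I)) := by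
  set n := N p with hn
  have hn1 : ‖n‖ = 1 := h.norm_eq_one p hp
  have hne : inner ℝ n e ≠ 0 := h.inner_ne_zero p hp
  have hL' : (1 : ℝ) < L := hL
  have he : e ≠ 0 := by
    intro he
    rw [he, inner_zero_right] at hne
    exact hne rfl
  have hepos : 0 < ‖e‖ := norm_pos_iff.2 he
  have habs : 0 < |inner ℝ n e| := abs_pos.2 hne
  -- With this `δ` the projection moves a chord `x - y` by at most `(L - 1)/L * ‖x - y‖`. This gives
  -- both constants: `1 + (L - 1)/L ≤ L` for the projection and `1 / (1 - (L - 1)/L) = L` for its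
  -- inverse.
  set δ : ℝ := (L - 1) / L * (|inner ℝ n e| / ‖e‖) with hδ
  have hδ0 : 0 < δ := by
    have : (0 : ℝ) < L - 1 := by linarith
    positivity
  obtain ⟨U₁, hU₁, hflat⟩ := h.flat p hp δ hδ0
  have hcont : ContinuousWithinAt (fun q => |inner ℝ (N q) e|) S p :=
    ((h.continuousOn p hp).inner continuousWithinAt_const).abs
  have hev1 : ∀ᶠ q in 𝓝[S] p, |inner ℝ (N q) e| < L * |inner ℝ n e| :=
    hcont.eventually (gt_mem_nhds (by nlinarith))
  have hev2 : ∀ᶠ q in 𝓝[S] p, |inner ℝ n e| < L * |inner ℝ (N q) e| :=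
    (hcont.const_mul (L : ℝ)).eventually (lt_mem_nhds (by nlinarith))
  obtain ⟨U₂, hU₂, hU₂'⟩ := mem_nhdsWithin_iff_exists_mem_nhds_inter.1 (hev1.and hev2)
  obtain ⟨U, hUs, hUo, hpU⟩ := mem_nhds_iff.1 (inter_mem hU₁ hU₂)
  refine ⟨U, hUo, hpU, fun A hA hAS I hI => ?_⟩
  have hAS' : A ⊆ S := fun x hx => (hAS hx).1
  have hAfin : μHE[2] A ≠ ∞ := ne_top_of_le_ne_top h.measure_ne_top (measure_mono hAS')
  have hm := h.measurableSet_flow_image hA hAS' hI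
  have hdiff : ∀ x ∈ A, ∀ y ∈ A, ‖(inner ℝ n (x - y) / inner ℝ n e) • e‖ ≤
      (L - 1) / L * ‖x - y‖ := by
    intro x hx y hy
    have h1 := hflat x ⟨hAS' hx, (hUs (hAS hx).2).1⟩ y ⟨hAS' hy, (hUs (hAS hy).2).1⟩
    rw [norm_smul, Real.norm_eq_abs, abs_div, div_mul_eq_mul_div, div_le_iff₀ habs]
    calc |inner ℝ n (x - y)| * ‖e‖ ≤ (δ * ‖x - y‖) * ‖e‖ := by gcongr
      _ = (L - 1) / L * ‖x - y‖ * |inner ℝ n e| := by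
        rw [hδ]; field_simp
  have hlip : LipschitzOnWith L (obliqueProj n e) A := by
    refine LipschitzOnWith.of_dist_le_mul fun x hx y hy => ?_
    rw [dist_eq_norm, dist_eq_norm, obliqueProj_sub]
    refine (norm_sub_le _ _).trans ?_
    have h1 := hdiff x hx y hy
    have h2 : 1 + ((L : ℝ) - 1) / L ≤ L := by
      rw [← sub_nonneg, show (L : ℝ) - (1 + (L - 1) / L) = (L - 1) ^ 2 / L by field_simp; ring]
      positivity
    have h3 : 0 ≤ ‖x - y‖ := norm_nonneg _
    nlinarith
  have hanti : ∀ x ∈ A, ∀ y ∈ A,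
      dist x y ≤ L * dist (obliqueProj n e x) (obliqueProj n e y) := by
    intro x hx y hy
    rw [dist_eq_norm, dist_eq_norm, obliqueProj_sub]
    have h1 := hdiff x hx y hy
    have h2 := norm_sub_norm_le (x - y) ((inner ℝ n (x - y) / inner ℝ n e) • e)
    have h3 : (L : ℝ) * (‖x - y‖ - (L - 1) / L * ‖x - y‖) = ‖x - y‖ := by
      field_simp; ring
    have h4 : (L : ℝ) * (‖x - y‖ - (L - 1) / L * ‖x - y‖) ≤
        L * ‖x - y - (inner ℝ n (x - y) / inner ℝ n e) • e‖ := by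
      gcongr
      linarith
    linarith
  have hν1 : ENNReal.ofReal |inner ℝ n e| * μHE[2] A ≤ L * fluxMeasure S N e A := by
    rw [fluxMeasure_apply hA hAS', ← lintegral_const_mul' _ _ (by simp), ← setLIntegral_const]
    refine setLIntegral_mono' hA fun q hq => ?_
    rw [← ENNReal.ofReal_coe_nnreal, ← ENNReal.ofReal_mul (by positivity)]
    exact ENNReal.ofReal_le_ofReal (hU₂' ⟨(hUs (hAS hq).2).2, hAS' hq⟩).2.le
  have hν2 : fluxMeasure S N e A ≤ L * (ENNReal.ofReal |inner ℝ n e| * μHE[2] A) := by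
    rw [fluxMeasure_apply hA hAS', ← mul_assoc, ← setLIntegral_const]
    refine setLIntegral_mono' hA fun q hq => ?_
    rw [← ENNReal.ofReal_coe_nnreal, ← ENNReal.ofReal_mul (by positivity)]
    exact ENNReal.ofReal_le_ofReal (hU₂' ⟨(hUs (hAS hq).2).2, hAS' hq⟩).1.le
  constructor
  · calc volume (flow e '' (A ×ˢ I))
        ≤ (L : ℝ≥0∞) ^ 2 * (ENNReal.ofReal |inner ℝ n e| * volume I * μHE[2] A) :=
          volume_flow_image_le hn1 hne hAfin hI hm hlip
      _ = (L : ℝ≥0∞) ^ 2 * (ENNReal.ofReal |inner ℝ n e| * μHE[2] A * volume I) := by ring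
      _ ≤ (L : ℝ≥0∞) ^ 2 * (L * fluxMeasure S N e A * volume I) := by gcongr
      _ = _ := by ring
  · calc fluxMeasure S N e A * volume I
        ≤ L * (ENNReal.ofReal |inner ℝ n e| * μHE[2] A) * volume I := by gcongr
      _ = L * (ENNReal.ofReal |inner ℝ n e| * volume I * μHE[2] A) := by ring
      _ ≤ L * ((L : ℝ≥0∞) ^ 2 * volume (flow e '' (A ×ˢ I))) := by
        exact mul_le_mul_right (le_volume_flow_image hn1 hne hAfin hI hm hanti) _
      _ = _ := by ring

lemma ENNReal_le_of_forall_one_lt_pow_mul {a b : ℝ≥0∞}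
    (h : ∀ L : ℝ≥0, 1 < L → a ≤ (L : ℝ≥0∞) ^ 3 * b) : a ≤ b := by
  have h1 : Tendsto (fun L : ℝ≥0 => (L : ℝ≥0∞) ^ 3 * b) (𝓝[>] 1)
      (𝓝 (((1 : ℝ≥0) : ℝ≥0∞) ^ 3 * b)) := by
    have h2 : Tendsto (fun L : ℝ≥0 => (L : ℝ≥0∞) ^ 3) (𝓝[>] 1) (𝓝 (((1 : ℝ≥0) : ℝ≥0∞) ^ 3)) :=
      (((ENNReal.continuous_pow 3).comp ENNReal.continuous_coe).tendsto 1).mono_left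
        nhdsWithin_le_nhds
    exact ENNReal.Tendsto.mul_const h2 (Or.inl (by simp))
  simp only [ENNReal.coe_one, one_pow, one_mul] at h1
  exact ge_of_tendsto h1 (eventually_nhdsWithin_of_forall h)

/-- The flow transports `|e · n| dS ⊗ dr` to Lebesgue measure. -/
theorem IsTransversalPatch.map_flow (h : IsTransversalPatch S N e) :
    Measure.map (flow e) ((fluxMeasure S N e).prod volume) =
      volume.restrict (flow e '' (S ×ˢ univ)) := by
  have hSm : MeasurableSet (S ×ˢ (univ : Set ℝ)) := h.measurableSet.prod MeasurableSet.univ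
  have hemb : MeasurableEmbedding ((S ×ˢ (univ : Set ℝ)).domRestrict (flow e)) :=
    (continuous_flow e).continuousOn.measurableEmbedding hSm h.injOn
  -- `M` is Lebesgue measure pulled back through the injective flow and carried by `S × ℝ`. The
  -- theorem says that `M` is the product measure, and this needs checking on rectangles only.
  set M : Measure (E3 × ℝ) := Measure.map Subtype.val
    (Measure.comap ((S ×ˢ (univ : Set ℝ)).domRestrict (flow e)) volume) with hM
  have hMapply : ∀ W : Set (E3 × ℝ), MeasurableSet W →
      M W = volume (flow e '' (W ∩ S ×ˢ univ)) := by
    intro W hW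
    rw [hM, Measure.map_apply measurable_subtype_coe hW, hemb.comap_apply]
    congr 1
    ext y
    simp only [mem_image, mem_preimage, Subtype.exists, Set.domRestrict_apply, mem_inter_iff]
    constructor
    · rintro ⟨q, hq, hqW, rfl⟩
      exact ⟨q, ⟨hqW, hq⟩, rfl⟩
    · rintro ⟨q, ⟨hqW, hq⟩, rfl⟩
      exact ⟨q, hq, hqW, rfl⟩
  have hrect : ∀ A : Set E3, MeasurableSet A → A ⊆ S → ∀ I : Set ℝ, MeasurableSet I →
      volume (flow e '' (A ×ˢ I)) = fluxMeasure S N e A * volume I := by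
    intro A hA hAS I hI
    -- For fixed `I` both sides are measures in `A`. Hence the local comparison with factor `L³`
    -- extends to all of `S` for every `L > 1`, and letting `L` tend to `1` gives equality.
    set m : Measure E3 := Measure.map Prod.fst (M.restrict (univ ×ˢ I)) with hm
    have hmapply : ∀ B, MeasurableSet B → B ⊆ S → m B = volume (flow e '' (B ×ˢ I)) := by
      intro B hB hBS
      rw [hm, Measure.map_apply measurable_fst hB,
        Measure.restrict_apply (measurable_fst hB), hMapply _
        ((measurable_fst hB).inter (MeasurableSet.univ.prod hI))]
      congr 2
      ext ⟨p, r⟩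
      simp only [mem_inter_iff, mem_preimage, mem_prod, mem_univ, true_and, and_true]
      exact ⟨fun h => ⟨h.1.1, h.1.2⟩, fun h => ⟨⟨h.1, h.2⟩, hBS h.1⟩⟩
    have hk : ∀ {B}, MeasurableSet B → (volume I • fluxMeasure S N e) B =
        fluxMeasure S N e B * volume I := by
      intro B _
      rw [Measure.smul_apply, smul_eq_mul, mul_comm]
    rw [← hmapply A hA hAS, ← hk hA]
    refine le_antisymm ?_ ?_
    · refine ENNReal_le_of_forall_one_lt_pow_mul fun L hL => ?_
      have := measure_le_of_locally_le (μ := m)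
        (ν := ((L : ℝ≥0∞) ^ 3) • (volume I • fluxMeasure S N e)) (S := S) (A := A) ?_ hA hAS
      · simpa using this
      intro p hp
      obtain ⟨U, hU, hpU, hUA⟩ := h.locally_comparable hp hL
      refine ⟨U, hU, hpU, fun B hB hBS => ?_⟩
      rw [hmapply B hB (hBS.trans inter_subset_left), Measure.smul_apply, hk hB]
      exact (hUA B hB hBS I hI).1
    · refine ENNReal_le_of_forall_one_lt_pow_mul fun L hL => ?_
      have := measure_le_of_locally_le (μ := volume I • fluxMeasure S N e)
        (ν := ((L : ℝ≥0∞) ^ 3) • m) (S := S) (A := A) ?_ hA hAS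
      · simpa using this
      intro p hp
      obtain ⟨U, hU, hpU, hUA⟩ := h.locally_comparable hp hL
      refine ⟨U, hU, hpU, fun B hB hBS => ?_⟩
      rw [hk hB, Measure.smul_apply, smul_eq_mul, hmapply B hB (hBS.trans inter_subset_left)]
      exact (hUA B hB hBS I hI).2
  have hfin : IsFiniteMeasure ((μHE[2] : Measure E3).restrict S) :=
    ⟨by rw [Measure.restrict_apply_univ]; exact h.measure_ne_top.lt_top⟩
  have hsf : SigmaFinite (fluxMeasure S N e) :=
    SigmaFinite.withDensity_of_ne_top (by simp)
  have hprod : (fluxMeasure S N e).prod volume = M := by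
    refine Measure.prod_eq fun A I hA hI => ?_
    rw [hMapply _ (hA.prod hI)]
    have h1 : A ×ˢ I ∩ S ×ˢ univ = (A ∩ S) ×ˢ I := by
      rw [prod_inter_prod, inter_univ]
    rw [h1, hrect _ (hA.inter h.measurableSet) inter_subset_right I hI]
    congr 1
    rw [fluxMeasure, withDensity_apply _ hA, withDensity_apply _ (hA.inter h.measurableSet),
      Measure.restrict_restrict hA, Measure.restrict_restrict (hA.inter h.measurableSet),
      inter_assoc, inter_self]
  rw [hprod, hM, Measure.map_map (continuous_flow e).measurable measurable_subtype_coe]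
  have : flow e ∘ Subtype.val = (S ×ˢ (univ : Set ℝ)).domRestrict (flow e) := rfl
  rw [this, hemb.map_comap, Set.range_domRestrict]

end

/-! ### Local structure of the boundary -/

lemma IsOutwardNormal.outwardNormal_eq {Ω : Set E3} {p n : E3} (h : IsOutwardNormal Ω p n) :
    outwardNormal Ω p = n := by
  have hex : ∃ n, IsOutwardNormal Ω p n := ⟨n, h⟩
  rw [outwardNormal, dif_pos hex]
  exact hex.choose_spec.unique h

lemma exists_isOutwardNormal_of_ne_zero {Ω : Set E3} {p : E3} (h : outwardNormal Ω p ≠ 0) :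
    ∃ n, IsOutwardNormal Ω p n := by
  by_contra hcon
  exact h (by rw [outwardNormal, dif_neg hcon])

lemma IsOutwardNormal.norm_eq_one {Ω : Set E3} {p n : E3} (h : IsOutwardNormal Ω p n) :
    ‖n‖ = 1 := by
  obtain ⟨-, ρ, -, hρ0, -, rfl⟩ := h
  rw [norm_smul, norm_inv, norm_norm, inv_mul_cancel₀ (norm_ne_zero_iff.2 hρ0)]

lemma inner_gradient (ρ : E3 → ℝ) (p v : E3) : inner ℝ (gradient ρ p) v = fderiv ℝ ρ p v := by
  simp [gradient]

/-- Near a boundary point at which `e` points strictly into `Ω`, the boundary is a transversal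
patch, with `Ω` lying on the side of it towards which `e` points. -/
structure IsInflowPatch (Ω : Set E3) (p₀ e : E3) (R R' : ℝ) : Prop where
  pos : 0 < R'
  le : R' ≤ R
  patch : IsTransversalPatch (frontier Ω ∩ Metric.ball p₀ R) (outwardNormal Ω) e
  inner_neg : ∀ p ∈ frontier Ω ∩ Metric.ball p₀ R, inner ℝ (outwardNormal Ω p) e < 0
  mem_of_flow : ∀ p ∈ frontier Ω ∩ Metric.ball p₀ R, ∀ r > 0,
    flow e (p, r) ∈ Metric.ball p₀ R → flow e (p, r) ∈ Ω
  exists_flow : ∀ x ∈ Ω ∩ Metric.ball p₀ R', ∃ r > 0,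
    ∃ p ∈ frontier Ω ∩ Metric.ball p₀ R, flow e (p, r) = x

/-- In a small ball the defining function `ρ` decreases along `e` at a rate of at least `κ`. A line
in direction `e` therefore meets `∂Ω` at most once in the ball and lies in `Ω` beyond that point;
conversely, moving back from a point of `Ω` close to `p₀` makes `ρ` positive, so the line has
crossed `∂Ω`. -/
lemma exists_isInflowPatch {Ω : Set E3} (hΩ : IsOpen Ω) (hfin : μHE[2] (frontier Ω) < ∞)
    {p₀ n e : E3} (hp₀ : IsOutwardNormal Ω p₀ n) (he : inner ℝ n e < 0) :
    ∃ R R', IsInflowPatch Ω p₀ e R R' := by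
  obtain ⟨hfr, ρ, hρ, hρ0, hρΩ, rfl⟩ := hp₀
  have hpos0 : 0 < ‖gradient ρ p₀‖ := norm_pos_iff.2 hρ0
  have hde : fderiv ℝ ρ p₀ e < 0 := by
    rw [inner_smul_left, inner_gradient] at he
    simp only [conj_trivial] at he
    by_contra hcon
    exact absurd he (not_lt.2 (mul_nonneg (inv_nonneg.2 hpos0.le) (not_lt.1 hcon)))
  -- Half the slope at `p₀`, so that by continuity of `fderiv ℝ ρ` the bound `-κ` persists in a
  -- ball.
  set κ : ℝ := -fderiv ℝ ρ p₀ e / 2 with hκ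
  have hκ0 : 0 < κ := by rw [hκ]; linarith
  have hcd : ∀ᶠ q in 𝓝 p₀, ContDiffAt ℝ 1 ρ q := hρ.eventually (by simp)
  have hfd : ContinuousAt (fderiv ℝ ρ) p₀ := (hρ.fderiv_right (m := 0) (by simp)).continuousAt
  have hev1 : ∀ᶠ q in 𝓝 p₀, fderiv ℝ ρ q e < -κ :=
    (hfd.clm_apply continuousAt_const).eventually (gt_mem_nhds (by rw [hκ]; linarith))
  have hall := hcd.and (hev1.and hρΩ)
  obtain ⟨R, hR, hball⟩ := Metric.eventually_nhds_iff_ball.1 hall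
  have hcdB : ∀ q ∈ Metric.ball p₀ R, ContDiffAt ℝ 1 ρ q := fun q hq => (hball q hq).1
  have hdB : ∀ q ∈ Metric.ball p₀ R, fderiv ℝ ρ q e < -κ := fun q hq => (hball q hq).2.1
  have hΩB : ∀ q ∈ Metric.ball p₀ R, (q ∈ Ω ↔ ρ q < 0) := fun q hq => (hball q hq).2.2
  have hgB : ∀ q ∈ Metric.ball p₀ R, gradient ρ q ≠ 0 := by
    intro q hq h0
    have := hdB q hq
    rw [← inner_gradient, h0, inner_zero_left] at this
    linarith
  have hnhds : ∀ q ∈ Metric.ball p₀ R, ∀ᶠ y in 𝓝 q, (y ∈ Ω ↔ ρ y < 0) := fun q hq =>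
    eventually_of_mem (Metric.isOpen_ball.mem_nhds hq) hΩB
  have hN : ∀ q ∈ frontier Ω ∩ Metric.ball p₀ R,
      IsOutwardNormal Ω q (‖gradient ρ q‖⁻¹ • gradient ρ q) := fun q hq =>
    ⟨hq.1, ρ, hcdB q hq.2, hgB q hq.2, hnhds q hq.2, rfl⟩
  have hzero : ∀ q ∈ frontier Ω ∩ Metric.ball p₀ R, ρ q = 0 := fun q hq =>
    apply_eq_zero_of_mem_frontier hq.1 (hcdB q hq.2).continuousAt (hnhds q hq.2)
  have hnormal : ∀ q ∈ frontier Ω ∩ Metric.ball p₀ R,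
      outwardNormal Ω q = ‖gradient ρ q‖⁻¹ • gradient ρ q := fun q hq =>
    (hN q hq).outwardNormal_eq
  have hneg : ∀ q ∈ frontier Ω ∩ Metric.ball p₀ R, inner ℝ (outwardNormal Ω q) e < 0 := by
    intro q hq
    rw [hnormal q hq, inner_smul_left, inner_gradient]
    have h1 := hdB q hq.2
    have h2 : 0 < ‖gradient ρ q‖ := norm_pos_iff.2 (hgB q hq.2)
    simp only [conj_trivial]
    exact mul_neg_of_pos_of_neg (inv_pos.2 h2) (by linarith)
  have hdec : ∀ x ∈ Metric.ball p₀ R, ∀ r > 0, flow e (x, r) ∈ Metric.ball p₀ R →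
      ρ (flow e (x, r)) < ρ x - κ * r := by
    intro x hx r hr hy
    -- Convexity of the ball keeps the whole segment inside it, so that the mean value theorem
    -- applies.
    have hseg : ∀ s ∈ Icc 0 r, x + s • e ∈ Metric.ball p₀ R := by
      intro s hs
      have h1 := (convex_ball p₀ R) hx hy (a := 1 - s / r) (b := s / r)
        (sub_nonneg.2 ((div_le_one hr).2 hs.2)) (div_nonneg hs.1 hr.le) (by ring)
      convert h1 using 1
      simp only [flow, smul_add, sub_smul, one_smul, smul_smul, div_mul_cancel₀ _ hr.ne']
      abel
    have hder : ∀ s ∈ Icc 0 r, HasDerivAt (fun s : ℝ => ρ (x + s • e)) (fderiv ℝ ρ (x + s • e) e)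
        s := by
      intro s hs
      have h1 := ((hcdB _ (hseg s hs)).differentiableAt (by simp)).hasFDerivAt
      have h2 : HasDerivAt (fun s : ℝ => x + s • e) e s := by
        simpa using ((hasDerivAt_id s).smul_const e).const_add x
      exact h1.comp_hasDerivAt s h2
    obtain ⟨c, hc, hc'⟩ := exists_hasDerivAt_eq_slope (fun s : ℝ => ρ (x + s • e)) _ hr
      (fun s hs => (hder s hs).continuousAt.continuousWithinAt)
      (fun s hs => hder s (Ioo_subset_Icc_self hs))
    have h3 := hdB _ (hseg c (Ioo_subset_Icc_self hc))
    rw [hc', sub_zero, div_lt_iff₀ hr] at h3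
    simp only [zero_smul, add_zero] at h3
    simp only [flow]
    linarith
  have hmem : ∀ p ∈ frontier Ω ∩ Metric.ball p₀ R, ∀ r > 0,
      flow e (p, r) ∈ Metric.ball p₀ R → flow e (p, r) ∈ Ω := by
    intro p hp r hr hy
    have := hdec p hp.2 r hr hy
    rw [hzero p hp] at this
    rw [hΩB _ hy]
    nlinarith
  have hfrΩ : ∀ {q}, q ∈ frontier Ω → q ∉ Ω := by
    intro q hq hqΩ
    rw [hΩ.frontier_eq] at hq
    exact hq.2 hqΩ
  -- A backward step of length up to `r₁` from the ball of radius `R / 2` stays in the ball of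
  -- radius `R`. In the smaller ball chosen below `ρ > -κ r₁`, so a full backward step makes `ρ`
  -- positive.
  set r₁ : ℝ := R / (2 * (‖e‖ + 1)) with hr₁
  have hr₁0 : 0 < r₁ := by positivity
  have hr₁e : r₁ * ‖e‖ < R / 2 := by
    rw [hr₁, div_mul_eq_mul_div, div_lt_div_iff₀ (by positivity) two_pos]
    nlinarith [norm_nonneg e]
  have hρp₀ : ρ p₀ = 0 := hzero p₀ ⟨hfr, Metric.mem_ball_self hR⟩
  have hev2 : ∀ᶠ q in 𝓝 p₀, -(κ * r₁) < ρ q :=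
    hρ.continuousAt.eventually (lt_mem_nhds (by rw [hρp₀]; nlinarith))
  obtain ⟨R₂, hR₂, hball₂⟩ := Metric.eventually_nhds_iff_ball.1 hev2
  refine ⟨R, min R₂ (R / 2), lt_min hR₂ (half_pos hR), (min_le_right _ _).trans (by linarith),
    ?_, hneg, hmem, ?_⟩
  · refine ⟨isClosed_frontier.measurableSet.inter Metric.isOpen_ball.measurableSet,
      ne_top_of_le_ne_top hfin.ne (measure_mono inter_subset_left), ?_, ?_,
      fun p hp => (hneg p hp).ne, ?_, ?_⟩
    -- Of two boundary points on the same line the later one would lie in `Ω`, but an open set is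
    -- disjoint from its frontier.
    · have aux : ∀ p ∈ frontier Ω ∩ Metric.ball p₀ R, ∀ q ∈ frontier Ω ∩ Metric.ball p₀ R,
          ∀ r s : ℝ, flow e (p, r) = flow e (q, s) → ¬ s < r := by
        intro p hp q hq r s h hsr
        have h1 : flow e (p, r - s) = q := by
          simp only [flow, sub_smul] at h ⊢
          rw [← add_sub_assoc, h, add_sub_cancel_right]
        exact hfrΩ hq.1 (h1 ▸ hmem p hp (r - s) (by linarith) (by rw [h1]; exact hq.2))
      rintro ⟨p, r⟩ ⟨hp, -⟩ ⟨q, s⟩ ⟨hq, -⟩ h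
      have hrs : r = s := le_antisymm (not_lt.1 (aux p hp q hq r s h))
        (not_lt.1 (aux q hq p hp s r h.symm))
      subst hrs
      simp only [flow, add_left_inj] at h
      rw [h]
    · exact fun p hp => by rw [hnormal p hp]; exact (hN p hp).norm_eq_one
    · have h1 : ContinuousOn (fun q => ‖gradient ρ q‖⁻¹ • gradient ρ q)
          (frontier Ω ∩ Metric.ball p₀ R) := by
        have hg : ContinuousOn (gradient ρ) (frontier Ω ∩ Metric.ball p₀ R) := by
          intro q hq
          have : ContinuousAt (fderiv ℝ ρ) q :=
            ((hcdB q hq.2).fderiv_right (m := 0) (by simp)).continuousAt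
          exact (((InnerProductSpace.toDual ℝ E3).symm.continuous.continuousAt).comp
            this).continuousWithinAt
        exact (hg.norm.inv₀ fun q hq => norm_ne_zero_iff.2 (hgB q hq.2)).smul hg
      exact h1.congr hnormal
    · intro p hp δ hδ
      have hs := (hcdB p hp.2).hasStrictFDerivAt (by simp)
      have hg0 : 0 < ‖gradient ρ p‖ := norm_pos_iff.2 (hgB p hp.2)
      have h1 := hs.isLittleO.def (c := δ * ‖gradient ρ p‖) (by positivity)
      rw [nhds_prod_eq, Filter.Eventually, mem_prod_same_iff] at h1
      obtain ⟨U, hU, hU'⟩ := h1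
      refine ⟨U, hU, fun x hx y hy => ?_⟩
      have h2 := hU' (mk_mem_prod hx.2 hy.2)
      simp only [mem_ofPred_eq, hzero x hx.1, hzero y hy.1, sub_self, zero_sub, norm_neg] at h2
      rw [hnormal p hp, inner_smul_left, inner_gradient]
      simp only [conj_trivial]
      rw [abs_mul, abs_inv, abs_norm, inv_mul_le_iff₀ hg0, ← Real.norm_eq_abs]
      linarith
  · rintro x ⟨hx, hxb⟩
    have hx1 : x ∈ Metric.ball p₀ (R / 2) := Metric.ball_subset_ball (min_le_right _ _) hxb
    have hx2 := hball₂ x (Metric.ball_subset_ball (min_le_left _ _) hxb)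
    have hxR : x ∈ Metric.ball p₀ R := Metric.ball_subset_ball (by linarith) hx1
    have hin : ∀ r ∈ Icc 0 r₁, x + (-r) • e ∈ Metric.ball p₀ R := by
      intro r hr
      rw [mem_ball_iff_norm] at hx1 ⊢
      have h1 : x + (-r) • e - p₀ = (x - p₀) - r • e := by rw [neg_smul]; abel
      rw [h1]
      refine (norm_sub_le _ _).trans_lt ?_
      rw [norm_smul, Real.norm_eq_abs, abs_of_nonneg hr.1]
      have := mul_le_mul_of_nonneg_right hr.2 (norm_nonneg e)
      linarith
    have hneg' : ρ x < 0 := (hΩB x hxR).1 hx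
    have hpos' : 0 < ρ (x + (-r₁) • e) := by
      have h1 := hdec (x + (-r₁) • e) (hin r₁ ⟨hr₁0.le, le_rfl⟩) r₁ hr₁0
      have h2 : flow e (x + (-r₁) • e, r₁) = x := by simp [flow]
      rw [h2] at h1
      linarith [h1 hxR]
    have hcont : ContinuousOn (fun r : ℝ => ρ (x + (-r) • e)) (Icc 0 r₁) := by
      intro r hr
      have h1 : ContinuousAt (fun r : ℝ => x + (-r) • e) r := by fun_prop
      exact (ContinuousAt.comp (f := fun r : ℝ => x + (-r) • e) (hcdB _ (hin r hr)).continuousAt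
        h1).continuousWithinAt
    obtain ⟨r, hr, hr0⟩ := intermediate_value_Icc hr₁0.le hcont (show (0 : ℝ) ∈ Icc _ _ by
      simp only [neg_zero, zero_smul, add_zero]
      exact ⟨hneg'.le, hpos'.le⟩)
    have hrpos : 0 < r := by
      rcases hr.1.eq_or_lt with h | h
      · rw [← h] at hr0
        simp only [neg_zero, zero_smul, add_zero] at hr0
        linarith
      · exact h
    set q := x + (-r) • e with hq
    have hqb : q ∈ Metric.ball p₀ R := hin r hr
    have hq0 : ρ q = 0 := hr0
    refine ⟨r, hrpos, q, ⟨?_, hqb⟩, by simp [flow, hq]⟩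
    rw [hΩ.frontier_eq]
    refine ⟨?_, fun hqΩ => by rw [hΩB q hqb] at hqΩ; linarith⟩
    -- Points slightly ahead of `q` have `ρ < 0`, so they lie in `Ω` and put `q` in its closure.
    have hlim : Tendsto (fun s : ℝ => flow e (q, s)) (𝓝[>] 0) (𝓝 q) := by
      have h1 : Continuous fun s : ℝ => flow e (q, s) := by unfold flow; fun_prop
      have h2 := h1.tendsto 0
      simp only [flow, zero_smul, add_zero] at h2
      exact h2.mono_left nhdsWithin_le_nhds
    refine mem_closure_of_tendsto hlim ?_
    filter_upwards [hlim.eventually (Metric.isOpen_ball.mem_nhds hqb), self_mem_nhdsWithin]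
      with s hs hs0
    have h3 := hdec q hqb s hs0 hs
    have hs0' : (0 : ℝ) < s := hs0
    rw [hΩB _ hs]
    nlinarith

/-! ### Integration along the lines in a transversal direction -/

instance : (volume : Measure SpaceTime).IsAddHaarMeasure :=
  Measure.prod.instIsAddHaarMeasure _ _

/-- The flow `((p, t), r) ↦ (p + r e, t)`. -/
def flowT (e : E3) (q : SpaceTime × ℝ) : SpaceTime := (flow e (q.1.1, q.2), q.1.2)

lemma continuous_flowT (e : E3) : Continuous (flowT e) := by unfold flowT flow; fun_prop

/-- The measure `|e · n| dS dt` on the part of the lateral boundary near `p₀`. -/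
def lateralFlux (Ω : Set E3) (T : ℝ) (p₀ e : E3) (R : ℝ) : Measure SpaceTime :=
  (fluxMeasure (frontier Ω ∩ Metric.ball p₀ R) (outwardNormal Ω) e).prod
    (volume.restrict (Ioo 0 T))

lemma cyl_isOpen {Ω : Set E3} (hΩ : IsOpen Ω) (T : ℝ) : IsOpen (cyl Ω T) := hΩ.prod isOpen_Ioo

section

variable {Ω : Set E3} {T : ℝ} {p₀ e : E3} {R R' : ℝ}

lemma IsTransversalPatch.sigmaFinite {S : Set E3} {N : E3 → E3} (h : IsTransversalPatch S N e) :
    SigmaFinite (fluxMeasure S N e) := by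
  have hfin : IsFiniteMeasure ((μHE[2] : Measure E3).restrict S) :=
    ⟨by rw [Measure.restrict_apply_univ]; exact h.measure_ne_top.lt_top⟩
  exact SigmaFinite.withDensity_of_ne_top (by simp)

lemma IsInflowPatch.sigmaFinite_lateralFlux (h : IsInflowPatch Ω p₀ e R R') :
    SigmaFinite (lateralFlux Ω T p₀ e R) := by
  have := h.patch.sigmaFinite
  unfold lateralFlux
  infer_instance

lemma IsInflowPatch.ae_mem (h : IsInflowPatch Ω p₀ e R R') :
    ∀ᵐ q ∂(lateralFlux Ω T p₀ e R), q.1 ∈ frontier Ω ∩ Metric.ball p₀ R ∧ q.2 ∈ Ioo 0 T := by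
  have := h.patch.sigmaFinite
  have h1 : ∀ᵐ p ∂(fluxMeasure (frontier Ω ∩ Metric.ball p₀ R) (outwardNormal Ω) e),
      p ∈ frontier Ω ∩ Metric.ball p₀ R :=
    (withDensity_absolutelyContinuous _ _).ae_le (ae_restrict_mem h.patch.measurableSet)
  have h2 : ∀ᵐ t ∂((volume : Measure ℝ).restrict (Ioo 0 T)), t ∈ Ioo 0 T :=
    ae_restrict_mem measurableSet_Ioo
  exact (Measure.quasiMeasurePreserving_fst.ae h1).and (Measure.quasiMeasurePreserving_snd.ae h2)

/-- Time is a spectator: after a permutation of the factors this is `IsTransversalPatch.map_flow`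
times the identity on `(0, T)`. -/
lemma IsInflowPatch.measurePreserving_flowT (h : IsInflowPatch Ω p₀ e R R') :
    MeasurePreserving (flowT e) ((lateralFlux Ω T p₀ e R).prod volume)
      ((volume : Measure SpaceTime).restrict
        ((flow e '' ((frontier Ω ∩ Metric.ball p₀ R) ×ˢ univ)) ×ˢ Ioo 0 T)) := by
  have := h.patch.sigmaFinite
  set φS := fluxMeasure (frontier Ω ∩ Metric.ball p₀ R) (outwardNormal Ω) e
  set ν : Measure ℝ := volume.restrict (Ioo 0 T)
  have m1 : MeasurePreserving (MeasurableEquiv.prodAssoc : (E3 × ℝ) × ℝ ≃ᵐ _)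
      ((φS.prod ν).prod volume) (φS.prod (ν.prod volume)) := measurePreserving_prodAssoc _ _ _
  have m2 : MeasurePreserving (Prod.map id Prod.swap : E3 × (ℝ × ℝ) → E3 × (ℝ × ℝ))
      (φS.prod (ν.prod volume)) (φS.prod ((volume : Measure ℝ).prod ν)) :=
    (MeasurePreserving.id φS).prod Measure.measurePreserving_swap
  have m3 : MeasurePreserving ((MeasurableEquiv.prodAssoc : (E3 × ℝ) × ℝ ≃ᵐ _).symm)
      (φS.prod ((volume : Measure ℝ).prod ν)) ((φS.prod volume).prod ν) :=
    (measurePreserving_prodAssoc _ _ _).symm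
  have m4 : MeasurePreserving (flow e) (φS.prod volume)
      (volume.restrict (flow e '' ((frontier Ω ∩ Metric.ball p₀ R) ×ˢ univ))) :=
    ⟨(continuous_flow e).measurable, h.patch.map_flow⟩
  have m5 := ((m4.prod (MeasurePreserving.id ν)).comp m3).comp (m2.comp m1)
  rw [Measure.volume_eq_prod, ← Measure.prod_restrict]
  exact m5

/-- A point of `Ω` in the small ball is reached with some positive parameter, and injectivity of the
flow makes this parameter equal to `r`. -/
lemma IsInflowPatch.flow_mem_iff (h : IsInflowPatch Ω p₀ e R R') {p : E3}
    (hp : p ∈ frontier Ω ∩ Metric.ball p₀ R) {r : ℝ} (hy : flow e (p, r) ∈ Metric.ball p₀ R') :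
    flow e (p, r) ∈ Ω ↔ 0 < r := by
  constructor
  · intro hyΩ
    obtain ⟨s, hs, q, hq, hqs⟩ := h.exists_flow _ ⟨hyΩ, hy⟩
    have := h.patch.injOn (mk_mem_prod hq (mem_univ s)) (mk_mem_prod hp (mem_univ r)) hqs
    rw [Prod.mk.injEq] at this
    exact this.2 ▸ hs
  · intro hr
    exact h.mem_of_flow p hp r hr (Metric.ball_subset_ball h.le hy)

/-- Change of variables `(x, t) = (p + r e, t)` for functions supported near `p₀`. -/
theorem IsInflowPatch.integral_cyl (h : IsInflowPatch Ω p₀ e R R') (hΩ : IsOpen Ω)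
    {G : SpaceTime → ℂ} (hG : IntegrableOn G (cyl Ω T))
    (hsupp : ∀ q : SpaceTime, q.1 ∉ Metric.ball p₀ R' → G q = 0) :
    Integrable (fun x : SpaceTime × ℝ => G (flowT e x))
      ((lateralFlux Ω T p₀ e R).prod (volume.restrict (Ioi 0))) ∧
    ∫ q in cyl Ω T, G q =
      ∫ q, (∫ r in Ioi (0 : ℝ), G (flowT e (q, r))) ∂(lateralFlux Ω T p₀ e R) := by
  have := h.sigmaFinite_lateralFlux (T := T)
  set S := frontier Ω ∩ Metric.ball p₀ R with hS
  have hmp := h.measurePreserving_flowT (T := T)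
  rw [← hS] at hmp
  set F := flow e '' (S ×ˢ univ) with hF
  have hFm : MeasurableSet F := h.patch.measurableSet_flow_image h.patch.measurableSet subset_rfl
    MeasurableSet.univ
  set D : Set SpaceTime := (Ω ∩ Metric.ball p₀ R') ×ˢ Ioo 0 T with hD
  have hDm : MeasurableSet D :=
    (hΩ.measurableSet.inter Metric.isOpen_ball.measurableSet).prod measurableSet_Ioo
  have hcm : MeasurableSet (cyl Ω T) := (cyl_isOpen hΩ T).measurableSet
  have hDc : D ⊆ cyl Ω T := prod_mono inter_subset_left subset_rfl
  have hDF : D ⊆ F ×ˢ Ioo 0 T := by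
    refine prod_mono (fun x hx => ?_) subset_rfl
    obtain ⟨r, -, p, hp, hpr⟩ := h.exists_flow x hx
    exact ⟨(p, r), ⟨hp, mem_univ _⟩, hpr⟩
  set G' := D.indicator G with hG'
  have hG'i : Integrable G' := (integrable_indicator_iff hDm).2 (hG.mono_set hDc)
  have hind : (cyl Ω T).indicator G = G' := by
    ext q
    by_cases hq : q ∈ cyl Ω T
    · by_cases hb : q.1 ∈ Metric.ball p₀ R'
      · rw [hG', indicator_of_mem hq, indicator_of_mem (show q ∈ D from ⟨⟨hq.1, hb⟩, hq.2⟩)]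
      · rw [hG', indicator_of_mem hq, indicator_of_notMem (fun hq' => hb hq'.1.2), hsupp q hb]
    · rw [hG', indicator_of_notMem hq, indicator_of_notMem fun hq' => hq (hDc hq')]
  have hcomp : Integrable (fun x : SpaceTime × ℝ => G' (flowT e x))
      ((lateralFlux Ω T p₀ e R).prod volume) :=
    hmp.integrable_comp_of_integrable hG'i.restrict
  have hint : ∫ q in cyl Ω T, G q =
      ∫ x, G' (flowT e x) ∂((lateralFlux Ω T p₀ e R).prod volume) := by
    rw [← integral_indicator hcm, hind, ← integral_map hmp.aemeasurable
      (by rw [hmp.map_eq]; exact hG'i.restrict.aestronglyMeasurable), hmp.map_eq,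
      setIntegral_eq_integral_of_forall_compl_eq_zero]
    exact fun q hq => indicator_of_notMem (fun hq' => hq (hDF hq')) _
  -- Along the line through a boundary point, lying in the domain means `r > 0` inside the small
  -- ball; outside that ball both sides vanish because of the support of `G`.
  have hpt : ∀ q : SpaceTime, q.1 ∈ S → q.2 ∈ Ioo 0 T → ∀ r : ℝ,
      G' (flowT e (q, r)) = (Ioi (0 : ℝ)).indicator (fun r => G (flowT e (q, r))) r := by
    intro q hq1 hq2 r
    by_cases hb : flow e (q.1, r) ∈ Metric.ball p₀ R'
    · have hiff := h.flow_mem_iff hq1 hb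
      by_cases hr : 0 < r
      · rw [indicator_of_mem (show r ∈ Ioi (0 : ℝ) from hr), hG', indicator_of_mem]
        exact ⟨⟨hiff.2 hr, hb⟩, hq2⟩
      · rw [indicator_of_notMem (show r ∉ Ioi (0 : ℝ) from hr), hG', indicator_of_notMem]
        exact fun hmem => hr (hiff.1 hmem.1.1)
    · rw [hG', indicator_of_notMem (fun hmem => hb hmem.1.2), eq_comm]
      by_cases hr : 0 < r
      · rw [indicator_of_mem (show r ∈ Ioi (0 : ℝ) from hr)]
        exact hsupp _ hb
      · rw [indicator_of_notMem (show r ∉ Ioi (0 : ℝ) from hr)]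
  have hae := h.ae_mem (T := T)
  constructor
  · have h1 : Integrable ((univ ×ˢ Ioi (0 : ℝ)).indicator
        fun x : SpaceTime × ℝ => G (flowT e x)) ((lateralFlux Ω T p₀ e R).prod volume) := by
      refine hcomp.congr ?_
      filter_upwards [Measure.quasiMeasurePreserving_fst.ae hae] with x hx
      have := hpt x.1 hx.1 hx.2 x.2
      simp only [Prod.mk.eta] at this
      rw [this]
      by_cases hr : x.2 ∈ Ioi (0 : ℝ)
      · rw [indicator_of_mem hr, indicator_of_mem (show x ∈ univ ×ˢ Ioi (0 : ℝ) from ⟨trivial, hr⟩)]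
      · rw [indicator_of_notMem hr, indicator_of_notMem fun hx' => hr hx'.2]
    rw [integrable_indicator_iff (MeasurableSet.univ.prod measurableSet_Ioi), IntegrableOn,
      ← Measure.prod_restrict, Measure.restrict_univ] at h1
    exact h1
  · rw [hint, integral_prod _ hcomp]
    refine integral_congr_ae ?_
    filter_upwards [hae] with q hq
    rw [← integral_indicator measurableSet_Ioi]
    exact integral_congr_ae (Eventually.of_forall (hpt q hq.1 hq.2))

/-- The derivative of `u φ` in the spatial direction `e`. -/
def flowDeriv (u : SpaceTime → ℝ) (φ : SpaceTime → ℂ) (e : E3) (q : SpaceTime) : ℂ :=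
  (fderiv ℝ u q (e, 0) : ℝ) * φ q + u q * fderiv ℝ φ q (e, 0)

lemma flowDeriv_eq_zero {u : SpaceTime → ℝ} {φ : SpaceTime → ℂ} {e : E3} {q : SpaceTime}
    (hq : q ∉ tsupport φ) : flowDeriv u φ e q = 0 := by
  have h1 : fderiv ℝ φ q = 0 := image_eq_zero_of_notMem_tsupport fun h =>
    hq (tsupport_fderiv_subset ℝ h)
  simp [flowDeriv, image_eq_zero_of_notMem_tsupport hq, h1]

/-- Off the closed support of `φ` the product vanishes locally. Differentiability of `u` is thus
needed on `tsupport φ` only, and the line may leave the cylinder. -/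
lemma hasDerivAt_flow {u : SpaceTime → ℝ} {φ : SpaceTime → ℂ} (hφ : ContDiff ℝ 1 φ)
    {q : SpaceTime} {e : E3} {r : ℝ}
    (hu : flowT e (q, r) ∈ tsupport φ → DifferentiableAt ℝ u (flowT e (q, r))) :
    HasDerivAt (fun r : ℝ => (u (flowT e (q, r)) : ℂ) * φ (flowT e (q, r)))
      (flowDeriv u φ e (flowT e (q, r))) r := by
  have hc : HasDerivAt (fun r : ℝ => flowT e (q, r)) ((e, 0) : SpaceTime) r := by
    refine HasDerivAt.prodMk ?_ (hasDerivAt_const r q.2)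
    simpa [flow] using ((hasDerivAt_id r).smul_const e).const_add q.1
  by_cases hs : flowT e (q, r) ∈ tsupport φ
  · have h1 := ((hu hs).hasFDerivAt.comp_hasDerivAt r hc).ofReal_comp
    have h2 := ((hφ.differentiable (by simp)) (flowT e (q, r))).hasFDerivAt.comp_hasDerivAt r hc
    exact h1.mul h2
  · rw [flowDeriv_eq_zero hs]
    have hev : ∀ᶠ s in 𝓝 r, flowT e (q, s) ∉ tsupport φ := by
      have : Continuous fun s : ℝ => flowT e (q, s) :=
        (continuous_flowT e).comp (continuous_const.prodMk continuous_id)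
      exact this.continuousAt.eventually ((isClosed_tsupport φ).isOpen_compl.mem_nhds hs)
    refine (hasDerivAt_const r (0 : ℂ)).congr_of_eventuallyEq ?_
    filter_upwards [hev] with s hs
    rw [image_eq_zero_of_notMem_tsupport hs, mul_zero]

/-- Traces on the boundary along the direction `e`. -/
theorem IsInflowPatch.tendsto_trace (h : IsInflowPatch Ω p₀ e R R') (hΩ : IsOpen Ω)
    {u : SpaceTime → ℝ} (hu : ContDiffOn ℝ 1 u (cyl Ω T)) {φ : SpaceTime → ℂ}
    (hφ : ContDiff ℝ 1 φ) (hsupp : ∀ q ∈ tsupport φ, q.1 ∈ Metric.ball p₀ R')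
    (hint : IntegrableOn (flowDeriv u φ e) (cyl Ω T)) :
    ∀ᵐ q ∂(lateralFlux Ω T p₀ e R),
      Tendsto (fun r : ℝ => (u (flowT e (q, r)) : ℂ) * φ (flowT e (q, r))) (𝓝[>] 0)
        (𝓝 (-∫ r in Ioi (0 : ℝ), flowDeriv u φ e (flowT e (q, r)))) := by
  have := h.sigmaFinite_lateralFlux (T := T)
  have h0 : ∀ q : SpaceTime, q.1 ∉ Metric.ball p₀ R' → flowDeriv u φ e q = 0 := fun q hq =>
    flowDeriv_eq_zero fun hq' => hq (hsupp q hq')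
  have hi := (h.integral_cyl hΩ hint h0).1
  filter_upwards [h.ae_mem (T := T), hi.prod_right_ae] with q hq hqi
  have hqi' : IntegrableOn (fun r => flowDeriv u φ e (flowT e (q, r))) (Ioi (0 : ℝ)) := hqi
  have hder : ∀ r > 0, HasDerivAt (fun r : ℝ => (u (flowT e (q, r)) : ℂ) * φ (flowT e (q, r)))
      (flowDeriv u φ e (flowT e (q, r))) r := by
    intro r hr
    refine hasDerivAt_flow hφ fun hs => ?_
    have hb := hsupp _ hs
    have hmem : flowT e (q, r) ∈ cyl Ω T := ⟨(h.flow_mem_iff hq.1 hb).2 hr, hq.2⟩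
    exact (hu.contDiffAt ((cyl_isOpen hΩ T).mem_nhds hmem)).differentiableAt (by simp)
  have he : 0 < ‖e‖ := by
    rw [norm_pos_iff]
    rintro rfl
    have := h.inner_neg q.1 hq.1
    simp at this
  -- The line eventually leaves the ball carrying `φ`. With this zero value at infinity, the product
  -- at `s` is minus the integral of its derivative over `(s, ∞)`, which has a limit as `s → 0+`.
  have hzero : ∀ᶠ r in atTop, (u (flowT e (q, r)) : ℂ) * φ (flowT e (q, r)) = 0 := by
    filter_upwards [eventually_gt_atTop ((R' + ‖q.1 - p₀‖) / ‖e‖), eventually_gt_atTop 0]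
      with r hr hr0
    refine mul_eq_zero_of_right _ (image_eq_zero_of_notMem_tsupport fun hs => ?_)
    have hb := hsupp _ hs
    rw [mem_ball_iff_norm] at hb
    rw [div_lt_iff₀ he] at hr
    have h1 : flow e (q.1, r) - p₀ = r • e + (q.1 - p₀) := by simp only [flow]; abel
    have h2 : ‖r • e‖ ≤ ‖r • e + (q.1 - p₀)‖ + ‖q.1 - p₀‖ := by
      have := norm_sub_le (r • e + (q.1 - p₀)) (q.1 - p₀)
      rwa [add_sub_cancel_right] at this
    rw [norm_smul, Real.norm_eq_abs, abs_of_pos hr0] at h2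
    have h3 : ‖flow e (q.1, r) - p₀‖ < R' := hb
    rw [h1] at h3
    linarith
  have hval : ∀ s > 0, (u (flowT e (q, s)) : ℂ) * φ (flowT e (q, s)) =
      -∫ r in Ioi s, flowDeriv u φ e (flowT e (q, r)) := by
    intro s hs
    rw [integral_Ioi_of_hasDerivAt_of_tendsto' (fun r hr => hder r (lt_of_lt_of_le hs hr))
      (hqi'.mono_set (Ioi_subset_Ioi hs.le)) (tendsto_const_nhds.congr'
        (hzero.mono fun r hr => hr.symm))]
    simp
  have hlim := hqi'.continuousWithinAt_Ici_primitive_Ioi.tendsto.mono_left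
    (nhdsWithin_mono (0 : ℝ) Ioi_subset_Ici_self)
  refine hlim.neg.congr' ?_
  filter_upwards [self_mem_nhdsWithin] with s hs
  exact (hval s hs).symm

end

/-! ### Green's identity and traces near a boundary point -/

/-- `∫ ∂_e(u φ) = ∫ A₃ (e · n) φ dS dt`. -/
def GreenIdentity (Ω : Set E3) (T : ℝ) (u A₃ : SpaceTime → ℝ) (e : E3) (φ : SpaceTime → ℂ) : Prop :=
  ∫ q in cyl Ω T, flowDeriv u φ e q =
    ∫ q, (A₃ q : ℂ) * (inner ℝ (outwardNormal Ω q.1) e : ℝ) * φ q ∂(lateralMeasure Ω T)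

lemma norm_outwardNormal_le (Ω : Set E3) (p : E3) : ‖outwardNormal Ω p‖ ≤ 1 := by
  by_cases h : outwardNormal Ω p = 0
  · simp [h]
  · obtain ⟨n, hn⟩ := exists_isOutwardNormal_of_ne_zero h
    rw [hn.outwardNormal_eq, hn.norm_eq_one]

lemma isCompact_closure_cyl {Ω : Set E3} (hΩb : Bornology.IsBounded Ω) (T : ℝ) :
    IsCompact (closure Ω ×ˢ Icc 0 T) :=
  hΩb.isCompact_closure.prod isCompact_Icc

lemma cyl_subset (Ω : Set E3) (T : ℝ) : cyl Ω T ⊆ closure Ω ×ˢ Icc 0 T :=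
  prod_mono subset_closure Ioo_subset_Icc_self

lemma exists_bound_test {Ω : Set E3} (hΩb : Bornology.IsBounded Ω) (T : ℝ) {φ : SpaceTime → ℂ}
    (hφ : ContDiff ℝ 1 φ) :
    ∃ C, 0 ≤ C ∧ ∀ q ∈ closure Ω ×ˢ Icc 0 T, ‖φ q‖ ≤ C ∧ ‖fderiv ℝ φ q‖ ≤ C := by
  obtain ⟨C₁, h₁⟩ := (isCompact_closure_cyl hΩb T).exists_bound_of_continuousOn
    hφ.continuous.continuousOn
  obtain ⟨C₂, h₂⟩ := (isCompact_closure_cyl hΩb T).exists_bound_of_continuousOn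
    (hφ.continuous_fderiv (by simp)).continuousOn
  exact ⟨max (max C₁ C₂) 0, le_max_right _ _, fun q hq =>
    ⟨(h₁ q hq).trans ((le_max_left _ _).trans (le_max_left _ _)),
      (h₂ q hq).trans ((le_max_right _ _).trans (le_max_left _ _))⟩⟩

lemma integrableOn_mul_test {Ω : Set E3} (hΩ : IsOpen Ω) (hΩb : Bornology.IsBounded Ω) {T : ℝ}
    {g : SpaceTime → ℝ} (hg : IntegrableOn g (cyl Ω T)) {φ : SpaceTime → ℂ} (hφ : Continuous φ) :
    IntegrableOn (fun q => (g q : ℂ) * φ q) (cyl Ω T) := by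
  obtain ⟨C, hC⟩ := (isCompact_closure_cyl hΩb T).exists_bound_of_continuousOn hφ.continuousOn
  refine (hg.ofReal (𝕜 := ℂ)).mul_bdd (c := C) hφ.aestronglyMeasurable ?_
  filter_upwards [ae_restrict_mem (cyl_isOpen hΩ T).measurableSet] with q hq
  exact hC q (cyl_subset Ω T hq)

lemma integrableOn_flowDeriv {Ω : Set E3} (hΩ : IsOpen Ω) (hΩb : Bornology.IsBounded Ω) {T : ℝ}
    {u : SpaceTime → ℝ} (hu : IntegrableOn u (cyl Ω T)) {e : E3}
    (hue : IntegrableOn (fun q => fderiv ℝ u q (e, 0)) (cyl Ω T)) {φ : SpaceTime → ℂ}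
    (hφ : ContDiff ℝ 1 φ) : IntegrableOn (flowDeriv u φ e) (cyl Ω T) :=
  (integrableOn_mul_test hΩ hΩb hue hφ.continuous).add
    (integrableOn_mul_test hΩ hΩb hu
      ((hφ.continuous_fderiv (by simp)).clm_apply continuous_const))

/-! ### Flux measure against surface measure, and Green's identity on a patch in both directions -/

section

variable {Ω : Set E3} {T : ℝ} {p₀ e : E3} {R R' : ℝ}

lemma IsInflowPatch.aemeasurable_density (h : IsInflowPatch Ω p₀ e R R') :
    AEMeasurable (fun p => ENNReal.ofReal |inner ℝ (outwardNormal Ω p) e|)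
      ((surfaceMeasure Ω).restrict (Metric.ball p₀ R)) := by
  rw [surfaceMeasure, Measure.restrict_restrict Metric.isOpen_ball.measurableSet, inter_comm]
  exact h.patch.measurable_density

variable [IsFiniteMeasure (surfaceMeasure Ω)]

lemma lateralMeasure_restrict (Ω : Set E3) [IsFiniteMeasure (surfaceMeasure Ω)] (T : ℝ)
    (B : Set E3) :
    (lateralMeasure Ω T).restrict (B ×ˢ univ) =
      ((surfaceMeasure Ω).restrict B).prod (volume.restrict (Ioo 0 T)) := by
  rw [lateralMeasure, ← Measure.prod_restrict, Measure.restrict_univ]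

lemma IsInflowPatch.aemeasurable_density' (h : IsInflowPatch Ω p₀ e R R') :
    AEMeasurable (fun q : SpaceTime => ENNReal.ofReal |inner ℝ (outwardNormal Ω q.1) e|)
      ((lateralMeasure Ω T).restrict (Metric.ball p₀ R ×ˢ univ)) := by
  rw [lateralMeasure_restrict]
  exact h.aemeasurable_density.comp_quasiMeasurePreserving Measure.quasiMeasurePreserving_fst

lemma IsInflowPatch.lateralFlux_eq (h : IsInflowPatch Ω p₀ e R R') :
    lateralFlux Ω T p₀ e R = ((lateralMeasure Ω T).restrict (Metric.ball p₀ R ×ˢ univ)).withDensity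
      fun q => ENNReal.ofReal |inner ℝ (outwardNormal Ω q.1) e| := by
  have h1 : (μHE[2] : Measure E3).restrict (frontier Ω ∩ Metric.ball p₀ R) =
      (surfaceMeasure Ω).restrict (Metric.ball p₀ R) := by
    rw [surfaceMeasure, Measure.restrict_restrict Metric.isOpen_ball.measurableSet, inter_comm]
  have := h.patch.sigmaFinite
  have hfin : IsFiniteMeasure ((surfaceMeasure Ω).restrict (Metric.ball p₀ R)) := by
    rw [← h1]
    exact ⟨by rw [Measure.restrict_apply_univ]; exact h.patch.measure_ne_top.lt_top⟩
  rw [lateralFlux, fluxMeasure, h1, prod_withDensity_left₀ h.aemeasurable_density,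
    lateralMeasure_restrict]

lemma IsInflowPatch.ae_lateral_mem (h : IsInflowPatch Ω p₀ e R R') :
    ∀ᵐ q ∂((lateralMeasure Ω T).restrict (Metric.ball p₀ R ×ˢ univ)),
      q.1 ∈ frontier Ω ∩ Metric.ball p₀ R ∧ q.2 ∈ Ioo 0 T := by
  rw [lateralMeasure_restrict]
  have h1 : ∀ᵐ p ∂((surfaceMeasure Ω).restrict (Metric.ball p₀ R)),
      p ∈ frontier Ω ∩ Metric.ball p₀ R := by
    rw [surfaceMeasure, Measure.restrict_restrict Metric.isOpen_ball.measurableSet,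
      inter_comm (Metric.ball p₀ R)]
    exact ae_restrict_mem h.patch.measurableSet
  have h2 : ∀ᵐ t ∂((volume : Measure ℝ).restrict (Ioo 0 T)), t ∈ Ioo 0 T :=
    ae_restrict_mem measurableSet_Ioo
  exact (Measure.quasiMeasurePreserving_fst.ae h1).and (Measure.quasiMeasurePreserving_snd.ae h2)

/-- The density `|e · n|` does not vanish on the patch, so the two measures have the same null sets.
-/
lemma IsInflowPatch.ae_lateralFlux_iff (h : IsInflowPatch Ω p₀ e R R') {P : SpaceTime → Prop} :
    (∀ᵐ q ∂(lateralFlux Ω T p₀ e R), P q) ↔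
      ∀ᵐ q ∂((lateralMeasure Ω T).restrict (Metric.ball p₀ R ×ˢ univ)), P q := by
  rw [h.lateralFlux_eq, ae_withDensity_iff' h.aemeasurable_density']
  refine eventually_congr ?_
  filter_upwards [h.ae_lateral_mem] with q hq
  have := h.inner_neg q.1 hq.1
  simp [this.ne]

/-- On the patch `e · n < 0`, hence `|e · n| = -(e · n)`; this is the source of the sign. -/
lemma IsInflowPatch.integral_lateralFlux (h : IsInflowPatch Ω p₀ e R R') {g : SpaceTime → ℂ}
    (hg : ∀ q : SpaceTime, q.1 ∉ Metric.ball p₀ R → g q = 0) :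
    ∫ q, g q ∂(lateralFlux Ω T p₀ e R) =
      -∫ q, (inner ℝ (outwardNormal Ω q.1) e : ℝ) * g q ∂(lateralMeasure Ω T) := by
  rw [h.lateralFlux_eq, integral_withDensity_eq_integral_toReal_smul₀ h.aemeasurable_density'
    (by simp), ← integral_neg, ← setIntegral_eq_integral_of_forall_compl_eq_zero
    (s := Metric.ball p₀ R ×ˢ univ) (μ := lateralMeasure Ω T)]
  · refine integral_congr_ae ?_
    filter_upwards [h.ae_lateral_mem] with q hq
    rw [ENNReal.toReal_ofReal (abs_nonneg _), abs_of_neg (h.inner_neg q.1 hq.1)]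
    simp
  · intro q hq
    rw [hg q fun hq' => hq ⟨hq', mem_univ _⟩, mul_zero, neg_zero]

/-- The limit of `u φ` at the boundary along `e` is minus the line integral of its derivative by
`tendsto_trace`, and `A₃ φ` by hypothesis. Equating the two and integrating over the patch gives the
identity. -/
lemma IsInflowPatch.greenIdentity (h : IsInflowPatch Ω p₀ e R R') (hΩ : IsOpen Ω)
    {u A₃ : SpaceTime → ℝ} (hu : ContDiffOn ℝ 1 u (cyl Ω T)) {φ : SpaceTime → ℂ}
    (hφ : ContDiff ℝ 1 φ) (hsupp : ∀ q ∈ tsupport φ, q.1 ∈ Metric.ball p₀ R')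
    (hint : IntegrableOn (flowDeriv u φ e) (cyl Ω T)) (hA : HasLateralValue Ω T u A₃) :
    GreenIdentity Ω T u A₃ e φ := by
  have h0 : ∀ q : SpaceTime, q.1 ∉ Metric.ball p₀ R' → flowDeriv u φ e q = 0 := fun q hq =>
    flowDeriv_eq_zero fun hq' => hq (hsupp q hq')
  have hφ0 : ∀ q : SpaceTime, q.1 ∉ Metric.ball p₀ R → φ q = 0 := fun q hq =>
    image_eq_zero_of_notMem_tsupport fun hq' => hq (Metric.ball_subset_ball h.le (hsupp q hq'))
  rw [GreenIdentity, (h.integral_cyl hΩ hint h0).2]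
  have hA' : ∀ᵐ q ∂(lateralFlux Ω T p₀ e R), inner ℝ e (outwardNormal Ω q.1) < 0 →
      Tendsto (fun s : ℝ => u (q.1 + s • e, q.2)) (𝓝[>] 0) (𝓝 (A₃ q)) :=
    h.ae_lateralFlux_iff.2 (ae_restrict_of_ae (hA e))
  have key : ∀ᵐ q ∂(lateralFlux Ω T p₀ e R),
      ∫ r in Ioi (0 : ℝ), flowDeriv u φ e (flowT e (q, r)) = -((A₃ q : ℂ) * φ q) := by
    filter_upwards [h.tendsto_trace hΩ hu hφ hsupp hint, hA', h.ae_mem (T := T)] with q h1 h2 h3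
    have h4 := h2 (by rw [real_inner_comm]; exact h.inner_neg q.1 h3.1)
    have h5 : Tendsto (fun r : ℝ => (u (flowT e (q, r)) : ℂ) * φ (flowT e (q, r))) (𝓝[>] 0)
        (𝓝 ((A₃ q : ℂ) * φ q)) := by
      have h6 : Tendsto (fun r : ℝ => φ (flowT e (q, r))) (𝓝[>] 0) (𝓝 (φ q)) := by
        have h7 : Continuous fun r : ℝ => φ (flowT e (q, r)) :=
          hφ.continuous.comp ((continuous_flowT e).comp (continuous_const.prodMk continuous_id))
        have h8 := h7.tendsto 0
        simp only [flowT, flow, zero_smul, add_zero, Prod.mk.eta] at h8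
        exact h8.mono_left nhdsWithin_le_nhds
      exact ((Complex.continuous_ofReal.tendsto _).comp h4).mul h6
    rw [← tendsto_nhds_unique h1 h5, neg_neg]
  rw [integral_congr_ae key, h.integral_lateralFlux
    (fun q hq => by rw [hφ0 q hq, mul_zero, neg_zero]), ← integral_neg]
  refine integral_congr_ae (Eventually.of_forall fun q => ?_)
  simp only
  ring

lemma IsInflowPatch.integrable_lateralFlux (h : IsInflowPatch Ω p₀ e R R') {g : SpaceTime → ℂ}
    (hg : Integrable g (lateralMeasure Ω T)) : Integrable g (lateralFlux Ω T p₀ e R) := by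
  rw [h.lateralFlux_eq, integrable_withDensity_iff_integrable_smul₀' h.aemeasurable_density'
    (by simp)]
  simp only [Complex.real_smul]
  refine (hg.restrict.bdd_mul (c := ‖e‖) ?_ ?_)
  · exact Complex.continuous_ofReal.comp_aestronglyMeasurable
      h.aemeasurable_density'.ennreal_toReal.aestronglyMeasurable
  · refine Eventually.of_forall fun q => ?_
    rw [Complex.norm_real, ENNReal.toReal_ofReal (abs_nonneg _), Real.norm_eq_abs, abs_abs]
    refine (abs_real_inner_le_norm _ _).trans ?_
    have := norm_outwardNormal_le Ω q.1
    nlinarith [norm_nonneg e]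

/-- If Green's identity holds for all test functions, then the traces of `u` are given by `A₃`. -/
lemma IsInflowPatch.tendsto_of_greenIdentity (h : IsInflowPatch Ω p₀ e R R') (hΩ : IsOpen Ω)
    (hΩb : Bornology.IsBounded Ω)
    {u A₃ : SpaceTime → ℝ} (hu : ContDiffOn ℝ 1 u (cyl Ω T)) (hui : IntegrableOn u (cyl Ω T))
    (hue : IntegrableOn (fun q => fderiv ℝ u q (e, 0)) (cyl Ω T))
    (hA : Integrable A₃ (lateralMeasure Ω T))
    (hG : ∀ η : SpaceTime → ℝ, ContDiff ℝ (⊤ : ℕ∞) η → HasCompactSupport η →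
      GreenIdentity Ω T u A₃ e (fun q => (η q : ℂ))) :
    ∀ᵐ q ∂((lateralMeasure Ω T).restrict (Metric.ball p₀ (R' / 2) ×ˢ univ)),
      Tendsto (fun s : ℝ => u (q.1 + s • e, q.2)) (𝓝[>] 0) (𝓝 (A₃ q)) := by
  have hR' := h.pos
  have hsf := h.sigmaFinite_lateralFlux (T := T)
  -- This cutoff equals `1` on the half ball, so the limit `B` of `u χ`, which exists almost
  -- everywhere, is there the limit of `u` itself.
  let χ₀ : ContDiffBump p₀ := ⟨R' / 2, 3 * R' / 4, by linarith, by linarith⟩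
  set χ : SpaceTime → ℂ := fun q => (χ₀ q.1 : ℂ) with hχ
  have hχc : ContDiff ℝ 1 χ :=
    Complex.ofRealCLM.contDiff.comp (χ₀.contDiff.comp contDiff_fst)
  have hχs : ∀ q ∈ tsupport χ, q.1 ∈ Metric.ball p₀ R' := by
    intro q hq
    have h1 : tsupport χ ⊆ Prod.fst ⁻¹' (tsupport χ₀) := by
      refine closure_minimal (fun q hq => subset_tsupport _ ?_)
        ((isClosed_tsupport _).preimage continuous_fst)
      rw [Function.mem_support] at hq ⊢
      exact fun h0 => hq (by simp only [hχ]; rw [h0, Complex.ofReal_zero])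
    have h2 := h1 hq
    rw [mem_preimage, χ₀.tsupport_eq] at h2
    exact Metric.closedBall_subset_ball (by change 3 * R' / 4 < R'; linarith) h2
  have hint := integrableOn_flowDeriv hΩ hΩb hui hue hχc
  set B : SpaceTime → ℂ := fun q => -∫ r in Ioi (0 : ℝ), flowDeriv u χ e (flowT e (q, r)) with hB
  have htr := h.tendsto_trace hΩ hu hχc hχs hint
  have hBi : Integrable B (lateralFlux Ω T p₀ e R) :=
    ((h.integral_cyl hΩ hint fun q hq => flowDeriv_eq_zero fun hq' =>
      hq (hχs q hq')).1.integral_prod_left).neg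
  have hAi : Integrable (fun q => (A₃ q : ℂ)) (lateralFlux Ω T p₀ e R) :=
    h.integrable_lateralFlux hA.ofReal
  have hU : IsOpen (Metric.ball p₀ (R' / 2) ×ˢ (univ : Set ℝ)) :=
    Metric.isOpen_ball.prod isOpen_univ
  have hχ1 : ∀ q ∈ Metric.ball p₀ (R' / 2) ×ˢ (univ : Set ℝ), χ q = 1 := by
    intro q hq
    simp only [hχ]
    rw [χ₀.one_of_mem_closedBall (Metric.ball_subset_closedBall hq.1), Complex.ofReal_one]
  have hlim : ∀ (f : SpaceTime → ℂ), Continuous f → ∀ q : SpaceTime,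
      Tendsto (fun r : ℝ => f (flowT e (q, r))) (𝓝[>] 0) (𝓝 (f q)) := by
    intro f hf q
    have h7 : Continuous fun r : ℝ => f (flowT e (q, r)) :=
      hf.comp ((continuous_flowT e).comp (continuous_const.prodMk continuous_id))
    have h8 := h7.tendsto 0
    simp only [flowT, flow, zero_smul, add_zero, Prod.mk.eta] at h8
    exact h8.mono_left nhdsWithin_le_nhds
  -- For `η` supported over the half ball, `u η` has the limit `B η`. Green's identity for `η` then
  -- reads `∫ (B - A₃) η = 0`, and `η` is arbitrary.
  have hBA : ∀ᵐ q ∂(lateralFlux Ω T p₀ e R),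
      q ∈ Metric.ball p₀ (R' / 2) ×ˢ (univ : Set ℝ) → B q - A₃ q = 0 := by
    refine hU.ae_eq_zero_of_integral_contDiff_smul_eq_zero
      ((hBi.sub hAi).locallyIntegrable.locallyIntegrableOn _) fun η hη hηc hηs => ?_
    set η' : SpaceTime → ℂ := fun q => (η q : ℂ) with hη'
    have hη'c : ContDiff ℝ 1 η' := Complex.ofRealCLM.contDiff.comp (hη.of_le (by simp))
    have hts : tsupport η' ⊆ tsupport η := by
      refine closure_mono fun q hq => ?_
      rw [Function.mem_support] at hq ⊢
      exact fun h0 => hq (by simp only [hη']; rw [h0, Complex.ofReal_zero])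
    have hη's : ∀ q ∈ tsupport η', q.1 ∈ Metric.ball p₀ R' := fun q hq =>
      Metric.ball_subset_ball (by linarith) (hηs (hts hq)).1
    have hη'i := integrableOn_flowDeriv hΩ hΩb hui hue hη'c
    have hη0 : ∀ q : SpaceTime, q.1 ∉ Metric.ball p₀ R → η' q = 0 := fun q hq =>
      image_eq_zero_of_notMem_tsupport fun hq' => hq (Metric.ball_subset_ball h.le (hη's q hq'))
    have hmul : ∀ q, χ q * η' q = η' q := by
      intro q
      by_cases hq : q ∈ tsupport η'
      · rw [hχ1 q (hηs (hts hq)), one_mul]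
      · rw [image_eq_zero_of_notMem_tsupport hq, mul_zero]
    have htr' : ∀ᵐ q ∂(lateralFlux Ω T p₀ e R),
        ∫ r in Ioi (0 : ℝ), flowDeriv u η' e (flowT e (q, r)) = -(B q * η' q) := by
      filter_upwards [htr, h.tendsto_trace hΩ hu hη'c hη's hη'i] with q h1 h2
      have h3 := h1.mul (hlim η' hη'c.continuous q)
      simp only [mul_assoc, hmul] at h3
      have h4 := tendsto_nhds_unique h2 h3
      rw [← neg_eq_iff_eq_neg]
      exact h4
    have hgr := hG η hη hηc
    rw [GreenIdentity, (h.integral_cyl hΩ hη'i fun q hq => flowDeriv_eq_zero fun hq' =>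
      hq (hη's q hq')).2, integral_congr_ae htr'] at hgr
    have h5 := h.integral_lateralFlux (T := T) (g := fun q => (A₃ q : ℂ) * η' q)
      (fun q hq => by rw [hη0 q hq, mul_zero])
    have h6 : ∫ q, (A₃ q : ℂ) * (inner ℝ (outwardNormal Ω q.1) e : ℝ) * η' q ∂(lateralMeasure Ω T) =
        -∫ q, (A₃ q : ℂ) * η' q ∂(lateralFlux Ω T p₀ e R) := by
      rw [h5, neg_neg]
      refine integral_congr_ae (Eventually.of_forall fun q => ?_)
      simp only
      ring
    rw [h6, integral_neg, neg_inj] at hgr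
    obtain ⟨C, hC⟩ := hηc.exists_bound_of_continuous hη.continuous
    have hbd : ∀ q, ‖η' q‖ ≤ C := fun q => by
      simp only [hη', Complex.norm_real]
      exact hC q
    have h7 : ∀ q, η q • (B q - (A₃ q : ℂ)) = B q * η' q - (A₃ q : ℂ) * η' q := fun q => by
      simp only [hη', Complex.real_smul]
      ring
    simp only [h7]
    rw [integral_sub (hBi.mul_bdd hη'c.continuous.aestronglyMeasurable (ae_of_all _ hbd))
      (hAi.mul_bdd hη'c.continuous.aestronglyMeasurable (ae_of_all _ hbd)), hgr, sub_self]
  have hfin : ∀ᵐ q ∂(lateralFlux Ω T p₀ e R), q ∈ Metric.ball p₀ (R' / 2) ×ˢ (univ : Set ℝ) →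
      Tendsto (fun s : ℝ => u (q.1 + s • e, q.2)) (𝓝[>] 0) (𝓝 (A₃ q)) := by
    filter_upwards [hBA, htr] with q h1 h2 hq
    have h3 : B q = (A₃ q : ℂ) := sub_eq_zero.1 (h1 hq)
    have h4 : Tendsto (fun r : ℝ => (u (flowT e (q, r)) : ℂ) * χ (flowT e (q, r))) (𝓝[>] 0)
      (𝓝 (A₃ q : ℂ)) := h3 ▸ h2
    have h5 : ∀ᶠ r in 𝓝[>] (0 : ℝ), flowT e (q, r) ∈ Metric.ball p₀ (R' / 2) ×ˢ (univ : Set ℝ) := by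
      have h7 : Continuous fun r : ℝ => flowT e (q, r) :=
        (continuous_flowT e).comp (continuous_const.prodMk continuous_id)
      have h8 := h7.tendsto 0
      have h9 : flowT e (q, 0) = q := by simp [flowT, flow]
      rw [h9] at h8
      exact (h8.mono_left nhdsWithin_le_nhds).eventually (hU.mem_nhds hq)
    have h6 : Tendsto (fun r : ℝ => (u (flowT e (q, r)) : ℂ)) (𝓝[>] 0) (𝓝 (A₃ q : ℂ)) := by
      refine h4.congr' ?_
      filter_upwards [h5] with r hr
      rw [hχ1 _ hr, mul_one]
    have h10 := (Complex.continuous_re.tendsto _).comp h6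
    simpa [Function.comp_def, flowT, flow] using h10
  rw [h.ae_lateralFlux_iff, ae_restrict_iff'₀
    (Metric.isOpen_ball.measurableSet.prod MeasurableSet.univ).nullMeasurableSet] at hfin
  rw [ae_restrict_iff'₀
    (Metric.isOpen_ball.measurableSet.prod MeasurableSet.univ).nullMeasurableSet]
  filter_upwards [hfin] with q hq hqm
  exact hq ⟨Metric.ball_subset_ball (by linarith [h.le]) hqm.1, hqm.2⟩ hqm

end

/-! ### Cutoff functions near a set of edges -/

lemma exists_bound_deriv_smoothTransition :
    ∃ C, 0 ≤ C ∧ ∀ x, |deriv Real.smoothTransition x| ≤ C := by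
  have hc : Continuous (deriv Real.smoothTransition) :=
    (Real.smoothTransition.contDiff (n := 1)).continuous_deriv (by simp)
  obtain ⟨C, hC⟩ := isCompact_Icc.exists_bound_of_continuousOn (s := Icc (0 : ℝ) 1) hc.continuousOn
  refine ⟨max C 0, le_max_right _ _, fun x => ?_⟩
  by_cases hx : x ∈ Icc (0 : ℝ) 1
  · exact (hC x hx).trans (le_max_left _ _)
  · have h0 : deriv Real.smoothTransition x = 0 := by
      rw [mem_Icc, not_and_or, not_le, not_le] at hx
      rcases hx with hx | hx
      · have : Real.smoothTransition =ᶠ[𝓝 x] fun _ => 0 := by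
          filter_upwards [gt_mem_nhds hx] with y hy
          exact Real.smoothTransition.zero_of_nonpos (le_of_lt hy)
        rw [this.deriv_eq, deriv_const]
      · have : Real.smoothTransition =ᶠ[𝓝 x] fun _ => 1 := by
          filter_upwards [lt_mem_nhds hx] with y hy
          exact Real.smoothTransition.one_of_one_le (le_of_lt hy)
        rw [this.deriv_eq, deriv_const]
    rw [h0, abs_zero]
    exact le_max_right _ _

/-- A `1`-Lipschitz function is within `ε` of a smooth `1`-Lipschitz function. -/
lemma exists_smooth_lipschitz_approx {d : E3 → ℝ} (hd : LipschitzWith 1 d) {ε : ℝ} (hε : 0 < ε) :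
    ∃ g : E3 → ℝ, ContDiff ℝ (⊤ : ℕ∞) g ∧ LipschitzWith 1 g ∧ ∀ x, |g x - d x| ≤ ε := by
  let ρ : ContDiffBump (0 : E3) := ⟨ε / 2, ε, by linarith, by linarith⟩
  set g : E3 → ℝ := convolution (ρ.normed volume) d (ContinuousLinearMap.lsmul ℝ ℝ) volume with hg
  have hint : ∀ x, Integrable fun t => ρ.normed volume t * d (x - t) := by
    intro x
    refine Continuous.integrable_of_hasCompactSupport ?_ ?_
    · exact ρ.continuous_normed.mul (hd.continuous.comp (by fun_prop))
    · exact ρ.hasCompactSupport_normed.mul_right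
  have hgx : ∀ x, g x = ∫ t, ρ.normed volume t * d (x - t) := by
    intro x
    rw [hg, convolution_def]
    rfl
  have hdist : ∀ x y, |d x - d y| ≤ dist x y := fun x y => by
    have := hd.dist_le_mul x y
    simpa [Real.dist_eq] using this
  refine ⟨g, ?_, ?_, ?_⟩
  · exact ρ.hasCompactSupport_normed.contDiff_convolution_left _ ρ.contDiff_normed
      hd.continuous.locallyIntegrable
  · refine LipschitzWith.of_dist_le_mul fun x y => ?_
    rw [Real.dist_eq, hgx, hgx, ← integral_sub (hint x) (hint y), NNReal.coe_one, one_mul]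
    refine (abs_integral_le_integral_abs).trans ?_
    have h1 : ∫ t, ρ.normed volume t * dist x y = dist x y := by
      rw [integral_mul_const, ρ.integral_normed, one_mul]
    rw [← h1]
    refine integral_mono (((hint x).sub (hint y)).abs)
      (ρ.integrable_normed.mul_const _) fun t => ?_
    simp only
    rw [← mul_sub, abs_mul, abs_of_nonneg (ρ.nonneg_normed t)]
    refine mul_le_mul_of_nonneg_left ?_ (ρ.nonneg_normed t)
    have := hdist (x - t) (y - t)
    rwa [dist_sub_right] at this
  · intro x
    have := ρ.dist_normed_convolution_le (μ := volume) (g := d) (x₀ := x) (ε := ε)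
      hd.continuous.aestronglyMeasurable fun y hy => by
        rw [Real.dist_eq]
        exact (hdist y x).trans (Metric.mem_ball.1 hy).le
    rwa [Real.dist_eq] at this

/-- Smooth cutoffs vanishing near a set `Γ`, with gradient of size `k` supported where the
distance to `Γ` is at most `4 / k`. -/
lemma exists_cutoff (Γ : Set E3) :
    ∃ C, 0 ≤ C ∧ ∀ k : ℕ, 0 < k → ∃ χ : E3 → ℝ, ContDiff ℝ (⊤ : ℕ∞) χ ∧ (∀ x, |χ x| ≤ 1) ∧
      (∀ x ∈ tsupport χ, x ∉ Γ) ∧ (∀ x, 4 / (k : ℝ) ≤ Metric.infDist x Γ → χ x = 1) ∧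
      (∀ x, ‖fderiv ℝ χ x‖ ≤ C * k) ∧
      (∀ x, 4 / (k : ℝ) < Metric.infDist x Γ → fderiv ℝ χ x = 0) := by
  obtain ⟨C, hC0, hC⟩ := exists_bound_deriv_smoothTransition
  refine ⟨C, hC0, fun k hk => ?_⟩
  have hk' : (0 : ℝ) < k := Nat.cast_pos.2 hk
  have hdl : LipschitzWith 1 (fun x => Metric.infDist x Γ) := Metric.lipschitz_infDist_pt Γ
  obtain ⟨g, hgc, hgl, hgd⟩ := exists_smooth_lipschitz_approx hdl
    (ε := 1 / (k : ℝ)) (by positivity)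
  -- As `g` is within `1/k` of the distance, distance below `1/k` gives `k g - 2 ≤ 0` and distance
  -- at least `4/k` gives `k g - 2 ≥ 1`. The derivative costs one factor `k`.
  set χ : E3 → ℝ := fun x => Real.smoothTransition (k * g x - 2) with hχ
  have hone : ∀ x, 4 / (k : ℝ) ≤ Metric.infDist x Γ → χ x = 1 := by
    intro x hx
    refine Real.smoothTransition.one_of_one_le ?_
    have h1 := (abs_le.1 (hgd x)).1
    have h2 : 3 / (k : ℝ) ≤ g x := by
      have : (3 : ℝ) / k = 4 / k - 1 / k := by ring
      linarith
    rw [div_le_iff₀ hk'] at h2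
    linarith
  have hzero : ∀ x, Metric.infDist x Γ < 1 / (k : ℝ) → χ x = 0 := by
    intro x hx
    refine Real.smoothTransition.zero_of_nonpos ?_
    have h1 := (abs_le.1 (hgd x)).2
    have h2 : g x ≤ 2 / (k : ℝ) := by
      have : (2 : ℝ) / k = 1 / k + 1 / k := by ring
      linarith
    rw [le_div_iff₀ hk'] at h2
    linarith
  refine ⟨χ, Real.smoothTransition.contDiff.comp ((contDiff_const.mul hgc).sub contDiff_const),
    fun x => ?_, fun x hx hxΓ => ?_, hone, fun x => ?_, fun x hx => ?_⟩
  · rw [abs_of_nonneg (Real.smoothTransition.nonneg _)]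
    exact Real.smoothTransition.le_one _
  · refine notMem_tsupport_iff_eventuallyEq.2 ?_ hx
    have h2 : ∀ᶠ y in 𝓝 x, Metric.infDist y Γ < 1 / (k : ℝ) :=
      hdl.continuous.continuousAt.eventually (gt_mem_nhds (by
        change Metric.infDist x Γ < 1 / (k : ℝ)
        rw [Metric.infDist_zero_of_mem hxΓ]
        positivity))
    filter_upwards [h2] with y hy
    exact hzero y hy
  · have h1 : HasFDerivAt (fun x => (k : ℝ) * g x - 2) ((k : ℝ) • fderiv ℝ g x) x :=
      (((hgc.differentiable (by simp)) x).hasFDerivAt.const_mul (k : ℝ)).sub_const 2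
    have h2 : HasDerivAt Real.smoothTransition (deriv Real.smoothTransition (k * g x - 2))
        (k * g x - 2) :=
      ((Real.smoothTransition.contDiff (n := 1)).differentiable (by simp) _).hasDerivAt
    have h3 := (h2.comp_hasFDerivAt x h1).fderiv
    have h4 : fderiv ℝ χ x =
        deriv Real.smoothTransition (k * g x - 2) • (k : ℝ) • fderiv ℝ g x := h3
    rw [h4, norm_smul, norm_smul, Real.norm_eq_abs, Real.norm_eq_abs, abs_of_pos hk']
    have h5 : ‖fderiv ℝ g x‖ ≤ 1 := norm_fderiv_le_of_lipschitz ℝ hgl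
    have h6 := hC (k * g x - 2)
    have h7 : (k : ℝ) * ‖fderiv ℝ g x‖ ≤ k := by nlinarith
    exact mul_le_mul h6 h7 (by positivity) hC0
  · have h1 : χ =ᶠ[𝓝 x] fun _ => 1 := by
      have h2 : ∀ᶠ y in 𝓝 x, 4 / (k : ℝ) < Metric.infDist y Γ :=
        hdl.continuous.continuousAt.eventually (lt_mem_nhds hx)
      filter_upwards [h2] with y hy
      exact hone y hy.le
    rw [h1.fderiv_eq, fderiv_fun_const]
    rfl

/-- The volume of a tube of radius `4 / k` about finitely many Lipschitz arcs is `O(k⁻²)`. -/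
lemma exists_volume_tube_le {ι : Type*} [Fintype ι] [Nonempty ι] {γ : ι → ℝ → E3} {K : ℝ≥0}
    (hγ : ∀ i, LipschitzOnWith K (γ i) (Icc 0 1)) :
    ∃ C : ℝ, 0 ≤ C ∧ ∀ k : ℕ, 0 < k →
      volume {x : E3 | Metric.infDist x (⋃ i, γ i '' Icc 0 1) ≤ 4 / (k : ℝ)} ≤
        ENNReal.ofReal (C / (k : ℝ) ^ 2) := by
  set Γ := ⋃ i, γ i '' Icc 0 1 with hΓ
  have hΓc : IsCompact Γ := isCompact_iUnion fun i => isCompact_Icc.image_of_continuousOn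
    (hγ i).continuousOn
  have hne : Γ.Nonempty := by
    obtain ⟨i⟩ := ‹Nonempty ι›
    exact ⟨γ i 0, mem_iUnion.2 ⟨i, 0, ⟨le_rfl, zero_le_one⟩, rfl⟩⟩
  set V : ℝ := (volume (Metric.ball (0 : E3) 1)).toReal with hV
  have hVtop : volume (Metric.ball (0 : E3) 1) ≠ ∞ := Metric.isBounded_ball.measure_lt_top.ne
  refine ⟨Fintype.card ι * (2 * (4 + K) ^ 3 * V), by positivity, fun k hk => ?_⟩
  have hk' : (0 : ℝ) < k := Nat.cast_pos.2 hk
  -- Each arc is sampled at the `k + 1` parameters `j/k`. A point of the tube is within `4/k` of an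
  -- arc, whose nearest point is within `K/k` of a sample. About `k` balls of volume `O(k⁻³)` give
  -- `O(k⁻²)`.
  have hcov : {x : E3 | Metric.infDist x Γ ≤ 4 / (k : ℝ)} ⊆
      ⋃ i : ι, ⋃ j ∈ Finset.range (k + 1),
        Metric.closedBall (γ i ((j : ℝ) / k)) ((4 + K) / k) := by
    intro x hx
    obtain ⟨y, hy, hxy⟩ := hΓc.exists_infDist_eq_dist hne x
    obtain ⟨i, s, hs, rfl⟩ := mem_iUnion.1 hy
    simp only [mem_iUnion, Finset.mem_range]
    have hsk : 0 ≤ s * k := mul_nonneg hs.1 hk'.le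
    have hfl := Nat.floor_le hsk
    have hfl' := Nat.lt_floor_add_one (s * k)
    have hjk : ⌊s * k⌋₊ ≤ k := by
      have h1 : s * k ≤ k := by nlinarith [hs.2]
      have h2 := Nat.floor_le_floor h1
      rwa [Nat.floor_natCast] at h2
    refine ⟨i, ⌊s * k⌋₊, Nat.lt_succ_of_le hjk, ?_⟩
    have hjm : ((⌊s * k⌋₊ : ℝ) / k) ∈ Icc (0 : ℝ) 1 :=
      ⟨by positivity, (div_le_one hk').2 (by exact_mod_cast hjk)⟩
    have h3 := (hγ i).dist_le_mul s hs _ hjm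
    have h4 : dist s ((⌊s * k⌋₊ : ℝ) / k) ≤ 1 / k := by
      have h5 : s - (⌊s * k⌋₊ : ℝ) / k = (s * k - ⌊s * k⌋₊) / k := by field_simp
      rw [Real.dist_eq, h5, abs_div, abs_of_pos hk']
      gcongr
      rw [abs_le]
      constructor <;> linarith
    rw [Metric.mem_closedBall]
    calc dist x (γ i ((⌊s * k⌋₊ : ℝ) / k))
        ≤ dist x (γ i s) + dist (γ i s) (γ i ((⌊s * k⌋₊ : ℝ) / k)) := dist_triangle _ _ _
      _ ≤ 4 / k + K * (1 / k) := by
        have h6 : (K : ℝ) * dist s ((⌊s * k⌋₊ : ℝ) / k) ≤ K * (1 / k) := by gcongr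
        rw [← hxy]
        exact add_le_add hx (h3.trans h6)
      _ = (4 + K) / k := by ring
  have hball : ∀ y : E3, volume (Metric.closedBall y ((4 + K) / k)) =
      ENNReal.ofReal (((4 + K) / k) ^ 3 * V) := by
    intro y
    rw [Measure.addHaar_closedBall _ _ (by positivity), ENNReal.ofReal_mul (by positivity), hV,
      ENNReal.ofReal_toReal hVtop]
    simp [E3]
  calc volume {x : E3 | Metric.infDist x Γ ≤ 4 / (k : ℝ)}
      ≤ volume (⋃ i : ι, ⋃ j ∈ Finset.range (k + 1),
        Metric.closedBall (γ i ((j : ℝ) / k)) ((4 + K) / k)) := measure_mono hcov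
    _ ≤ ∑ i : ι, ∑ j ∈ Finset.range (k + 1),
        volume (Metric.closedBall (γ i ((j : ℝ) / k)) ((4 + K) / k)) := by
      refine (measure_iUnion_fintype_le _ _).trans (Finset.sum_le_sum fun i _ => ?_)
      exact measure_biUnion_finset_le _ _
    _ = ENNReal.ofReal (Fintype.card ι * ((k + 1) * (((4 + K) / k) ^ 3 * V))) := by
      simp only [hball, Finset.sum_const, Finset.card_range, Finset.card_univ, nsmul_eq_mul]
      rw [ENNReal.ofReal_mul (p := (Fintype.card ι : ℝ)) (by positivity),
        ENNReal.ofReal_mul (p := (k : ℝ) + 1) (by positivity)]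
      congr 1
      · simp
      · congr 1
        rw [← Nat.cast_succ, ENNReal.ofReal_natCast]
    _ ≤ ENNReal.ofReal (Fintype.card ι * (2 * (4 + K) ^ 3 * V) / (k : ℝ) ^ 2) := by
      refine ENNReal.ofReal_le_ofReal ?_
      have hk1 : (1 : ℝ) ≤ k := by exact_mod_cast hk
      have h1 : ((k : ℝ) + 1) * (((4 + K) / k) ^ 3 * V) ≤ (2 * (4 + K) ^ 3 * V) / (k : ℝ) ^ 2 := by
        rw [div_pow, div_mul_eq_mul_div, mul_div_assoc', div_le_div_iff₀ (by positivity)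
          (by positivity)]
        have h2 : (0 : ℝ) ≤ (4 + K) ^ 3 * V * k ^ 2 := by positivity
        nlinarith
      rw [mul_div_assoc]
      gcongr

/-- An interval has finite one-dimensional measure, hence zero two-dimensional measure, and
Lipschitz maps preserve this. -/
lemma euclideanHausdorffMeasure_arcs {ι : Type*} [Countable ι] {γ : ι → ℝ → E3} {K : ℝ≥0}
    (hγ : ∀ i, LipschitzOnWith K (γ i) (Icc 0 1)) : μHE[2] (⋃ i, γ i '' Icc 0 1) = 0 := by
  rw [measure_iUnion_null_iff]
  intro i
  refine le_antisymm ((euclideanHausdorffMeasure_image_le (hγ i) 2).trans ?_) (by simp)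
  have h1 : (μHE[2] : Measure ℝ) (Icc 0 1) = 0 := by
    have h2 := Measure.euclideanHausdorffMeasure_zero_or_top (d₁ := 1) (d₂ := 2) one_lt_two
      (Icc (0 : ℝ) 1)
    refine h2.resolve_right ?_
    have h3 := InnerProductSpace.euclideanHausdorffMeasure_eq_volume (V := ℝ)
    rw [Module.finrank_self] at h3
    rw [h3]
    simp
  rw [h1, mul_zero]

/-! ### Green's identity on the cylinder -/

/-- The set of regular points is relatively open in `∂Ω`, hence Borel, and the normal is continuous
on it; elsewhere it is `0`. The patches are taken in the direction `-n`, which points strictly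
inwards at every regular point. -/
lemma measurable_outwardNormal {Ω : Set E3} (hΩ : IsOpen Ω) (hfin : μHE[2] (frontier Ω) < ∞) :
    Measurable (outwardNormal Ω) := by
  set Reg : Set E3 := {p | outwardNormal Ω p ≠ 0} with hReg
  have hsub : Reg ⊆ frontier Ω := by
    intro p hp
    obtain ⟨n, hn⟩ := exists_isOutwardNormal_of_ne_zero hp
    exact hn.1
  have hpatch : ∀ p ∈ Reg, ∃ e R R', IsInflowPatch Ω p e R R' := by
    intro p hp
    obtain ⟨n, hn⟩ := exists_isOutwardNormal_of_ne_zero hp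
    refine ⟨-n, exists_isInflowPatch hΩ hfin hn ?_⟩
    rw [inner_neg_right, real_inner_self_eq_norm_sq, hn.norm_eq_one]
    norm_num
  choose! e R R' hP using hpatch
  have hball : ∀ p ∈ Reg, frontier Ω ∩ Metric.ball p (R p) ⊆ Reg := by
    intro p hp q hq h0
    have h1 : outwardNormal Ω q = 0 := h0
    have := (hP p hp).patch.norm_eq_one q hq
    rw [h1, norm_zero] at this
    exact zero_ne_one this
  have hRpos : ∀ p ∈ Reg, 0 < R p := fun p hp => (hP p hp).pos.trans_le (hP p hp).le
  have hRm : MeasurableSet Reg := by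
    have : Reg = frontier Ω ∩ ⋃ p ∈ Reg, Metric.ball p (R p) := by
      ext q
      simp only [mem_inter_iff, mem_iUnion]
      constructor
      · exact fun hq => ⟨hsub hq, q, hq, Metric.mem_ball_self (hRpos q hq)⟩
      · rintro ⟨hq, p, hp, hqp⟩
        exact hball p hp ⟨hq, hqp⟩
    rw [this]
    exact isClosed_frontier.measurableSet.inter
      (isOpen_biUnion fun _ _ => Metric.isOpen_ball).measurableSet
  have hcont : ContinuousOn (outwardNormal Ω) Reg := by
    intro p hp
    have h1 := (hP p hp).patch.continuousOn p ⟨hsub hp, Metric.mem_ball_self (hRpos p hp)⟩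
    refine h1.mono_of_mem_nhdsWithin ?_
    filter_upwards [self_mem_nhdsWithin, mem_nhdsWithin_of_mem_nhds
      (Metric.ball_mem_nhds p (hRpos p hp))] with q hq hq'
    exact ⟨hsub hq, hq'⟩
  classical
  have h1 := hcont.measurable_piecewise (continuousOn_const (c := (0 : E3)) (s := Regᶜ)) hRm
  convert h1 using 1
  ext1 p
  by_cases hp : p ∈ Reg
  · rw [piecewise_eq_of_mem _ _ _ hp]
  · rw [piecewise_eq_of_notMem _ _ _ hp]
    exact not_not.1 hp

lemma ae_lateral_mem (Ω : Set E3) [IsFiniteMeasure (surfaceMeasure Ω)] (T : ℝ) :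
    ∀ᵐ q ∂(lateralMeasure Ω T), q.1 ∈ frontier Ω ∧ q.2 ∈ Ioo 0 T := by
  have h1 : ∀ᵐ p ∂(surfaceMeasure Ω), p ∈ frontier Ω :=
    ae_restrict_mem isClosed_frontier.measurableSet
  have h2 : ∀ᵐ t ∂((volume : Measure ℝ).restrict (Ioo 0 T)), t ∈ Ioo 0 T :=
    ae_restrict_mem measurableSet_Ioo
  exact (Measure.quasiMeasurePreserving_fst.ae h1).and (Measure.quasiMeasurePreserving_snd.ae h2)

section

variable {Ω : Set E3} {T : ℝ} {u A₃ : SpaceTime → ℝ}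

lemma integrable_lateral_mul_test [IsFiniteMeasure (surfaceMeasure Ω)] (hΩ : IsOpen Ω)
    (hΩb : Bornology.IsBounded Ω) (hA : Integrable A₃ (lateralMeasure Ω T)) (e : E3)
    {φ : SpaceTime → ℂ} (hφ : Continuous φ) :
    Integrable (fun q => (A₃ q : ℂ) * (inner ℝ (outwardNormal Ω q.1) e : ℝ) * φ q)
      (lateralMeasure Ω T) := by
  have hfin : μHE[2] (frontier Ω) < ∞ := by
    have := measure_lt_top (surfaceMeasure Ω) univ
    rwa [surfaceMeasure, Measure.restrict_apply_univ] at this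
  obtain ⟨C, hC⟩ := (isCompact_closure_cyl hΩb T).exists_bound_of_continuousOn hφ.continuousOn
  have h1 : Integrable (fun q => (A₃ q : ℂ) * (inner ℝ (outwardNormal Ω q.1) e : ℝ))
      (lateralMeasure Ω T) := by
    refine (hA.ofReal (𝕜 := ℂ)).mul_bdd (c := ‖e‖) ?_ (ae_of_all _ fun q => ?_)
    · have : Measurable fun q : SpaceTime => inner ℝ (outwardNormal Ω q.1) e :=
        ((measurable_outwardNormal hΩ hfin).comp measurable_fst).inner measurable_const
      exact (Complex.measurable_ofReal.comp this).aestronglyMeasurable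
    · rw [Complex.norm_real, Real.norm_eq_abs]
      refine (abs_real_inner_le_norm _ _).trans ?_
      have := norm_outwardNormal_le Ω q.1
      nlinarith [norm_nonneg e]
  refine h1.mul_bdd (c := C) hφ.aestronglyMeasurable ?_
  filter_upwards [ae_lateral_mem Ω T] with q hq
  exact hC q ⟨frontier_subset_closure hq.1, Ioo_subset_Icc_self hq.2⟩

lemma flowDeriv_add {φ ψ : SpaceTime → ℂ} (hφ : ContDiff ℝ 1 φ) (hψ : ContDiff ℝ 1 ψ) (e : E3)
    (q : SpaceTime) :
    flowDeriv u (fun q => φ q + ψ q) e q = flowDeriv u φ e q + flowDeriv u ψ e q := by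
  simp only [flowDeriv]
  rw [fderiv_fun_add (hφ.differentiable (by simp) q) (hψ.differentiable (by simp) q),
    add_apply]
  ring

lemma flowDeriv_sub_dir (φ : SpaceTime → ℂ) (e e' : E3) (q : SpaceTime) :
    flowDeriv u φ (e - e') q = flowDeriv u φ e q - flowDeriv u φ e' q := by
  have : ((e - e', 0) : SpaceTime) = (e, 0) - (e', 0) := by simp
  simp only [flowDeriv, this, map_sub]
  push_cast
  ring

/-- The standing assumptions on the domain and on the function `u` with boundary data `A₃`. -/
structure GreenData (Ω : Set E3) (T : ℝ) (u A₃ : SpaceTime → ℝ) : Prop where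
  isOpen : IsOpen Ω
  isBounded : Bornology.IsBounded Ω
  area : IsFiniteMeasure (surfaceMeasure Ω)
  contDiffOn : ContDiffOn ℝ 1 u (cyl Ω T)
  integrable : IntegrableOn u (cyl Ω T)
  integrable_fderiv : ∀ e : E3, IntegrableOn (fun q => fderiv ℝ u q (e, 0)) (cyl Ω T)
  integrable_lateral : Integrable A₃ (lateralMeasure Ω T)

namespace GreenData

lemma integrableOn_flowDeriv (h : GreenData Ω T u A₃) {φ : SpaceTime → ℂ} (hφ : ContDiff ℝ 1 φ)
    (e : E3) : IntegrableOn (flowDeriv u φ e) (cyl Ω T) :=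
  FirstOrderPDE.integrableOn_flowDeriv h.isOpen h.isBounded h.integrable (h.integrable_fderiv e) hφ

lemma area_lt_top (h : GreenData Ω T u A₃) : μHE[2] (frontier Ω) < ∞ := by
  have := h.area
  have := measure_lt_top (surfaceMeasure Ω) univ
  rwa [surfaceMeasure, Measure.restrict_apply_univ] at this

lemma add (h : GreenData Ω T u A₃) {φ ψ : SpaceTime → ℂ} (hφ : ContDiff ℝ 1 φ)
    (hψ : ContDiff ℝ 1 ψ) {e : E3} (h1 : GreenIdentity Ω T u A₃ e φ)
    (h2 : GreenIdentity Ω T u A₃ e ψ) : GreenIdentity Ω T u A₃ e (fun q => φ q + ψ q) := by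
  have := h.area
  unfold GreenIdentity at *
  simp only [flowDeriv_add hφ hψ, mul_add]
  rw [integral_add (h.integrableOn_flowDeriv hφ e) (h.integrableOn_flowDeriv hψ e),
    integral_add (integrable_lateral_mul_test h.isOpen h.isBounded h.integrable_lateral e
      hφ.continuous) (integrable_lateral_mul_test h.isOpen h.isBounded h.integrable_lateral e
      hψ.continuous), h1, h2]

lemma zero_test (e : E3) : GreenIdentity Ω T u A₃ e (fun _ => 0) := by
  have : flowDeriv u (fun _ => 0) e = fun _ => 0 := by
    funext q
    simp [flowDeriv]
  simp [GreenIdentity, this]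

lemma sum (h : GreenData Ω T u A₃) {ι : Type*} (s : Finset ι) {φ : ι → SpaceTime → ℂ}
    (hφ : ∀ i, ContDiff ℝ 1 (φ i)) {e : E3} (h1 : ∀ i, GreenIdentity Ω T u A₃ e (φ i)) :
    GreenIdentity Ω T u A₃ e (fun q => ∑ i ∈ s, φ i q) := by
  classical
  induction s using Finset.induction_on with
  | empty => simpa using zero_test e
  | insert i s hi ih =>
    simp only [Finset.sum_insert hi]
    exact h.add (hφ i) (ContDiff.sum fun j _ => hφ j) (h1 i) ih

lemma sub_dir (h : GreenData Ω T u A₃) {φ : SpaceTime → ℂ} (hφ : ContDiff ℝ 1 φ) {e e' : E3}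
    (h1 : GreenIdentity Ω T u A₃ e φ) (h2 : GreenIdentity Ω T u A₃ e' φ) :
    GreenIdentity Ω T u A₃ (e - e') φ := by
  have := h.area
  unfold GreenIdentity at *
  simp only [flowDeriv_sub_dir, inner_sub_right, Complex.ofReal_sub, mul_sub, sub_mul]
  rw [integral_sub (h.integrableOn_flowDeriv hφ e) (h.integrableOn_flowDeriv hφ e'),
    integral_sub (integrable_lateral_mul_test h.isOpen h.isBounded h.integrable_lateral e
      hφ.continuous) (integrable_lateral_mul_test h.isOpen h.isBounded h.integrable_lateral e'
      hφ.continuous), h1, h2]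

/-- Both sides see the test function only on `closure Ω`. This is needed because the partition of
unity in `glue` sums to `1` only on a compact subset of it. -/
lemma congr (h : GreenData Ω T u A₃) {φ ψ : SpaceTime → ℂ} {e : E3}
    (h1 : GreenIdentity Ω T u A₃ e φ) (heq : ∀ q : SpaceTime, q.1 ∈ closure Ω → φ q = ψ q) :
    GreenIdentity Ω T u A₃ e ψ := by
  have := h.area
  have hm := (cyl_isOpen h.isOpen T).measurableSet
  unfold GreenIdentity at *
  have e1 : ∫ q in cyl Ω T, flowDeriv u ψ e q = ∫ q in cyl Ω T, flowDeriv u φ e q := by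
    refine setIntegral_congr_fun hm fun q hq => ?_
    have h2 : ψ =ᶠ[𝓝 q] φ := by
      filter_upwards [(cyl_isOpen h.isOpen T).mem_nhds hq] with y hy
      exact (heq y (subset_closure hy.1)).symm
    simp only [flowDeriv, h2.fderiv_eq, h2.eq_of_nhds]
  rw [e1, h1]
  refine integral_congr_ae ?_
  filter_upwards [ae_lateral_mem Ω T] with q hq
  rw [heq q (frontier_subset_closure hq.1)]

/-- Extended by zero, `u φ` is differentiable along every line in direction `e`: such lines keep `t`
fixed and the support stays away from `∂Ω`. The integral of the derivative is zero, and so is the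
boundary term. -/
lemma local_interior (h : GreenData Ω T u A₃) {φ : SpaceTime → ℂ} (hφ : ContDiff ℝ 1 φ)
    (hsupp : ∀ q ∈ tsupport φ, q.1 ∈ Ω) (e : E3) : GreenIdentity Ω T u A₃ e φ := by
  have := h.area
  have hm := (cyl_isOpen h.isOpen T).measurableSet
  have hR : ∫ q, (A₃ q : ℂ) * (inner ℝ (outwardNormal Ω q.1) e : ℝ) * φ q ∂(lateralMeasure Ω T) =
      0 := by
    rw [← integral_zero SpaceTime ℂ (μ := lateralMeasure Ω T)]
    refine integral_congr_ae ?_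
    filter_upwards [ae_lateral_mem Ω T] with q hq
    refine mul_eq_zero_of_right _ (image_eq_zero_of_notMem_tsupport fun hq' => ?_)
    have := hsupp q hq'
    rw [h.isOpen.frontier_eq] at hq
    exact hq.1.2 this
  rw [GreenIdentity, hR, ← integral_indicator hm]
  set F : SpaceTime → ℂ := (cyl Ω T).indicator fun q => (u q : ℂ) * φ q with hF
  set F' : SpaceTime → ℂ := (cyl Ω T).indicator (flowDeriv u φ e) with hF'
  have hline : ∀ q, HasLineDerivAt ℝ F (F' q) q ((e, 0) : SpaceTime) := by
    intro q
    have hfl : ∀ r : ℝ, q + r • ((e, 0) : SpaceTime) = flowT e (q, r) := fun r => by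
      ext1 <;> simp [flowT, flow]
    unfold HasLineDerivAt
    simp only [hfl]
    have hfl0 : flowT e (q, 0) = q := by simp [flowT, flow]
    by_cases ht : q.2 ∈ Ioo 0 T
    · have h1 := hasDerivAt_flow (u := u) hφ (q := q) (e := e) (r := 0) fun hs => by
        rw [hfl0] at hs ⊢
        exact (h.contDiffOn.contDiffAt ((cyl_isOpen h.isOpen T).mem_nhds
          ⟨hsupp q hs, ht⟩)).differentiableAt (by simp)
      have hval : ∀ r : ℝ, F (flowT e (q, r)) =
          (u (flowT e (q, r)) : ℂ) * φ (flowT e (q, r)) := by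
        intro r
        by_cases hr : flowT e (q, r) ∈ tsupport φ
        · rw [hF, indicator_of_mem]
          exact ⟨hsupp _ hr, ht⟩
        · rw [image_eq_zero_of_notMem_tsupport hr, mul_zero, hF]
          by_cases hc : flowT e (q, r) ∈ cyl Ω T
          · rw [indicator_of_mem hc, image_eq_zero_of_notMem_tsupport hr, mul_zero]
          · rw [indicator_of_notMem hc]
      simp only [hval]
      have hval' : F' q = flowDeriv u φ e q := by
        by_cases hr : q ∈ tsupport φ
        · rw [hF', indicator_of_mem]
          exact ⟨hsupp _ hr, ht⟩
        · rw [flowDeriv_eq_zero hr, hF']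
          by_cases hc : q ∈ cyl Ω T
          · rw [indicator_of_mem hc, flowDeriv_eq_zero hr]
          · rw [indicator_of_notMem hc]
      rw [hval']
      rwa [hfl0] at h1
    · have h0 : ∀ r : ℝ, F (flowT e (q, r)) = 0 := fun r => by
        rw [hF, indicator_of_notMem]
        exact fun hc => ht hc.2
      have h0' : F' q = 0 := by
        rw [hF', indicator_of_notMem]
        exact fun hc => ht hc.2
      simp only [h0, h0']
      exact hasDerivAt_const _ _
  have hFi : Integrable F := (integrable_indicator_iff hm).2
    (integrableOn_mul_test h.isOpen h.isBounded h.integrable hφ.continuous)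
  have hF'i : Integrable F' := (integrable_indicator_iff hm).2 (h.integrableOn_flowDeriv hφ e)
  have hfin := integral_bilinear_hasLineDerivAt_right_eq_neg_left_of_integrable
    (μ := (volume : Measure SpaceTime)) (B := ContinuousLinearMap.mul ℝ ℂ) (f := F) (f' := F')
    (g := fun _ => 1) (g' := fun _ => 0) (v := ((e, 0) : SpaceTime)) (by simpa using hF'i)
    (by simp) (by simpa using hFi) (fun q _ => hline q)
    (fun q _ => by unfold HasLineDerivAt; exact hasDerivAt_const _ _)
  simpa using hfin

/-- Writing `e = (e - M n) - (-M n)` with `M > ‖e‖` exhibits `e` as a difference of two directions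
pointing strictly inwards at `p`, and Green's identity is linear in the direction. -/
lemma local_boundary (h : GreenData Ω T u A₃) (hA : HasLateralValue Ω T u A₃) {p n : E3}
    (hp : IsOutwardNormal Ω p n) (e : E3) :
    ∃ r > 0, ∀ φ : SpaceTime → ℂ, ContDiff ℝ 1 φ → (∀ q ∈ tsupport φ, q.1 ∈ Metric.ball p r) →
      GreenIdentity Ω T u A₃ e φ := by
  have := h.area
  set M : ℝ := ‖e‖ + 1 with hM
  have hM0 : 0 < M := by positivity
  have hnn : inner ℝ n n = (1 : ℝ) := by rw [real_inner_self_eq_norm_sq, hp.norm_eq_one, one_pow]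
  have h1 : inner ℝ n (e - M • n) < 0 := by
    rw [inner_sub_right, inner_smul_right, hnn]
    have := real_inner_le_norm n e
    rw [hp.norm_eq_one] at this
    linarith
  have h2 : inner ℝ n (-(M • n)) < 0 := by
    rw [inner_neg_right, inner_smul_right, hnn]
    linarith
  obtain ⟨R₁, R₁', hP₁⟩ := exists_isInflowPatch h.isOpen h.area_lt_top hp h1
  obtain ⟨R₂, R₂', hP₂⟩ := exists_isInflowPatch h.isOpen h.area_lt_top hp h2
  refine ⟨min R₁' R₂', lt_min hP₁.pos hP₂.pos, fun φ hφ hs => ?_⟩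
  have g1 := hP₁.greenIdentity h.isOpen h.contDiffOn hφ
    (fun q hq => Metric.ball_subset_ball (min_le_left _ _) (hs q hq))
    (h.integrableOn_flowDeriv hφ _) hA
  have g2 := hP₂.greenIdentity h.isOpen h.contDiffOn hφ
    (fun q hq => Metric.ball_subset_ball (min_le_right _ _) (hs q hq))
    (h.integrableOn_flowDeriv hφ _) hA
  have g3 := h.sub_dir hφ g1 g2
  rwa [sub_neg_eq_add, sub_add_cancel] at g3

lemma tsupport_spatial_mul_subset (χ : E3 → ℝ) (φ : SpaceTime → ℂ) :
    ∀ q ∈ tsupport (fun q : SpaceTime => (χ q.1 : ℂ) * φ q), q.1 ∈ tsupport χ := by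
  intro q hq
  have h1 : tsupport (fun q : SpaceTime => (χ q.1 : ℂ) * φ q) ⊆ Prod.fst ⁻¹' (tsupport χ) := by
    refine closure_minimal (fun q hq => subset_tsupport _ ?_)
      ((isClosed_tsupport _).preimage continuous_fst)
    rw [Function.mem_support] at hq ⊢
    exact fun h0 => hq (by rw [h0, Complex.ofReal_zero, zero_mul])
  exact h1 hq

lemma contDiff_spatial_mul {χ : E3 → ℝ} (hχ : ContDiff ℝ 1 χ) {φ : SpaceTime → ℂ}
    (hφ : ContDiff ℝ 1 φ) : ContDiff ℝ 1 (fun q : SpaceTime => (χ q.1 : ℂ) * φ q) :=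
  (Complex.ofRealCLM.contDiff.comp (hχ.comp contDiff_fst)).mul hφ

/-- The test function `χ φ` is decomposed by a partition of unity on the compact set where `χ` is
felt; local finiteness leaves finitely many pieces, each covered by a local identity. -/
lemma glue (h : GreenData Ω T u A₃) {e : E3} {χ : E3 → ℝ} (hχ : ContDiff ℝ 1 χ)
    (hloc : ∀ p ∈ closure Ω ∩ tsupport χ, ∃ U : Set E3, IsOpen U ∧ p ∈ U ∧ ∀ φ : SpaceTime → ℂ,
      ContDiff ℝ 1 φ → (∀ q ∈ tsupport φ, q.1 ∈ U) → GreenIdentity Ω T u A₃ e φ)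
    {φ : SpaceTime → ℂ} (hφ : ContDiff ℝ 1 φ) :
    GreenIdentity Ω T u A₃ e (fun q => (χ q.1 : ℂ) * φ q) := by
  classical
  set K : Set E3 := closure Ω ∩ tsupport χ with hK
  have hKc : IsCompact K := h.isBounded.isCompact_closure.inter_right (isClosed_tsupport _)
  choose! U hUo hpU hUG using hloc
  obtain ⟨f, hf⟩ := SmoothPartitionOfUnity.exists_isSubordinate (modelWithCornersSelf ℝ E3)
    hKc.isClosed (fun p : K => U p) (fun p => hUo p p.2)
    (fun p hp => mem_iUnion.2 ⟨⟨p, hp⟩, hpU p hp⟩)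
  have hfin := f.locallyFinite.finite_nonempty_inter_compact hKc
  set F := hfin.toFinset with hF
  have hsum : ∀ x ∈ K, ∑ i ∈ F, f i x = 1 := by
    intro x hx
    rw [← f.sum_eq_one hx, finsum_eq_sum_of_support_subset]
    intro i hi
    rw [Finset.mem_coe, hF, Finite.mem_toFinset]
    exact ⟨x, hi, hx⟩
  have hfc : ∀ i, ContDiff ℝ 1 (fun x => f i x) := fun i =>
    ((f i).contMDiff.contDiff).of_le (by exact_mod_cast le_top)
  have key : GreenIdentity Ω T u A₃ e (fun q => ∑ i ∈ F, (f i q.1 : ℂ) * ((χ q.1 : ℂ) * φ q)) := by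
    refine h.sum F (fun i => contDiff_spatial_mul (hfc i) (contDiff_spatial_mul hχ hφ)) fun i => ?_
    refine hUG i i.2 _ (contDiff_spatial_mul (hfc i) (contDiff_spatial_mul hχ hφ)) fun q hq => ?_
    exact hf i (tsupport_spatial_mul_subset _ _ q hq)
  refine h.congr key fun q hq => ?_
  rw [← Finset.sum_mul]
  by_cases hqs : q.1 ∈ tsupport χ
  · have h1 := hsum q.1 ⟨hq, hqs⟩
    rw [← Complex.ofReal_sum, h1, Complex.ofReal_one, one_mul]
  · rw [image_eq_zero_of_notMem_tsupport hqs]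
    simp

end GreenData

end

lemma volume_eq_zero_of_euclideanHausdorffMeasure {S : Set E3} (h : μHE[2] S = 0) :
    volume S = 0 := by
  have h1 := Measure.euclideanHausdorffMeasure_zero_or_top (d₁ := 2) (d₂ := 3) (by norm_num) S
  rw [h] at h1
  have h2 := InnerProductSpace.euclideanHausdorffMeasure_eq_volume (V := E3)
  have h3 : Module.finrank ℝ E3 = 3 := by simp [E3]
  rw [h3] at h2
  rw [← h2]
  simpa using h1

lemma flowDeriv_spatial_mul {u : SpaceTime → ℝ} {χ : E3 → ℝ} (hχ : ContDiff ℝ 1 χ)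
    {φ : SpaceTime → ℂ} (hφ : ContDiff ℝ 1 φ) (e : E3) (q : SpaceTime) :
    flowDeriv u (fun q : SpaceTime => (χ q.1 : ℂ) * φ q) e q =
      (χ q.1 : ℂ) * flowDeriv u φ e q + u q * (fderiv ℝ χ q.1 e : ℝ) * φ q := by
  have h1 : HasFDerivAt (fun q : SpaceTime => (χ q.1 : ℂ))
      (Complex.ofRealCLM.comp ((fderiv ℝ χ q.1).comp (ContinuousLinearMap.fst ℝ E3 ℝ))) q :=
    Complex.ofRealCLM.hasFDerivAt.comp q
      ((hχ.differentiable (by simp) q.1).hasFDerivAt.comp q hasFDerivAt_fst)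
  have h2 := (h1.mul (hφ.differentiable (by simp) q).hasFDerivAt).fderiv
  simp only [flowDeriv]
  have h3 : fderiv ℝ (fun q : SpaceTime => (χ q.1 : ℂ) * φ q) q (e, 0) =
      (χ q.1 : ℂ) * fderiv ℝ φ q (e, 0) + φ q * (fderiv ℝ χ q.1 e : ℝ) := by
    rw [show (fun q : SpaceTime => (χ q.1 : ℂ) * φ q) = (fun q : SpaceTime => (χ q.1 : ℂ)) * φ
      from rfl, h2]
    simp
  rw [h3]
  ring

/-- The contribution of the cutoffs near the edges tends to zero for square integrable `u`. -/
lemma tendsto_cutoff_error {Ω : Set E3} (hΩ : IsOpen Ω) {T : ℝ}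
    {u : SpaceTime → ℝ} (hu : MemLp u 2 (volume.restrict (cyl Ω T))) {Γ : Set E3}
    (hΓ : IsClosed Γ) (hne : Γ.Nonempty) (hΓ0 : volume Γ = 0) {C : ℝ} (hC0 : 0 ≤ C)
    (hC : ∀ k : ℕ, 0 < k →
      volume {x : E3 | Metric.infDist x Γ ≤ 4 / (k : ℝ)} ≤ ENNReal.ofReal (C / (k : ℝ) ^ 2))
    {M : ℝ} {b : ℕ → SpaceTime → ℂ}
    (hb : ∀ k : ℕ, ∀ q ∈ cyl Ω T, ‖b k q‖ ≤ M * (k + 1) * |u q|)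
    (hb0 : ∀ k : ℕ, ∀ q : SpaceTime, 4 / ((k + 1 : ℕ) : ℝ) < Metric.infDist q.1 Γ → b k q = 0) :
    Tendsto (fun k => ∫ q in cyl Ω T, b k q) atTop (𝓝 0) := by
  have hcm := (cyl_isOpen hΩ T).measurableSet
  have hu2 : IntegrableOn (fun q => u q ^ 2) (cyl Ω T) := hu.integrable_sq
  set tube : ℕ → Set E3 := fun k => {x : E3 | Metric.infDist x Γ ≤ 4 / ((k + 1 : ℕ) : ℝ)}
    with htube
  have htm : ∀ k, MeasurableSet (tube k) := fun k =>
    (isClosed_le (Metric.continuous_infDist_pt Γ) continuous_const).measurableSet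
  set D : ℕ → Set SpaceTime := fun k => cyl Ω T ∩ tube k ×ˢ univ with hD
  have hDm : ∀ k, MeasurableSet (D k) := fun k => hcm.inter ((htm k).prod MeasurableSet.univ)
  have hDvol : ∀ k, volume (D k) ≤ ENNReal.ofReal (C / ((k + 1 : ℕ) : ℝ) ^ 2 * |T|) := by
    intro k
    have h1 : D k ⊆ tube k ×ˢ Ioo 0 T := fun q hq => ⟨hq.2.1, hq.1.2⟩
    refine (measure_mono h1).trans ?_
    rw [Measure.volume_eq_prod, Measure.prod_prod, Real.volume_Ioo, sub_zero,
      ENNReal.ofReal_mul (by positivity)]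
    exact mul_le_mul' (hC (k + 1) (Nat.succ_pos k)) (ENNReal.ofReal_le_ofReal (le_abs_self T))
  have hDfin : ∀ k, volume (D k) ≠ ∞ := fun k => ne_top_of_le_ne_top ENNReal.ofReal_ne_top (hDvol k)
  have hsq : Tendsto (fun k => ∫ q in D k, u q ^ 2) atTop (𝓝 0) := by
    have h1 : ∀ k, ∫ q in D k, u q ^ 2 =
        ∫ q in cyl Ω T, (tube k ×ˢ (univ : Set ℝ)).indicator (fun q => u q ^ 2) q := fun k => by
      rw [setIntegral_indicator ((htm k).prod MeasurableSet.univ)]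
    simp only [h1]
    rw [← integral_zero SpaceTime ℝ (μ := volume.restrict (cyl Ω T))]
    refine tendsto_integral_of_dominated_convergence (fun q => u q ^ 2) (fun k => ?_) hu2
      (fun k => ae_of_all _ fun q => ?_) ?_
    · exact hu2.aestronglyMeasurable.indicator ((htm k).prod MeasurableSet.univ)
    · by_cases hq : q ∈ tube k ×ˢ (univ : Set ℝ)
      · rw [indicator_of_mem hq, Real.norm_eq_abs, abs_of_nonneg (sq_nonneg _)]
      · rw [indicator_of_notMem hq, norm_zero]
        positivity
    · have hnull : ∀ᵐ q : SpaceTime, q.1 ∉ Γ :=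
        Measure.quasiMeasurePreserving_fst.ae (measure_eq_zero_iff_ae_notMem.1 hΓ0)
      filter_upwards [ae_restrict_of_ae hnull] with q hq
      have hpos := (hΓ.notMem_iff_infDist_pos hne).1 hq
      have h2 : Tendsto (fun k : ℕ => 4 / ((k + 1 : ℕ) : ℝ)) atTop (𝓝 0) := by
        have h3 := (tendsto_one_div_add_atTop_nhds_zero_nat (𝕜 := ℝ)).const_mul 4
        rw [mul_zero] at h3
        refine h3.congr fun k => ?_
        push_cast
        ring
      refine tendsto_const_nhds.congr' ?_
      filter_upwards [h2.eventually (gt_mem_nhds hpos)] with k hk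
      rw [indicator_of_notMem]
      exact fun hq' => absurd hq'.1 (not_le.2 hk)
  -- A weighted Cauchy-Schwarz inequality: `M k |u| ≤ δ k² + M² |u|² / (4δ)`, with `k + 1` in the
  -- role of `k`. The first term integrates to at most `δ C |T|` because the tube has volume
  -- `O(k⁻²)`, and the second tends to `0` for fixed `δ`.
  have hbound : ∀ δ > 0, ∀ k, ‖∫ q in cyl Ω T, b k q‖ ≤
      δ * (C * |T|) + M ^ 2 / (4 * δ) * ∫ q in D k, u q ^ 2 := by
    intro δ hδ k
    have hk0 : (0 : ℝ) < (k : ℝ) + 1 := by positivity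
    have h1 : ∫ q in cyl Ω T, b k q = ∫ q in D k, b k q := by
      refine setIntegral_eq_of_subset_of_forall_sdiff_eq_zero hcm inter_subset_left fun q hq => ?_
      refine hb0 k q ?_
      by_contra hcon
      exact hq.2 ⟨hq.1, not_lt.1 hcon, mem_univ _⟩
    have hci : Integrable (fun _ : SpaceTime => δ * ((k : ℝ) + 1) ^ 2) (volume.restrict (D k)) :=
      integrableOn_const (hDfin k)
    have hg : IntegrableOn (fun q => δ * ((k : ℝ) + 1) ^ 2 + M ^ 2 / (4 * δ) * u q ^ 2) (D k) :=
      hci.add ((hu2.mono_set inter_subset_left).const_mul _)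
    rw [h1]
    calc ‖∫ q in D k, b k q‖
        ≤ ∫ q in D k, (δ * ((k : ℝ) + 1) ^ 2 + M ^ 2 / (4 * δ) * u q ^ 2) := by
          refine norm_integral_le_of_norm_le hg ?_
          filter_upwards [ae_restrict_mem (hDm k)] with q hq
          refine (hb k q hq.1).trans ?_
          have h2 : 0 ≤ (2 * δ * ((k : ℝ) + 1) - M * |u q|) ^ 2 / (4 * δ) := by positivity
          have h3 : (2 * δ * ((k : ℝ) + 1) - M * |u q|) ^ 2 / (4 * δ) =
              δ * ((k : ℝ) + 1) ^ 2 - M * (k + 1) * |u q| + M ^ 2 / (4 * δ) * |u q| ^ 2 := by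
            field_simp
            ring
          rw [sq_abs] at h3
          linarith
      _ = δ * ((k : ℝ) + 1) ^ 2 * volume.real (D k) + M ^ 2 / (4 * δ) * ∫ q in D k, u q ^ 2 := by
          rw [integral_add hci
            ((hu2.mono_set inter_subset_left).const_mul _), setIntegral_const, smul_eq_mul,
            integral_const_mul]
          ring
      _ ≤ δ * (C * |T|) + M ^ 2 / (4 * δ) * ∫ q in D k, u q ^ 2 := by
          gcongr ?_ + _
          have h4 : volume.real (D k) ≤ C / ((k : ℝ) + 1) ^ 2 * |T| := by
            have := ENNReal.toReal_le_of_le_ofReal (by positivity) (hDvol k)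
            push_cast at this
            exact this
          calc δ * ((k : ℝ) + 1) ^ 2 * volume.real (D k)
              ≤ δ * ((k : ℝ) + 1) ^ 2 * (C / ((k : ℝ) + 1) ^ 2 * |T|) := by gcongr
            _ = δ * (C * |T|) := by field_simp
  rw [Metric.tendsto_atTop']
  intro ε hε
  set δ : ℝ := ε / (2 * (C * |T| + 1)) with hδ
  have hδ0 : 0 < δ := by positivity
  have h1 : δ * (C * |T|) < ε / 2 := by
    rw [hδ, div_mul_eq_mul_div, div_lt_div_iff₀ (by positivity) two_pos]
    nlinarith [mul_nonneg hC0 (abs_nonneg T)]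
  have h2 := hsq.const_mul (M ^ 2 / (4 * δ))
  rw [mul_zero] at h2
  obtain ⟨N, hN⟩ := eventually_atTop.1 (h2.eventually (gt_mem_nhds (half_pos hε)))
  refine ⟨N, fun k hk => ?_⟩
  rw [dist_zero_right]
  have := hbound δ hδ0 k
  have := hN k hk.le
  linarith

/-- Green's identity for `C¹` functions with square integrable derivatives and lateral values `A₃`
in domains with piecewise smooth boundary. -/
theorem GreenData.greenIdentity {Ω : Set E3} {T : ℝ} {u A₃ : SpaceTime → ℝ}
    (h : GreenData Ω T u A₃) (hΩs : HasPiecewiseSmoothBoundary Ω)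
    (hu : MemLp u 2 (volume.restrict (cyl Ω T))) (hA : HasLateralValue Ω T u A₃) (e : E3)
    {φ : SpaceTime → ℂ} (hφ : ContDiff ℝ 1 φ) : GreenIdentity Ω T u A₃ e φ := by
  have harea := h.area
  obtain ⟨-, m, γ₀, K, hγ₀, hreg⟩ := hΩs
  -- A constant arc at the origin is added so that `Γ` is nonempty even when there are no edges;
  -- `Metric.infDist` to the empty set would be `0`. Cutting out one more point does no harm.
  set γ : Option (Fin m) → ℝ → E3 := fun o => o.elim (fun _ => 0) γ₀ with hγdef
  have hγ : ∀ i, LipschitzOnWith K (γ i) (Icc 0 1) := by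
    intro i
    cases i with
    | none =>
      refine LipschitzOnWith.of_dist_le_mul fun x _ y _ => ?_
      simp only [hγdef, Option.elim_none, dist_self]
      positivity
    | some i => exact hγ₀ i
  set Γ : Set E3 := ⋃ i, γ i '' Icc 0 1 with hΓdef
  have hΓc : IsClosed Γ := (isCompact_iUnion fun i => isCompact_Icc.image_of_continuousOn
    (hγ i).continuousOn).isClosed
  have hΓne : Γ.Nonempty := ⟨0, mem_iUnion.2 ⟨none, 0, ⟨le_rfl, zero_le_one⟩, rfl⟩⟩
  have hΓ0 : μHE[2] Γ = 0 := euclideanHausdorffMeasure_arcs hγ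
  have hΓv : volume Γ = 0 := volume_eq_zero_of_euclideanHausdorffMeasure hΓ0
  obtain ⟨C, hC0, hC⟩ := exists_volume_tube_le hγ
  obtain ⟨C', hC'0, hC'⟩ := exists_cutoff Γ
  choose χ hχc hχ1 hχs hχone hχd hχd0 using fun k : ℕ => hC' (k + 1) (Nat.succ_pos k)
  have hχc1 : ∀ k, ContDiff ℝ 1 (χ k) := fun k => (hχc k).of_le (by exact_mod_cast le_top)
  -- The support of `χ k` avoids `Γ`, so each of its points in `closure Ω` is either interior or a
  -- regular boundary point, and a local identity is available.
  have hG : ∀ k, GreenIdentity Ω T u A₃ e (fun q => (χ k q.1 : ℂ) * φ q) := by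
    intro k
    refine h.glue (hχc1 k) (fun p hp => ?_) hφ
    by_cases hpΩ : p ∈ Ω
    · exact ⟨Ω, h.isOpen, hpΩ, fun φ hφ hs => h.local_interior hφ hs e⟩
    · have hpf : p ∈ frontier Ω := by
        rw [h.isOpen.frontier_eq]
        exact ⟨hp.1, hpΩ⟩
      obtain ⟨n, hn⟩ := hreg p hpf fun i hi => hχs k p hp.2 (mem_iUnion.2 ⟨some i, hi⟩)
      obtain ⟨r, hr, hG⟩ := h.local_boundary hA hn e
      exact ⟨Metric.ball p r, Metric.isOpen_ball, Metric.mem_ball_self hr, hG⟩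
  obtain ⟨B, hB0, hB⟩ := exists_bound_test h.isBounded T hφ
  have hlimχ : ∀ x, x ∉ Γ → ∀ᶠ k in atTop, χ k x = 1 := by
    intro x hx
    have hpos := (hΓc.notMem_iff_infDist_pos hΓne).1 hx
    have h2 : Tendsto (fun k : ℕ => 4 / ((k + 1 : ℕ) : ℝ)) atTop (𝓝 0) := by
      have h3 := (tendsto_one_div_add_atTop_nhds_zero_nat (𝕜 := ℝ)).const_mul 4
      rw [mul_zero] at h3
      refine h3.congr fun k => ?_
      push_cast
      ring
    filter_upwards [h2.eventually (gt_mem_nhds hpos)] with k hk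
    exact hχone k x hk.le
  have hχcont : ∀ k, Continuous fun q : SpaceTime => (χ k q.1 : ℂ) := fun k =>
    Complex.continuous_ofReal.comp ((hχc k).continuous.comp continuous_fst)
  have hχn : ∀ k, ∀ q : SpaceTime, ‖(χ k q.1 : ℂ)‖ ≤ 1 := fun k q => by
    rw [Complex.norm_real]
    exact hχ1 k q.1
  have hFi := h.integrableOn_flowDeriv hφ e
  have hdc : ∀ k, Continuous fun q : SpaceTime => ((fderiv ℝ (χ k) q.1 e : ℝ) : ℂ) := fun k =>
    Complex.continuous_ofReal.comp ((((hχc1 k).continuous_fderiv (by simp)).comp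
      continuous_fst).clm_apply continuous_const)
  have hEi : ∀ k, IntegrableOn (fun q => (u q : ℂ) * (fderiv ℝ (χ k) q.1 e : ℝ) * φ q)
      (cyl Ω T) := fun k => by
    have := integrableOn_mul_test h.isOpen h.isBounded h.integrable ((hdc k).mul hφ.continuous)
    simp only [mul_assoc]
    exact this
  have hleft : Tendsto (fun k => ∫ q in cyl Ω T, (χ k q.1 : ℂ) * flowDeriv u φ e q) atTop
      (𝓝 (∫ q in cyl Ω T, flowDeriv u φ e q)) := by
    refine tendsto_integral_of_dominated_convergence (fun q => ‖flowDeriv u φ e q‖)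
      (fun k => ((hχcont k).aestronglyMeasurable).mul hFi.aestronglyMeasurable) hFi.norm
      (fun k => ae_of_all _ fun q => ?_) ?_
    · rw [norm_mul]
      exact mul_le_of_le_one_left (norm_nonneg _) (hχn k q)
    · have hnull : ∀ᵐ q : SpaceTime, q.1 ∉ Γ :=
        Measure.quasiMeasurePreserving_fst.ae (measure_eq_zero_iff_ae_notMem.1 hΓv)
      filter_upwards [ae_restrict_of_ae hnull] with q hq
      refine tendsto_const_nhds.congr' ?_
      filter_upwards [hlimχ q.1 hq] with k hk
      rw [hk, Complex.ofReal_one, one_mul]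
  have herr : Tendsto (fun k => ∫ q in cyl Ω T, (u q : ℂ) * (fderiv ℝ (χ k) q.1 e : ℝ) * φ q) atTop
      (𝓝 0) := by
    refine tendsto_cutoff_error h.isOpen hu hΓc hΓne hΓv hC0 hC (M := C' * ‖e‖ * B)
      (fun k q hq => ?_) (fun k q hq => ?_)
    · rw [norm_mul, norm_mul, Complex.norm_real, Complex.norm_real, Real.norm_eq_abs]
      have h1 : ‖fderiv ℝ (χ k) q.1 e‖ ≤ C' * ((k + 1 : ℕ) : ℝ) * ‖e‖ :=
        ((fderiv ℝ (χ k) q.1).le_opNorm e).trans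
          (mul_le_mul_of_nonneg_right (hχd k q.1) (norm_nonneg e))
      have h2 := (hB q (cyl_subset Ω T hq)).1
      push_cast at h1
      calc |u q| * ‖fderiv ℝ (χ k) q.1 e‖ * ‖φ q‖
          ≤ |u q| * (C' * ((k : ℝ) + 1) * ‖e‖) * B := by gcongr
        _ = C' * ‖e‖ * B * (k + 1) * |u q| := by ring
    · rw [hχd0 k q.1 hq]
      simp
  have hright : Tendsto (fun k => ∫ q, (A₃ q : ℂ) * (inner ℝ (outwardNormal Ω q.1) e : ℝ) *
      ((χ k q.1 : ℂ) * φ q) ∂(lateralMeasure Ω T)) atTop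
      (𝓝 (∫ q, (A₃ q : ℂ) * (inner ℝ (outwardNormal Ω q.1) e : ℝ) * φ q
        ∂(lateralMeasure Ω T))) := by
    have hRi := integrable_lateral_mul_test h.isOpen h.isBounded h.integrable_lateral e
      hφ.continuous
    have hcomm : ∀ k q, (A₃ q : ℂ) * (inner ℝ (outwardNormal Ω q.1) e : ℝ) *
      ((χ k q.1 : ℂ) * φ q) = (χ k q.1 : ℂ) * ((A₃ q : ℂ) *
        (inner ℝ (outwardNormal Ω q.1) e : ℝ) * φ q) := fun k q => by ring
    simp only [hcomm]
    refine tendsto_integral_of_dominated_convergence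
      (fun q => ‖(A₃ q : ℂ) * (inner ℝ (outwardNormal Ω q.1) e : ℝ) * φ q‖)
      (fun k => ((hχcont k).aestronglyMeasurable).mul hRi.aestronglyMeasurable) hRi.norm
      (fun k => ae_of_all _ fun q => ?_) ?_
    · rw [norm_mul]
      exact mul_le_of_le_one_left (norm_nonneg _) (hχn k q)
    · have hnull : ∀ᵐ q ∂(lateralMeasure Ω T), q.1 ∉ Γ := by
        refine Measure.quasiMeasurePreserving_fst.ae (measure_eq_zero_iff_ae_notMem.1 ?_)
        exact le_antisymm ((Measure.restrict_apply_le _ _).trans hΓ0.le) (by simp)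
      filter_upwards [hnull] with q hq
      refine tendsto_const_nhds.congr' ?_
      filter_upwards [hlimχ q.1 hq] with k hk
      rw [hk, Complex.ofReal_one, one_mul]
  -- By the product rule the left side for `χ φ` splits into a part converging by domination and the
  -- error carrying the gradient of `χ`.
  have hsplit : ∀ k, (∫ q in cyl Ω T, (χ k q.1 : ℂ) * flowDeriv u φ e q) +
      (∫ q in cyl Ω T, (u q : ℂ) * (fderiv ℝ (χ k) q.1 e : ℝ) * φ q) =
      ∫ q, (A₃ q : ℂ) * (inner ℝ (outwardNormal Ω q.1) e : ℝ) *
      ((χ k q.1 : ℂ) * φ q) ∂(lateralMeasure Ω T) := by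
    intro k
    rw [← hG k, ← integral_add (hFi.bdd_mul (hχcont k).aestronglyMeasurable
      (ae_of_all _ (hχn k))) (hEi k)]
    refine integral_congr_ae (ae_of_all _ fun q => ?_)
    exact (flowDeriv_spatial_mul (hχc1 k) hφ e q).symm
  have hfinal := hleft.add herr
  simp only [hsplit, add_zero] at hfinal
  exact tendsto_nhds_unique hfinal hright

/-! ### The time direction -/

/-- Up to a constant, `v` is the primitive of `v'`, which is continuous on the closed interval. -/
lemma exists_limits_of_integrable_deriv {T : ℝ} (hT : 0 < T) {v v' : ℝ → ℂ}
    (hd : ∀ t ∈ Ioo 0 T, HasDerivAt v (v' t) t) (hi : IntegrableOn v' (Ioo 0 T)) :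
    ∃ L₀ L₁, Tendsto v (𝓝[>] 0) (𝓝 L₀) ∧ Tendsto v (𝓝[<] T) (𝓝 L₁) := by
  have hi' : IntegrableOn v' (Icc 0 T) :=
    (integrableOn_Icc_iff_integrableOn_Ioo (by simp) (by simp)).2 hi
  have hP : ContinuousOn (fun t => ∫ s in (0 : ℝ)..t, v' s) (Icc 0 T) := by
    have := intervalIntegral.continuousOn_primitive_interval (μ := volume) (f := v') (a := 0)
      (b := T) (by rwa [uIcc_of_le hT.le])
    rwa [uIcc_of_le hT.le] at this
  have hii : ∀ a ∈ Icc 0 T, ∀ b ∈ Icc 0 T, IntervalIntegrable v' volume a b := by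
    intro a ha b hb
    refine (hi'.mono_set ?_).intervalIntegrable
    exact uIcc_subset_Icc ha hb
  set c := T / 2 with hc
  have hcm : c ∈ Ioo 0 T := ⟨by linarith, by linarith⟩
  have hv : ∀ t ∈ Ioo 0 T, v t = (∫ s in (0 : ℝ)..t, v' s) + (v c - ∫ s in (0 : ℝ)..c, v' s) := by
    intro t ht
    have h1 : ∫ s in c..t, v' s = v t - v c := by
      refine intervalIntegral.integral_eq_sub_of_hasDerivAt (fun s hs => hd s ?_)
        (hii c (Ioo_subset_Icc_self hcm) t (Ioo_subset_Icc_self ht))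
      exact ordConnected_Ioo.uIcc_subset hcm ht hs
    have h2 := intervalIntegral.integral_add_adjacent_intervals
      (hii 0 ⟨le_rfl, hT.le⟩ c (Ioo_subset_Icc_self hcm))
      (hii c (Ioo_subset_Icc_self hcm) t (Ioo_subset_Icc_self ht))
    rw [← h2, h1]
    ring
  refine ⟨(∫ s in (0 : ℝ)..0, v' s) + (v c - ∫ s in (0 : ℝ)..c, v' s),
    (∫ s in (0 : ℝ)..T, v' s) + (v c - ∫ s in (0 : ℝ)..c, v' s), ?_, ?_⟩
  · have h1 := ((hP 0 ⟨le_rfl, hT.le⟩).mono Ioo_subset_Icc_self).tendsto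
    rw [nhdsWithin_Ioo_eq_nhdsGT hT] at h1
    refine (h1.add_const (v c - ∫ s in (0 : ℝ)..c, v' s)).congr' ?_
    filter_upwards [Ioo_mem_nhdsGT hT] with t ht
    exact (hv t ht).symm
  · have h1 := ((hP T ⟨hT.le, le_rfl⟩).mono Ioo_subset_Icc_self).tendsto
    rw [nhdsWithin_Ioo_eq_nhdsLT hT] at h1
    refine (h1.add_const (v c - ∫ s in (0 : ℝ)..c, v' s)).congr' ?_
    filter_upwards [Ioo_mem_nhdsLT hT] with t ht
    exact (hv t ht).symm

/-- The time derivative of `u φ`. -/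
def timeDeriv (u : SpaceTime → ℝ) (φ : SpaceTime → ℂ) (q : SpaceTime) : ℂ :=
  (dt u q : ℂ) * φ q + u q * fderiv ℝ φ q (0, 1)

/-- `∫ ∂_t(u φ) = ∫ (A₂ φ(x, T) - A₁ φ(x, 0)) dx`. -/
def TimeIdentity (Ω : Set E3) (T : ℝ) (u : SpaceTime → ℝ) (A₁ A₂ : E3 → ℝ) (φ : SpaceTime → ℂ) :
    Prop :=
  ∫ q in cyl Ω T, timeDeriv u φ q = ∫ x in Ω, ((A₂ x : ℂ) * φ (x, T) - (A₁ x : ℂ) * φ (x, 0))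

section

variable {Ω : Set E3} {T : ℝ} {u : SpaceTime → ℝ} {A₁ A₂ : E3 → ℝ}

lemma integrableOn_timeDeriv (hΩ : IsOpen Ω) (hΩb : Bornology.IsBounded Ω)
    (hu : IntegrableOn u (cyl Ω T)) (hut : IntegrableOn (dt u) (cyl Ω T)) {φ : SpaceTime → ℂ}
    (hφ : ContDiff ℝ 1 φ) : IntegrableOn (timeDeriv u φ) (cyl Ω T) :=
  (integrableOn_mul_test hΩ hΩb hut hφ.continuous).add
    (integrableOn_mul_test hΩ hΩb hu
      ((hφ.continuous_fderiv (by simp)).clm_apply continuous_const))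

lemma hasDerivAt_timeLine (hΩ : IsOpen Ω) (hu : ContDiffOn ℝ 1 u (cyl Ω T)) {φ : SpaceTime → ℂ}
    (hφ : ContDiff ℝ 1 φ) {x : E3} (hx : x ∈ Ω) {t : ℝ} (ht : t ∈ Ioo 0 T) :
    HasDerivAt (fun t : ℝ => (u (x, t) : ℂ) * φ (x, t)) (timeDeriv u φ (x, t)) t := by
  have hc : HasDerivAt (fun t : ℝ => ((x, t) : SpaceTime)) ((0, 1) : SpaceTime) t :=
    (hasDerivAt_const t x).prodMk (hasDerivAt_id t)
  have hu' := (hu.contDiffAt ((cyl_isOpen hΩ T).mem_nhds (show (x, t) ∈ cyl Ω T from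
    ⟨hx, ht⟩))).differentiableAt (by simp)
  have h1 := (hu'.hasFDerivAt.comp_hasDerivAt t hc).ofReal_comp
  have h2 := ((hφ.differentiable (by simp)) (x, t)).hasFDerivAt.comp_hasDerivAt t hc
  exact h1.mul h2

lemma cyl_restrict (Ω : Set E3) (T : ℝ) : (volume : Measure SpaceTime).restrict (cyl Ω T) =
    ((volume : Measure E3).restrict Ω).prod ((volume : Measure ℝ).restrict (Ioo 0 T)) := by
  rw [cyl, Measure.volume_eq_prod, Measure.prod_restrict]

lemma ae_timeLine (hΩ : IsOpen Ω) (hT : 0 < T) (hu : ContDiffOn ℝ 1 u (cyl Ω T))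
    {φ : SpaceTime → ℂ} (hφ : ContDiff ℝ 1 φ) (hi : IntegrableOn (timeDeriv u φ) (cyl Ω T)) :
    ∀ᵐ x ∂(volume.restrict Ω), ∀ L₀ L₁ : ℂ,
      Tendsto (fun t : ℝ => (u (x, t) : ℂ) * φ (x, t)) (𝓝[>] 0) (𝓝 L₀) →
      Tendsto (fun t : ℝ => (u (x, t) : ℂ) * φ (x, t)) (𝓝[<] T) (𝓝 L₁) →
      ∫ t in Ioo 0 T, timeDeriv u φ (x, t) = L₁ - L₀ := by
  rw [IntegrableOn, cyl_restrict] at hi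
  filter_upwards [hi.prod_right_ae, ae_restrict_mem hΩ.measurableSet] with x hxi hx L₀ L₁ h0 h1
  have hii : IntervalIntegrable (fun t => timeDeriv u φ (x, t)) volume 0 T :=
    (intervalIntegrable_iff_integrableOn_Ioo_of_le hT.le).2 hxi
  rw [← intervalIntegral.integral_eq_sub_of_hasDerivAt_of_tendsto hT
    (fun t ht => hasDerivAt_timeLine hΩ hu hφ hx ht) hii h0 h1,
    intervalIntegral.integral_of_le hT.le, integral_Ioc_eq_integral_Ioo]

lemma integral_cyl_eq {G : SpaceTime → ℂ} (hG : IntegrableOn G (cyl Ω T)) :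
    ∫ q in cyl Ω T, G q = ∫ x in Ω, ∫ t in Ioo 0 T, G (x, t) := by
  rw [IntegrableOn, cyl_restrict] at hG
  rw [cyl_restrict, integral_prod _ hG]

lemma tendsto_timeLine {φ : SpaceTime → ℂ} (hφ : Continuous φ) (x : E3) (t₀ : ℝ) (s : Set ℝ) :
    Tendsto (fun t : ℝ => φ (x, t)) (𝓝[s] t₀) (𝓝 (φ (x, t₀))) := by
  have : Continuous fun t : ℝ => φ (x, t) := hφ.comp (by fun_prop)
  exact (this.tendsto t₀).mono_left nhdsWithin_le_nhds

theorem timeIdentity (hΩ : IsOpen Ω) (hΩb : Bornology.IsBounded Ω) (hT : 0 < T)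
    (hu : ContDiffOn ℝ 1 u (cyl Ω T)) (hui : IntegrableOn u (cyl Ω T))
    (hut : IntegrableOn (dt u) (cyl Ω T)) (h₁ : HasInitialValue Ω u A₁)
    (h₂ : HasTerminalValue Ω T u A₂) {φ : SpaceTime → ℂ} (hφ : ContDiff ℝ 1 φ) :
    TimeIdentity Ω T u A₁ A₂ φ := by
  have hi := integrableOn_timeDeriv hΩ hΩb hui hut hφ
  rw [TimeIdentity, integral_cyl_eq hi]
  refine integral_congr_ae ?_
  filter_upwards [ae_timeLine hΩ hT hu hφ hi, h₁, h₂] with x hx h1 h2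
  exact hx _ _ (((Complex.continuous_ofReal.tendsto _).comp h1).mul
    (tendsto_timeLine hφ.continuous x 0 _))
    (((Complex.continuous_ofReal.tendsto _).comp h2).mul (tendsto_timeLine hφ.continuous x T _))

/-- If the time identity holds for all test functions, then `u` has the initial and terminal
values `A₁` and `A₂`. -/
theorem initial_terminal_of_timeIdentity (hΩ : IsOpen Ω) (hΩb : Bornology.IsBounded Ω) (hT : 0 < T)
    (hu : ContDiffOn ℝ 1 u (cyl Ω T)) (hui : IntegrableOn u (cyl Ω T))
    (hut : IntegrableOn (dt u) (cyl Ω T)) (hA₁ : IntegrableOn A₁ Ω) (hA₂ : IntegrableOn A₂ Ω)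
    (hid : ∀ η : SpaceTime → ℝ, ContDiff ℝ (⊤ : ℕ∞) η → HasCompactSupport η →
      TimeIdentity Ω T u A₁ A₂ (fun q => (η q : ℂ))) :
    HasInitialValue Ω u A₁ ∧ HasTerminalValue Ω T u A₂ := by
  -- Testing with products `η(x) χ(t)` and varying `η` localizes the identity to almost every `x`.
  have key : ∀ χ : ℝ → ℝ, ContDiff ℝ (⊤ : ℕ∞) χ → HasCompactSupport χ →
      ∀ᵐ x ∂(volume.restrict Ω), ∫ t in Ioo 0 T, timeDeriv u (fun q => (χ q.2 : ℂ)) (x, t) =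
        (A₂ x : ℂ) * χ T - (A₁ x : ℂ) * χ 0 := by
    intro χ hχ hχs
    have hχc : ContDiff ℝ 1 (fun q : SpaceTime => (χ q.2 : ℂ)) :=
      Complex.ofRealCLM.contDiff.comp ((hχ.of_le (by exact_mod_cast le_top)).comp contDiff_snd)
    have hi := integrableOn_timeDeriv hΩ hΩb hui hut hχc
    have hgi : IntegrableOn (fun x => ∫ t in Ioo 0 T, timeDeriv u (fun q => (χ q.2 : ℂ)) (x, t))
        Ω := by
      rw [IntegrableOn, cyl_restrict] at hi
      exact hi.integral_prod_left
    have hri : IntegrableOn (fun x => (A₂ x : ℂ) * χ T - (A₁ x : ℂ) * χ 0) Ω :=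
      (hA₂.ofReal.mul_const _).sub (hA₁.ofReal.mul_const _)
    have h0 := hΩ.ae_eq_zero_of_integral_contDiff_smul_eq_zero (μ := volume.restrict Ω)
      (((hgi.sub hri).locallyIntegrable).locallyIntegrableOn Ω) fun η hη hηc hηs => ?_
    · filter_upwards [h0, ae_restrict_mem hΩ.measurableSet] with x hx hxΩ
      exact sub_eq_zero.1 (hx hxΩ)
    set ψ : SpaceTime → ℝ := fun q => η q.1 * χ q.2 with hψ
    have hψc : ContDiff ℝ (⊤ : ℕ∞) ψ := (hη.comp contDiff_fst).mul (hχ.comp contDiff_snd)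
    have hψs : HasCompactSupport ψ := by
      refine HasCompactSupport.intro (hηc.isCompact.prod hχs.isCompact) fun q hq => ?_
      rw [mem_prod, not_and_or] at hq
      rcases hq with hq | hq
      · simp [hψ, image_eq_zero_of_notMem_tsupport hq]
      · simp [hψ, image_eq_zero_of_notMem_tsupport hq]
    have hψc1 : ContDiff ℝ 1 (fun q => (ψ q : ℂ)) :=
      Complex.ofRealCLM.contDiff.comp (hψc.of_le (by exact_mod_cast le_top))
    have h1 := hid ψ hψc hψs
    rw [TimeIdentity, integral_cyl_eq (integrableOn_timeDeriv hΩ hΩb hui hut hψc1)] at h1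
    have h2 : ∀ x t, timeDeriv u (fun q => (ψ q : ℂ)) (x, t) =
        (η x : ℂ) * timeDeriv u (fun q => (χ q.2 : ℂ)) (x, t) := by
      intro x t
      have hη1 : ContDiff ℝ 1 η := hη.of_le (by exact_mod_cast le_top)
      have e1 : HasFDerivAt (fun q : SpaceTime => (η q.1 : ℂ)) (Complex.ofRealCLM.comp
          ((fderiv ℝ η x).comp (ContinuousLinearMap.fst ℝ E3 ℝ))) (x, t) :=
        Complex.ofRealCLM.hasFDerivAt.comp (x, t)
          ((hη1.differentiable (by simp) x).hasFDerivAt.comp (x, t) hasFDerivAt_fst)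
      have e2 := (e1.mul (hχc.differentiable (by simp) (x, t)).hasFDerivAt).fderiv
      have e3 : (fun q => (ψ q : ℂ)) =
          (fun q : SpaceTime => (η q.1 : ℂ)) * fun q : SpaceTime => (χ q.2 : ℂ) := by
        funext q
        simp [hψ]
      simp only [timeDeriv]
      have e4 : (ψ (x, t) : ℂ) = (η x : ℂ) * (χ t : ℂ) := by simp [hψ]
      rw [e4, e3, e2]
      simp
      ring
    simp only [h2, integral_const_mul] at h1
    have h3 : ∀ x, η x • ((fun x => ∫ t in Ioo 0 T, timeDeriv u (fun q => (χ q.2 : ℂ)) (x, t)) -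
        fun x => (A₂ x : ℂ) * χ T - (A₁ x : ℂ) * χ 0) x =
        (η x : ℂ) * (∫ t in Ioo 0 T, timeDeriv u (fun q => (χ q.2 : ℂ)) (x, t)) -
        ((A₂ x : ℂ) * (ψ (x, T) : ℂ) - (A₁ x : ℂ) * (ψ (x, 0) : ℂ)) := by
      intro x
      simp only [Pi.sub_apply, Complex.real_smul, hψ]
      push_cast
      ring
    obtain ⟨C, hC⟩ := hηc.exists_bound_of_continuous hη.continuous
    have hηb : ∀ x, ‖(η x : ℂ)‖ ≤ C := fun x => by
      rw [Complex.norm_real]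
      exact hC x
    have hηm : AEStronglyMeasurable (fun x => (η x : ℂ)) (volume.restrict Ω) :=
      (Complex.continuous_ofReal.comp hη.continuous).aestronglyMeasurable
    have hri' : Integrable (fun x => (A₂ x : ℂ) * (ψ (x, T) : ℂ) - (A₁ x : ℂ) * (ψ (x, 0) : ℂ))
        (volume.restrict Ω) := by
      refine (hri.bdd_mul hηm (ae_of_all _ hηb)).congr (ae_of_all _ fun x => ?_)
      simp only [hψ]
      push_cast
      ring
    simp only [h3]
    rw [integral_sub (hgi.bdd_mul hηm (ae_of_all _ hηb)) hri', h1, sub_self]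
  have hone : ContDiff ℝ 1 (fun _ : SpaceTime => (1 : ℂ)) := contDiff_const
  have hi1 := integrableOn_timeDeriv hΩ hΩb hui hut hone
  have hlim : ∀ᵐ x ∂(volume.restrict Ω), ∃ L₀ L₁ : ℂ,
      Tendsto (fun t : ℝ => (u (x, t) : ℂ)) (𝓝[>] 0) (𝓝 L₀) ∧
      Tendsto (fun t : ℝ => (u (x, t) : ℂ)) (𝓝[<] T) (𝓝 L₁) := by
    rw [IntegrableOn, cyl_restrict] at hi1
    filter_upwards [hi1.prod_right_ae, ae_restrict_mem hΩ.measurableSet] with x hxi hx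
    refine exists_limits_of_integrable_deriv hT (v' := fun t => timeDeriv u (fun _ => 1) (x, t))
      (fun t ht => ?_) hxi
    simpa using hasDerivAt_timeLine hΩ hu hone hx ht
  -- Outer radius `T / 2 < T` makes each cutoff equal to `1` at one end of the time interval and `0`
  -- at the other, which separates the two limits.
  let χ₀ : ContDiffBump (0 : ℝ) := ⟨T / 4, T / 2, by linarith, by linarith⟩
  let χ₁ : ContDiffBump (T : ℝ) := ⟨T / 4, T / 2, by linarith, by linarith⟩
  have v00 : χ₀ 0 = 1 := χ₀.one_of_mem_closedBall (Metric.mem_closedBall_self (by positivity))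
  have v11 : χ₁ T = 1 := χ₁.one_of_mem_closedBall (Metric.mem_closedBall_self (by positivity))
  have v01 : χ₀ T = 0 := χ₀.zero_of_le_dist (by
    rw [Real.dist_eq, sub_zero, abs_of_pos hT]
    change T / 2 ≤ T
    linarith)
  have v10 : χ₁ 0 = 0 := χ₁.zero_of_le_dist (by
    rw [Real.dist_eq, zero_sub, abs_neg, abs_of_pos hT]
    change T / 2 ≤ T
    linarith)
  have hc : ∀ χ : ℝ → ℝ, ContDiff ℝ (⊤ : ℕ∞) χ →
      ContDiff ℝ 1 (fun q : SpaceTime => (χ q.2 : ℂ)) := fun χ hχ =>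
    Complex.ofRealCLM.contDiff.comp ((hχ.of_le (by exact_mod_cast le_top)).comp contDiff_snd)
  have hl : ∀ χ : ℝ → ℝ, ContDiff ℝ (⊤ : ℕ∞) χ →
      ∀ᵐ x ∂(volume.restrict Ω), ∀ L₀ L₁ : ℂ,
      Tendsto (fun t : ℝ => (u (x, t) : ℂ)) (𝓝[>] 0) (𝓝 L₀) →
      Tendsto (fun t : ℝ => (u (x, t) : ℂ)) (𝓝[<] T) (𝓝 L₁) →
      ∫ t in Ioo 0 T, timeDeriv u (fun q => (χ q.2 : ℂ)) (x, t) = L₁ * χ T - L₀ * χ 0 := by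
    intro χ hχ
    filter_upwards [ae_timeLine hΩ hT hu (hc χ hχ)
      (integrableOn_timeDeriv hΩ hΩb hui hut (hc χ hχ))] with x hx L₀ L₁ h0 h1
    exact hx _ _ (h0.mul (tendsto_timeLine (hc χ hχ).continuous x 0 _))
      (h1.mul (tendsto_timeLine (hc χ hχ).continuous x T _))
  have hre : ∀ {l : Filter ℝ} {x : E3} {y : ℝ},
      Tendsto (fun t : ℝ => (u (x, t) : ℂ)) l (𝓝 (y : ℂ)) →
      Tendsto (fun t : ℝ => u (x, t)) l (𝓝 y) := by
    intro l x y h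
    simpa [Function.comp_def] using (Complex.continuous_re.tendsto _).comp h
  constructor
  · filter_upwards [hlim, key χ₀ χ₀.contDiff χ₀.hasCompactSupport, hl χ₀ χ₀.contDiff]
      with x hx h1 h2
    obtain ⟨L₀, L₁, l0, l1⟩ := hx
    have h3 := (h2 L₀ L₁ l0 l1).symm.trans h1
    simp only [v00, v01, Complex.ofReal_zero, Complex.ofReal_one, mul_zero, mul_one, zero_sub,
      neg_inj] at h3
    rw [h3] at l0
    exact hre l0
  · filter_upwards [hlim, key χ₁ χ₁.contDiff χ₁.hasCompactSupport, hl χ₁ χ₁.contDiff]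
      with x hx h1 h2
    obtain ⟨L₀, L₁, l0, l1⟩ := hx
    have h3 := (h2 L₀ L₁ l0 l1).symm.trans h1
    simp only [v11, v10, Complex.ofReal_zero, Complex.ofReal_one, mul_zero, mul_one,
      sub_zero] at h3
    rw [h3] at l1
    exact hre l1

end

/-! ### Continuous functions with continuous weak derivatives -/

section

variable {E : Type*} [NormedAddCommGroup E] [NormedSpace ℝ E] [FiniteDimensional ℝ E]
  [MeasurableSpace E] [BorelSpace E] {μ : Measure E} [μ.IsAddHaarMeasure]

open scoped Convolution

lemma integrable_indicator_closedBall {F : Type*} [NormedAddCommGroup F] {v : E → F} {x : E}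
    {r : ℝ} (hv : ContinuousOn v (Metric.closedBall x r)) :
    Integrable ((Metric.closedBall x r).indicator v) μ := by
  have : ProperSpace E := FiniteDimensional.proper ℝ E
  exact (integrable_indicator_iff Metric.isClosed_closedBall.measurableSet).2
    (hv.integrableOn_compact (isCompact_closedBall x r))

/-- Differentiation falls on the mollifier, and `z ↦ φ(y - z)` is an admissible test function
supported in the ball, so the weak derivative takes it back; the sign comes from the reflection. The
indicators make both factors globally integrable without changing anything near `y`. -/
lemma fderiv_convolution_of_weak {U : Set E} {v : E → ℝ} {v' : E → E →L[ℝ] ℝ}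
    {x : E} {r : ℝ} (hK : Metric.closedBall x r ⊆ U)
    (hv : ContinuousOn v (Metric.closedBall x r)) (hv' : ContinuousOn v' (Metric.closedBall x r))
    (hw : ∀ η : E → ℝ, ContDiff ℝ (⊤ : ℕ∞) η → HasCompactSupport η → tsupport η ⊆ U → ∀ e,
      ∫ q, v q * fderiv ℝ η q e ∂μ = -∫ q, v' q e * η q ∂μ)
    (φ : ContDiffBump (0 : E)) {y : E} (hy : Metric.closedBall y φ.rOut ⊆ Metric.closedBall x r) :
    HasFDerivAt (φ.normed μ ⋆[ContinuousLinearMap.lsmul ℝ ℝ, μ]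
        (Metric.closedBall x r).indicator v)
      ((φ.normed μ ⋆[ContinuousLinearMap.lsmul ℝ ℝ, μ] (Metric.closedBall x r).indicator v') y)
      y := by
  have hg := (integrable_indicator_closedBall (μ := μ) hv).locallyIntegrable
  have hg' := (integrable_indicator_closedBall (μ := μ) hv').locallyIntegrable
  have hφs : HasCompactSupport (φ.normed μ) := φ.hasCompactSupport_normed
  have h1 := hφs.hasFDerivAt_convolution_left (ContinuousLinearMap.lsmul ℝ ℝ)
    (φ.contDiff_normed (n := 1)) hg y
  refine h1.congr_fderiv (Eq.symm ?_)
  have i1 := (hφs.convolutionExists_left (ContinuousLinearMap.lsmul ℝ ℝ)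
    (φ.continuous_normed (μ := μ)) hg' y).integrable_swap
  have i2 := ((hφs.fderiv (𝕜 := ℝ)).convolutionExists_left
    ((ContinuousLinearMap.lsmul ℝ ℝ).precompL E)
    ((φ.contDiff_normed (n := 1) (μ := μ)).continuous_fderiv (by simp)) hg y).integrable_swap
  ext e
  rw [convolution_eq_swap, convolution_eq_swap, ContinuousLinearMap.integral_apply i1,
    ContinuousLinearMap.integral_apply i2]
  set η : E → ℝ := fun z => φ.normed μ (y - z) with hη
  have hηc : ContDiff ℝ (⊤ : ℕ∞) η := φ.contDiff_normed.comp (contDiff_const.sub contDiff_id)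
  have hηz : ∀ z, z ∉ Metric.closedBall y φ.rOut → η z = 0 := by
    intro z hz
    have : y - z ∉ tsupport (φ.normed μ) := by
      rw [φ.tsupport_normed_eq]
      simpa [dist_eq_norm, norm_sub_rev] using hz
    change φ.normed μ (y - z) = 0
    exact image_eq_zero_of_notMem_tsupport this
  have hpr : ProperSpace E := FiniteDimensional.proper ℝ E
  have hηs : HasCompactSupport η := HasCompactSupport.intro (isCompact_closedBall y φ.rOut) hηz
  have hηt : tsupport η ⊆ Metric.closedBall y φ.rOut := by
    refine closure_minimal (fun z hz => ?_) Metric.isClosed_closedBall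
    by_contra h
    exact hz (hηz z h)
  have hd : ∀ z, fderiv ℝ η z e = - fderiv ℝ (φ.normed μ) (y - z) e := by
    intro z
    have h2 : HasFDerivAt η ((fderiv ℝ (φ.normed μ) (y - z)).comp
        (-ContinuousLinearMap.id ℝ E)) z :=
      (((φ.contDiff_normed (n := 1) (μ := μ)).differentiable (by simp)
        (y - z)).hasFDerivAt).comp z ((hasFDerivAt_id z).const_sub y)
    rw [h2.fderiv]
    simp
  have hdz : ∀ z, z ∉ Metric.closedBall x r → fderiv ℝ η z e = 0 := by
    intro z hz
    have : z ∉ tsupport (fderiv ℝ η) := fun h => hz (hy (hηt (tsupport_fderiv_subset ℝ h)))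
    rw [image_eq_zero_of_notMem_tsupport this]
    rfl
  have h3 := hw η hηc hηs (hηt.trans (hy.trans hK)) e
  rw [← neg_eq_iff_eq_neg, ← integral_neg] at h3
  refine Eq.trans ?_ (h3.symm.trans ?_)
  · refine integral_congr_ae (ae_of_all _ fun z => ?_)
    by_cases hz : z ∈ Metric.closedBall x r
    · simp [indicator_of_mem hz, hη, mul_comm]
    · have h0 := hηz z fun h => hz (hy h)
      simp [indicator_of_notMem hz, h0]
  · refine integral_congr_ae (ae_of_all _ fun z => ?_)
    by_cases hz : z ∈ Metric.closedBall x r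
    · simp [indicator_of_mem hz, hd, mul_comm]
    · simp [indicator_of_notMem hz, hdz z hz]

lemma exists_dist_normed_convolution_le {F : Type*} [NormedAddCommGroup F] [NormedSpace ℝ F]
    [CompleteSpace F] {v : E → F} {x : E} {r ε : ℝ}
    (hv : ContinuousOn v (Metric.closedBall x r)) (hε : 0 < ε) :
    ∃ δ > 0, ∀ φ : ContDiffBump (0 : E), φ.rOut ≤ δ → ∀ y,
      Metric.closedBall y φ.rOut ⊆ Metric.closedBall x r →
      dist ((φ.normed μ ⋆[ContinuousLinearMap.lsmul ℝ ℝ, μ]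
        (Metric.closedBall x r).indicator v) y) (v y) ≤ ε := by
  have hpr : ProperSpace E := FiniteDimensional.proper ℝ E
  obtain ⟨δ, hδ, h⟩ := Metric.uniformContinuousOn_iff.1
    ((isCompact_closedBall x r).uniformContinuousOn_of_continuous hv) ε hε
  refine ⟨δ, hδ, fun φ hφ y hy => ?_⟩
  have hyx : y ∈ Metric.closedBall x r := hy (Metric.mem_closedBall_self φ.rOut_pos.le)
  have h1 := φ.dist_normed_convolution_le (μ := μ) (x₀ := y) (ε := ε)
    (integrable_indicator_closedBall (μ := μ) hv).aestronglyMeasurable fun z hz => by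
      have hzx := hy (Metric.ball_subset_closedBall hz)
      rw [indicator_of_mem hzx, indicator_of_mem hyx]
      exact (h z hzx y hyx ((Metric.mem_ball.1 hz).trans_le hφ)).le
  rwa [indicator_of_mem hyx] at h1

/-- A continuous function whose weak derivative is continuous is differentiable. -/
theorem hasFDerivAt_of_weak {U : Set E} (hU : IsOpen U) {v : E → ℝ} {v' : E → E →L[ℝ] ℝ}
    (hv : ContinuousOn v U) (hv' : ContinuousOn v' U)
    (hw : ∀ η : E → ℝ, ContDiff ℝ (⊤ : ℕ∞) η → HasCompactSupport η → tsupport η ⊆ U → ∀ e,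
      ∫ q, v q * fderiv ℝ η q e ∂μ = -∫ q, v' q e * η q ∂μ)
    {x : E} (hx : x ∈ U) : HasFDerivAt v (v' x) x := by
  obtain ⟨r, hr, hrU⟩ := Metric.nhds_basis_closedBall.mem_iff.1 (hU.mem_nhds hx)
  have hr2 : 0 < r / 2 := by positivity
  -- Radii of at most `r / 2` keep the mollification on the ball of radius `r / 2` inside the closed
  -- ball of radius `r`. There the mollified functions converge pointwise and their derivatives
  -- uniformly.
  let φ : ℕ → ContDiffBump (0 : E) := fun n =>
    ⟨r / 2 / (n + 1) / 2, r / 2 / (n + 1), by positivity, half_lt_self (by positivity)⟩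
  have hφ0 : Tendsto (fun n => (φ n).rOut) atTop (𝓝 0) := by
    have := (tendsto_one_div_add_atTop_nhds_zero_nat (𝕜 := ℝ)).const_mul (r / 2)
    simpa [φ, div_eq_mul_inv] using this
  have hφr : ∀ n, (φ n).rOut ≤ r / 2 := fun n =>
    div_le_self hr2.le (by linarith [Nat.cast_nonneg (α := ℝ) n])
  have hsub : ∀ n, ∀ y ∈ Metric.ball x (r / 2),
      Metric.closedBall y (φ n).rOut ⊆ Metric.closedBall x r := by
    intro n y hy
    refine Metric.closedBall_subset_closedBall' ?_
    have := Metric.mem_ball.1 hy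
    linarith [hφr n]
  refine hasFDerivAt_of_tendstoUniformlyOn (l := atTop) (s := Metric.ball x (r / 2))
    (f := fun n => (φ n).normed μ ⋆[ContinuousLinearMap.lsmul ℝ ℝ, μ]
        (Metric.closedBall x r).indicator v)
    (f' := fun n => (φ n).normed μ ⋆[ContinuousLinearMap.lsmul ℝ ℝ, μ]
        (Metric.closedBall x r).indicator v')
    Metric.isOpen_ball ?_ ?_ ?_ (Metric.mem_ball_self hr2)
  · rw [Metric.tendstoUniformlyOn_iff]
    intro ε hε
    obtain ⟨δ, hδ, h⟩ := exists_dist_normed_convolution_le (μ := μ) (hv'.mono hrU) (half_pos hε)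
    filter_upwards [hφ0.eventually (ge_mem_nhds hδ)] with n hn y hy
    rw [dist_comm]
    exact (h (φ n) hn y (hsub n y hy)).trans_lt (half_lt_self hε)
  · intro n y hy
    exact fderiv_convolution_of_weak hrU (hv.mono hrU) (hv'.mono hrU) hw (φ n) (hsub n y hy)
  · intro y hy
    rw [Metric.tendsto_nhds]
    intro ε hε
    obtain ⟨δ, hδ, h⟩ := exists_dist_normed_convolution_le (μ := μ) (hv.mono hrU) (half_pos hε)
    filter_upwards [hφ0.eventually (ge_mem_nhds hδ)] with n hn
    exact (h (φ n) hn y (hsub n y hy)).trans_lt (half_lt_self hε)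

end

theorem contDiffOn_one_of_hasFDerivAt {E : Type*} [NormedAddCommGroup E]
    [NormedSpace ℝ E] {U : Set E} (hU : IsOpen U) {v : E → ℝ}
    {v' : E → E →L[ℝ] ℝ} (hv' : ContinuousOn v' U) (h : ∀ x ∈ U, HasFDerivAt v (v' x) x) :
    ContDiffOn ℝ 1 v U := by
  have h1 := contDiffOn_succ_iff_fderiv_of_isOpen (𝕜 := ℝ) (n := 0) (f := v) hU
  rw [zero_add] at h1
  refine h1.2 ⟨fun x hx => (h x hx).differentiableAt.differentiableWithinAt, by simp, ?_⟩
  exact contDiffOn_zero.2 (hv'.congr fun x hx => (h x hx).fderiv)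

/-! ### Solutions and weak solutions -/

/-- The hypotheses on the domain and on the initial, terminal and lateral data. -/
structure ProblemData (Ω : Set E3) (T : ℝ) (A₁ A₂ : E3 → ℝ) (A₃ : SpaceTime → ℝ) : Prop where
  isOpen : IsOpen Ω
  isBounded : Bornology.IsBounded Ω
  boundary : HasPiecewiseSmoothBoundary Ω
  pos : 0 < T
  memLp_initial : MemLp A₁ 2 (volume.restrict Ω)
  memLp_terminal : MemLp A₂ 2 (volume.restrict Ω)
  memLp_lateral : MemLp A₃ 2 (lateralMeasure Ω T)

/-- The hypotheses on a candidate `Z` for `(u, u_x, u_y, u_z)` and a candidate `g` for `u_t`. -/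
structure StateData (Ω : Set E3) (T : ℝ) (Z : SpaceTime → Fin 4 → ℝ) (g : SpaceTime → ℝ) :
    Prop where
  continuousOn : ContinuousOn Z (cyl Ω T)
  continuousOn_time : ContinuousOn g (cyl Ω T)
  memLp : ∀ k, MemLp (fun p => Z p k) 2 (volume.restrict (cyl Ω T))
  memLp_time : MemLp g 2 (volume.restrict (cyl Ω T))

/-- `(Z₁, Z₂, Z₃, g)` is the gradient of `Z₀` with the initial, terminal and lateral values
`A₁, A₂, A₃`, tested against `φ`. -/
structure WeakIdentities (Ω : Set E3) (T : ℝ) (A₁ A₂ : E3 → ℝ) (A₃ : SpaceTime → ℝ)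
    (Z : SpaceTime → Fin 4 → ℝ) (g : SpaceTime → ℝ) (φ : SpaceTime → ℂ) : Prop where
  time : ∫ q in cyl Ω T, ((g q : ℂ) * φ q + Z q 0 * fderiv ℝ φ q (0, 1)) =
    ∫ x in Ω, ((A₂ x : ℂ) * φ (x, T) - (A₁ x : ℂ) * φ (x, 0))
  lateral (k : Fin 3) :
    ∫ q in cyl Ω T, ((Z q k.succ : ℂ) * φ q +
      Z q 0 * fderiv ℝ φ q (EuclideanSpace.single k 1, 0)) =
    ∫ q, (A₃ q : ℂ) * (outwardNormal Ω q.1 k : ℂ) * φ q ∂(lateralMeasure Ω T)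

section

variable {Ω : Set E3} {T : ℝ} {A₁ A₂ : E3 → ℝ} {A₃ : SpaceTime → ℝ}
  {Z : SpaceTime → Fin 4 → ℝ} {g : SpaceTime → ℝ}

lemma ProblemData.isFiniteMeasure_surface (h : ProblemData Ω T A₁ A₂ A₃) :
    IsFiniteMeasure (surfaceMeasure Ω) :=
  ⟨by rw [surfaceMeasure, Measure.restrict_apply_univ]; exact h.boundary.1⟩

lemma ProblemData.isFiniteMeasure_lateral (h : ProblemData Ω T A₁ A₂ A₃) :
    IsFiniteMeasure (lateralMeasure Ω T) := by
  have := h.isFiniteMeasure_surface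
  have : IsFiniteMeasure (volume.restrict (Ioo (0 : ℝ) T)) := ⟨by simp⟩
  rw [lateralMeasure]
  infer_instance

lemma ProblemData.isFiniteMeasure_domain (h : ProblemData Ω T A₁ A₂ A₃) :
    IsFiniteMeasure (volume.restrict Ω) :=
  ⟨by rw [Measure.restrict_apply_univ]; exact h.isBounded.measure_lt_top⟩

lemma ProblemData.isFiniteMeasure_cyl (h : ProblemData Ω T A₁ A₂ A₃) :
    IsFiniteMeasure (volume.restrict (cyl Ω T)) :=
  ⟨by
    rw [Measure.restrict_apply_univ]
    exact (h.isBounded.prod (Metric.isBounded_Ioo 0 T)).measure_lt_top⟩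

lemma ProblemData.integrable_lateral (h : ProblemData Ω T A₁ A₂ A₃) :
    Integrable A₃ (lateralMeasure Ω T) := by
  have := h.isFiniteMeasure_lateral
  exact h.memLp_lateral.integrable (by norm_num)

lemma ProblemData.integrable_initial (h : ProblemData Ω T A₁ A₂ A₃) : IntegrableOn A₁ Ω := by
  have := h.isFiniteMeasure_domain
  exact h.memLp_initial.integrable (by norm_num)

lemma ProblemData.integrable_terminal (h : ProblemData Ω T A₁ A₂ A₃) : IntegrableOn A₂ Ω := by
  have := h.isFiniteMeasure_domain
  exact h.memLp_terminal.integrable (by norm_num)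

lemma ProblemData.integrableOn_cyl (h : ProblemData Ω T A₁ A₂ A₃) {v : SpaceTime → ℝ}
    (hv : MemLp v 2 (volume.restrict (cyl Ω T))) : IntegrableOn v (cyl Ω T) := by
  have := h.isFiniteMeasure_cyl
  exact hv.integrable (by norm_num)

lemma jet_succ (u : SpaceTime → ℝ) (p : SpaceTime) (k : Fin 3) : jet u p k.succ = dx k u p := by
  fin_cases k <;> rfl

lemma fderiv_space_eq_sum {F : Type*} [NormedAddCommGroup F] [NormedSpace ℝ F]
    (L : SpaceTime →L[ℝ] F) (e : E3) :
    L (e, 0) = ∑ k, e k • L (EuclideanSpace.single k 1, 0) := by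
  have h1 : ∑ k, e k • (EuclideanSpace.single k (1 : ℝ) : E3) = e := by
    ext i
    simp [Pi.single_apply]
  have h2 : ((e, 0) : SpaceTime) =
      ∑ k, e k • ((EuclideanSpace.single k (1 : ℝ), 0) : SpaceTime) := by
    refine Prod.ext ?_ ?_
    · rw [Prod.fst_sum]
      exact h1.symm
    · rw [Prod.snd_sum]
      simp
  rw [h2, map_sum]
  exact Finset.sum_congr rfl fun k _ => map_smul _ _ _

lemma integrableOn_spaceDeriv (hZ : ∀ k, IntegrableOn (dx k g) (cyl Ω T)) (e : E3) :
    IntegrableOn (fun q => fderiv ℝ g q (e, 0)) (cyl Ω T) := by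
  simp_rw [fderiv_space_eq_sum _ e]
  exact integrable_finsetSum _ fun k _ => (hZ k).smul (e k)

/-- The test function is only assumed `C¹`, without decay, because the result is applied to plane
waves. -/
theorem weakIdentities_of_isSolution (h : ProblemData Ω T A₁ A₂ A₃) (hZ : StateData Ω T Z g)
    {f : (Fin 4 → ℝ) → SpaceTime → ℝ} {u : SpaceTime → ℝ} (hg : ∀ p ∈ cyl Ω T, g p = f (Z p) p)
    (hu : IsSolution Ω T f A₁ A₂ A₃ u) (huZ : ∀ p ∈ cyl Ω T, Z p = jet u p) {φ : SpaceTime → ℂ}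
    (hφ : ContDiff ℝ 1 φ) : WeakIdentities Ω T A₁ A₂ A₃ Z g φ := by
  have hm : MeasurableSet (cyl Ω T) := (cyl_isOpen h.isOpen T).measurableSet
  have e0 : ∀ p ∈ cyl Ω T, Z p 0 = u p := fun p hp => by rw [huZ p hp]; rfl
  have ek : ∀ k : Fin 3, ∀ p ∈ cyl Ω T, Z p k.succ = dx k u p := fun k p hp => by
    rw [huZ p hp, jet_succ]
  have et : ∀ p ∈ cyl Ω T, g p = dt u p := fun p hp => by
    rw [hg p hp, huZ p hp, hu.eqn p hp]
  have hu2 : MemLp u 2 (volume.restrict (cyl Ω T)) :=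
    (memLp_congr_ae ((ae_restrict_iff' hm).2 (ae_of_all _ e0))).1 (hZ.memLp 0)
  have hui := h.integrableOn_cyl hu2
  have hut : IntegrableOn (dt u) (cyl Ω T) :=
    (h.integrableOn_cyl hZ.memLp_time).congr_fun et hm
  have hux : ∀ k, IntegrableOn (dx k u) (cyl Ω T) := fun k =>
    (h.integrableOn_cyl (hZ.memLp k.succ)).congr_fun (ek k) hm
  refine ⟨?_, fun k => ?_⟩
  · refine Eq.trans ?_ (timeIdentity h.isOpen h.isBounded h.pos hu.contDiffOn hui hut hu.initial
      hu.terminal hφ)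
    refine setIntegral_congr_fun hm fun q hq => ?_
    simp only [timeDeriv, e0 q hq, et q hq]
  · have hG : GreenData Ω T u A₃ := ⟨h.isOpen, h.isBounded, h.isFiniteMeasure_surface,
      hu.contDiffOn, hui, integrableOn_spaceDeriv hux, h.integrable_lateral⟩
    have h1 := hG.greenIdentity h.boundary hu2 hu.lateral (EuclideanSpace.single k 1) hφ
    refine Eq.trans ?_ (h1.trans ?_)
    · refine setIntegral_congr_fun hm fun q hq => ?_
      simp only [flowDeriv, e0 q hq, ek k q hq, dx]
    · simp [EuclideanSpace.inner_single_right]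

/-- Both sides are linear in the direction. The weak identities give three directions, whereas the
lateral boundary condition concerns all of them. -/
theorem greenIdentity_of_basis (h : ProblemData Ω T A₁ A₂ A₃) {u : SpaceTime → ℝ}
    (hu : IntegrableOn u (cyl Ω T)) (hux : ∀ k, IntegrableOn (dx k u) (cyl Ω T))
    {φ : SpaceTime → ℂ} (hφ : ContDiff ℝ 1 φ)
    (hk : ∀ k : Fin 3, GreenIdentity Ω T u A₃ (EuclideanSpace.single k 1) φ) (e : E3) :
    GreenIdentity Ω T u A₃ e φ := by
  have := h.isFiniteMeasure_surface
  have h1 : ∀ q, flowDeriv u φ e q =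
      ∑ k, (e k : ℂ) * flowDeriv u φ (EuclideanSpace.single k 1) q := by
    intro q
    simp only [flowDeriv]
    rw [fderiv_space_eq_sum (fderiv ℝ u q) e, fderiv_space_eq_sum (fderiv ℝ φ q) e]
    push_cast
    simp only [Finset.sum_mul, Finset.mul_sum, mul_add, Finset.sum_add_distrib, smul_eq_mul,
      Complex.real_smul, Complex.ofReal_mul]
    congr 1 <;> refine Finset.sum_congr rfl fun k _ => ?_ <;> ring
  have h2 : ∀ q : SpaceTime, (A₃ q : ℂ) * (inner ℝ (outwardNormal Ω q.1) e : ℝ) * φ q =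
      ∑ k, (e k : ℂ) * ((A₃ q : ℂ) *
        (inner ℝ (outwardNormal Ω q.1) (EuclideanSpace.single k 1) : ℝ) * φ q) := by
    intro q
    have : (inner ℝ (outwardNormal Ω q.1) e : ℝ) = ∑ k, outwardNormal Ω q.1 k * e k := by
      simp [PiLp.inner_apply, mul_comm]
    rw [this]
    push_cast
    simp only [Finset.sum_mul, Finset.mul_sum]
    refine Finset.sum_congr rfl fun k _ => ?_
    simp [EuclideanSpace.inner_single_right]
    ring
  rw [GreenIdentity]
  simp_rw [h1, h2]
  rw [integral_finsetSum, integral_finsetSum]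
  · refine Finset.sum_congr rfl fun k _ => ?_
    rw [integral_const_mul, integral_const_mul, hk k]
  · exact fun k _ => (integrable_lateral_mul_test h.isOpen h.isBounded h.integrable_lateral _
      hφ.continuous).const_mul _
  · exact fun k _ => (integrableOn_flowDeriv h.isOpen h.isBounded hu (hux k) hφ).const_mul _

/-- The exceptional set is locally null: each of its points satisfies `e · n < 0`, so it is regular
and has an inflow patch for `e`, on which `tendsto_of_greenIdentity` applies. -/
theorem hasLateralValue_of_greenIdentity (h : ProblemData Ω T A₁ A₂ A₃) {u : SpaceTime → ℝ}
    (huc : ContDiffOn ℝ 1 u (cyl Ω T)) (hu : IntegrableOn u (cyl Ω T))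
    (hux : ∀ e : E3, IntegrableOn (fun q => fderiv ℝ u q (e, 0)) (cyl Ω T))
    (hG : ∀ η : SpaceTime → ℝ, ContDiff ℝ (⊤ : ℕ∞) η → HasCompactSupport η → ∀ e,
      GreenIdentity Ω T u A₃ e (fun q => (η q : ℂ))) : HasLateralValue Ω T u A₃ := by
  have := h.isFiniteMeasure_surface
  intro e
  rw [ae_iff]
  refine measure_null_of_locally_null _ fun q hq => ?_
  simp only [mem_ofPred_eq, Classical.not_imp] at hq
  have hn0 : outwardNormal Ω q.1 ≠ 0 := fun h0 => by simp [h0] at hq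
  obtain ⟨n, hn⟩ := exists_isOutwardNormal_of_ne_zero hn0
  have hne : inner ℝ n e < 0 := by
    rw [← hn.outwardNormal_eq, real_inner_comm]
    exact hq.1
  obtain ⟨R, R', hp⟩ := exists_isInflowPatch h.isOpen h.boundary.1 hn hne
  have h1 := hp.tendsto_of_greenIdentity h.isOpen h.isBounded huc hu (hux e)
    h.integrable_lateral (fun η hη hηs => hG η hη hηs e)
  have hB : MeasurableSet (Metric.ball q.1 (R' / 2) ×ˢ (univ : Set ℝ)) :=
    Metric.isOpen_ball.measurableSet.prod MeasurableSet.univ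
  rw [ae_restrict_iff' hB, ae_iff] at h1
  have hR : 0 < R' / 2 := half_pos hp.pos
  refine ⟨_, inter_mem_nhdsWithin _ (prod_mem_nhds (Metric.ball_mem_nhds q.1 hR) univ_mem),
    measure_mono_null ?_ h1⟩
  rintro x ⟨hx1, hx2⟩
  simp only [mem_ofPred_eq, Classical.not_imp] at hx1 ⊢
  exact ⟨hx2, hx1.2⟩

lemma fderiv_ofReal_apply {E : Type*} [NormedAddCommGroup E] [NormedSpace ℝ E] {η : E → ℝ} {q : E}
    (hη : DifferentiableAt ℝ η q) (w : E) :
    fderiv ℝ (fun p => (η p : ℂ)) q w = (fderiv ℝ η q w : ℝ) := by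
  have h1 : HasFDerivAt (fun p => (η p : ℂ)) (Complex.ofRealCLM.comp (fderiv ℝ η q)) q :=
    Complex.ofRealCLM.hasFDerivAt.comp q hη.hasFDerivAt
  rw [h1.fderiv]
  rfl

/-- The candidate for the derivative of `Z₀`. -/
def stateDeriv (Z : SpaceTime → Fin 4 → ℝ) (g : SpaceTime → ℝ) (p : SpaceTime) :
    SpaceTime →L[ℝ] ℝ :=
  (∑ k : Fin 3, Z p k.succ • (EuclideanSpace.proj k : E3 →L[ℝ] ℝ)).comp
    (ContinuousLinearMap.fst ℝ E3 ℝ) + g p • ContinuousLinearMap.snd ℝ E3 ℝ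

lemma stateDeriv_apply (p w : SpaceTime) :
    stateDeriv Z g p w = (∑ k : Fin 3, Z p k.succ * w.1 k) + g p * w.2 := by
  simp [stateDeriv]

lemma StateData.continuousOn_stateDeriv (hZ : StateData Ω T Z g) :
    ContinuousOn (stateDeriv Z g) (cyl Ω T) := by
  have h1 : ∀ k, ContinuousOn (fun p => Z p k) (cyl Ω T) := continuousOn_pi.1 hZ.continuousOn
  have h2 := hZ.continuousOn_time
  unfold stateDeriv
  refine ContinuousOn.add (ContinuousOn.clm_comp ?_ continuousOn_const)
    (h2.smul continuousOn_const)
  exact continuousOn_finsetSum _ fun k _ => (h1 k.succ).smul continuousOn_const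

/-- For test functions supported in the open cylinder all boundary terms vanish, and the identities
say that `stateDeriv` is the weak derivative of `Z₀`. It is continuous, hence the classical
derivative. -/
theorem hasFDerivAt_of_weakIdentities (h : ProblemData Ω T A₁ A₂ A₃) (hZ : StateData Ω T Z g)
    (hw : ∀ η : SpaceTime → ℝ, ContDiff ℝ (⊤ : ℕ∞) η → HasCompactSupport η →
      WeakIdentities Ω T A₁ A₂ A₃ Z g (fun q => (η q : ℂ))) {p : SpaceTime} (hp : p ∈ cyl Ω T) :
    HasFDerivAt (fun q => Z q 0) (stateDeriv Z g p) p := by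
  have := h.isFiniteMeasure_surface
  refine hasFDerivAt_of_weak (μ := volume) (cyl_isOpen h.isOpen T) (v := fun q => Z q 0)
    (v' := stateDeriv Z g)
    (continuousOn_pi.1 hZ.continuousOn 0) hZ.continuousOn_stateDeriv (fun η hη hηs hηt e => ?_) hp
  have hη1 : ContDiff ℝ 1 η := hη.of_le (by exact_mod_cast le_top)
  have hη1c : ContDiff ℝ 1 (fun q => (η q : ℂ)) := Complex.ofRealCLM.contDiff.comp hη1
  have hdη : ∀ w, Continuous fun q => fderiv ℝ (fun p => (η p : ℂ)) q w := fun w =>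
    (hη1c.continuous_fderiv (by simp)).clm_apply continuous_const
  have hη0 : ∀ q, q ∉ cyl Ω T → η q = 0 := fun q hq =>
    image_eq_zero_of_notMem_tsupport fun h => hq (hηt h)
  have hdη0 : ∀ q, q ∉ cyl Ω T → fderiv ℝ η q e = 0 := fun q hq => by
    rw [image_eq_zero_of_notMem_tsupport fun h => hq (hηt (tsupport_fderiv_subset ℝ h))]
    rfl
  have hW := hw η hη hηs
  have i0 : ∀ k, IntegrableOn (fun q => (Z q k : ℂ) * (η q : ℂ)) (cyl Ω T) := fun k =>
    integrableOn_mul_test h.isOpen h.isBounded (h.integrableOn_cyl (hZ.memLp k)) hη1c.continuous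
  have ig : IntegrableOn (fun q => (g q : ℂ) * (η q : ℂ)) (cyl Ω T) :=
    integrableOn_mul_test h.isOpen h.isBounded (h.integrableOn_cyl hZ.memLp_time) hη1c.continuous
  have i1 : ∀ w, IntegrableOn (fun q => (Z q 0 : ℂ) * fderiv ℝ (fun p => (η p : ℂ)) q w)
      (cyl Ω T) := fun w =>
    integrableOn_mul_test h.isOpen h.isBounded (h.integrableOn_cyl (hZ.memLp 0)) (hdη w)
  have htime : ∫ q in cyl Ω T, ((g q : ℂ) * (η q : ℂ) +
      Z q 0 * fderiv ℝ (fun p => (η p : ℂ)) q (0, 1)) = 0 := by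
    rw [hW.time]
    refine integral_eq_zero_of_ae (ae_of_all _ fun x => ?_)
    simp [hη0 (x, T) (fun h => lt_irrefl _ h.2.2), hη0 (x, 0) (fun h => lt_irrefl _ h.2.1)]
  have hlat : ∀ k : Fin 3, ∫ q in cyl Ω T, ((Z q k.succ : ℂ) * (η q : ℂ) +
      Z q 0 * fderiv ℝ (fun p => (η p : ℂ)) q (EuclideanSpace.single k 1, 0)) = 0 := by
    intro k
    rw [hW.lateral k]
    refine integral_eq_zero_of_ae ?_
    filter_upwards [ae_lateral_mem Ω T] with q hq
    have : q ∉ cyl Ω T := fun hc => by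
      have := hq.1
      rw [h.isOpen.frontier_eq] at this
      exact this.2 hc.1
    simp [hη0 q this]
  -- The weak identity in direction `e` is the combination of the three spatial identities and the
  -- time identity with the coordinates of `e` as coefficients.
  have hsum : ∀ q, (Z q 0 : ℂ) * ((fderiv ℝ η q e : ℝ) : ℂ) + ((stateDeriv Z g q e : ℝ) : ℂ) * η q =
      (∑ k : Fin 3, (e.1 k : ℂ) * ((Z q k.succ : ℂ) * (η q : ℂ) +
        Z q 0 * fderiv ℝ (fun p => (η p : ℂ)) q (EuclideanSpace.single k 1, 0))) +
      (e.2 : ℂ) * ((g q : ℂ) * (η q : ℂ) +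
        Z q 0 * fderiv ℝ (fun p => (η p : ℂ)) q (0, 1)) := by
    intro q
    have hd := hη1.differentiable (by simp) q
    simp only [fderiv_ofReal_apply hd]
    have h1 : fderiv ℝ η q e =
        (∑ k, e.1 k * fderiv ℝ η q (EuclideanSpace.single k 1, 0)) + e.2 * fderiv ℝ η q (0, 1) := by
      have : e = (e.1, 0) + e.2 • ((0, 1) : SpaceTime) := by ext <;> simp
      conv_lhs => rw [this, map_add, fderiv_space_eq_sum, map_smul]
      simp only [smul_eq_mul]
    rw [h1, stateDeriv_apply]
    push_cast
    simp only [mul_add, add_mul, Finset.sum_add_distrib, Finset.mul_sum, Finset.sum_mul]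
    have : ∀ a b c d a' b' c' d' : ℂ, b = a' → d = d' → a = c' → c = b' →
        a + d + (b + c) = a' + c' + (b' + d') := by
      rintro _ _ _ _ _ _ _ _ rfl rfl rfl rfl; ring
    refine this _ _ _ _ _ _ _ _ ?_ ?_ ?_ ?_
    · exact Finset.sum_congr rfl fun k _ => by ring
    · ring
    · exact Finset.sum_congr rfl fun k _ => by ring
    · ring
  have iA : IntegrableOn (fun q => (Z q 0 : ℂ) * ((fderiv ℝ η q e : ℝ) : ℂ)) (cyl Ω T) := by
    refine (i1 e).congr (ae_of_all _ fun q => ?_)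
    simp only [fderiv_ofReal_apply (hη1.differentiable (by simp) q)]
  have iB : IntegrableOn (fun q => ((stateDeriv Z g q e : ℝ) : ℂ) * η q) (cyl Ω T) := by
    have : IntegrableOn (fun q => (∑ k : Fin 3, (e.1 k : ℂ) * ((Z q k.succ : ℂ) * (η q : ℂ))) +
        (e.2 : ℂ) * ((g q : ℂ) * (η q : ℂ))) (cyl Ω T) :=
      (integrable_finsetSum _ fun k _ => (i0 k.succ).const_mul _).add (ig.const_mul _)
    refine this.congr (ae_of_all _ fun q => ?_)
    simp only [stateDeriv_apply]
    push_cast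
    rw [add_mul, Finset.sum_mul]
    congr 1
    · exact Finset.sum_congr rfl fun k _ => by ring
    · ring
  have htot : (∫ q in cyl Ω T, (Z q 0 : ℂ) * ((fderiv ℝ η q e : ℝ) : ℂ)) +
      ∫ q in cyl Ω T, ((stateDeriv Z g q e : ℝ) : ℂ) * η q = 0 := by
    rw [← integral_add iA iB]
    simp_rw [hsum]
    rw [integral_add, integral_finsetSum]
    · simp_rw [integral_const_mul, hlat, htime]
      simp
    · exact fun k _ => ((i0 k.succ).add (i1 _)).const_mul _
    · exact integrable_finsetSum _ fun k _ => ((i0 k.succ).add (i1 _)).const_mul _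
    · exact (ig.add (i1 _)).const_mul _
  rw [eq_neg_iff_add_eq_zero, ← setIntegral_eq_integral_of_forall_compl_eq_zero (s := cyl Ω T)
    (f := fun q => Z q 0 * fderiv ℝ η q e) (fun q hq => by simp [hdη0 q hq]),
    ← setIntegral_eq_integral_of_forall_compl_eq_zero (s := cyl Ω T)
    (f := fun q => stateDeriv Z g q e * η q) (fun q hq => by simp [hη0 q hq])]
  rw [← Complex.ofReal_inj]
  push_cast
  rw [← integral_complex_ofReal, ← integral_complex_ofReal]
  push_cast
  exact htot

/-- Interior test functions give regularity and the equation. Once `Z₀` is `C¹`, the same identities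
with test functions not vanishing on the boundary become the time identity and Green's identity,
which determine the boundary limits. -/
theorem isSolution_of_weakIdentities (h : ProblemData Ω T A₁ A₂ A₃) (hZ : StateData Ω T Z g)
    {f : (Fin 4 → ℝ) → SpaceTime → ℝ} (hg : ∀ p ∈ cyl Ω T, g p = f (Z p) p)
    (hw : ∀ η : SpaceTime → ℝ, ContDiff ℝ (⊤ : ℕ∞) η → HasCompactSupport η →
      WeakIdentities Ω T A₁ A₂ A₃ Z g (fun q => (η q : ℂ))) :
    IsSolution Ω T f A₁ A₂ A₃ (fun p => Z p 0) ∧ ∀ p ∈ cyl Ω T, Z p = jet (fun p => Z p 0) p := by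
  have hm : MeasurableSet (cyl Ω T) := (cyl_isOpen h.isOpen T).measurableSet
  have hd : ∀ p ∈ cyl Ω T, HasFDerivAt (fun q => Z q 0) (stateDeriv Z g p) p := fun p hp =>
    hasFDerivAt_of_weakIdentities h hZ hw hp
  have hx : ∀ k, ∀ p ∈ cyl Ω T, dx k (fun q => Z q 0) p = Z p k.succ := by
    intro k p hp
    rw [dx, (hd p hp).fderiv, stateDeriv_apply]
    simp [PiLp.single_apply]
  have ht : ∀ p ∈ cyl Ω T, dt (fun q => Z q 0) p = g p := by
    intro p hp
    rw [dt, (hd p hp).fderiv, stateDeriv_apply]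
    simp
  have hjet : ∀ p ∈ cyl Ω T, Z p = jet (fun p => Z p 0) p := by
    intro p hp
    funext k
    refine Fin.cases rfl (fun k => ?_) k
    rw [jet_succ, hx k p hp]
  have hc : ContDiffOn ℝ 1 (fun q => Z q 0) (cyl Ω T) :=
    contDiffOn_one_of_hasFDerivAt (cyl_isOpen h.isOpen T) hZ.continuousOn_stateDeriv hd
  have hu : IntegrableOn (fun q => Z q 0) (cyl Ω T) := h.integrableOn_cyl (hZ.memLp 0)
  have hut : IntegrableOn (dt fun q => Z q 0) (cyl Ω T) :=
    (h.integrableOn_cyl hZ.memLp_time).congr_fun (fun p hp => (ht p hp).symm) hm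
  have hux : ∀ k, IntegrableOn (dx k fun q => Z q 0) (cyl Ω T) := fun k =>
    (h.integrableOn_cyl (hZ.memLp k.succ)).congr_fun (fun p hp => (hx k p hp).symm) hm
  have hit := initial_terminal_of_timeIdentity h.isOpen h.isBounded h.pos hc hu hut
    h.integrable_initial h.integrable_terminal fun η hη hηs => by
      refine Eq.trans ?_ (hw η hη hηs).time
      refine setIntegral_congr_fun hm fun q hq => ?_
      simp only [timeDeriv, ht q hq]
  refine ⟨⟨hc, fun p hp => ?_, hit.1, hit.2, ?_⟩, hjet⟩
  · rw [ht p hp, hg p hp, ← hjet p hp]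
  · refine hasLateralValue_of_greenIdentity h hc hu (integrableOn_spaceDeriv hux)
      fun η hη hηs e => ?_
    have hη1c : ContDiff ℝ 1 (fun q => (η q : ℂ)) :=
      Complex.ofRealCLM.contDiff.comp (hη.of_le (by exact_mod_cast le_top))
    refine greenIdentity_of_basis h hu hux hη1c (fun k => ?_) e
    refine Eq.trans ?_ (((hw η hη hηs).lateral k).trans ?_)
    · refine setIntegral_congr_fun hm fun q hq => ?_
      simp only [flowDeriv, ← hx k q hq, dx]
    · simp [EuclideanSpace.inner_single_right]

end

/-! ### Plane waves and the inverse Fourier transform of Schwartz functions -/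

lemma phase_add (p q ξ : SpaceTime) : phase (p + q) ξ = phase p ξ + phase q ξ := by
  simp [phase, add_mul, Finset.sum_add_distrib]
  ring

lemma phase_smul_right (c : ℝ) (p ξ : SpaceTime) : phase p (c • ξ) = c * phase p ξ := by
  simp only [phase, Prod.smul_fst, Prod.smul_snd, PiLp.smul_apply, smul_eq_mul, mul_add,
    Finset.mul_sum]
  congr 1
  · exact Finset.sum_congr rfl fun k _ => by ring
  · ring

lemma phase_comm (p ξ : SpaceTime) : phase p ξ = phase ξ p := by
  simp [phase, mul_comm]

@[fun_prop]
lemma continuous_phase : Continuous fun q : SpaceTime × SpaceTime => phase q.1 q.2 := by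
  unfold phase
  fun_prop

/-- `phase · ξ` as a continuous linear map. -/
def phaseCLM (ξ : SpaceTime) : SpaceTime →L[ℝ] ℝ :=
  LinearMap.toContinuousLinearMap
    { toFun := fun p => phase p ξ
      map_add' := fun p q => phase_add p q ξ
      map_smul' := fun c p => by
        rw [phase_comm, phase_smul_right, phase_comm]
        rfl }

@[simp] lemma phaseCLM_apply (ξ p : SpaceTime) : phaseCLM ξ p = phase p ξ := rfl

/-- The plane wave `e^{-i p·ξ}`. -/
def planeWave (ξ p : SpaceTime) : ℂ := Complex.exp (-(Complex.I * (phase p ξ : ℂ)))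

lemma continuous_planeWave : Continuous fun q : SpaceTime × SpaceTime => planeWave q.1 q.2 := by
  unfold planeWave
  have : Continuous fun q : SpaceTime × SpaceTime => phase q.2 q.1 :=
    continuous_phase.comp continuous_swap
  fun_prop

lemma norm_planeWave (ξ p : SpaceTime) : ‖planeWave ξ p‖ = 1 := by
  rw [planeWave, Complex.norm_exp]
  simp

lemma contDiff_planeWave (ξ : SpaceTime) : ContDiff ℝ 1 (planeWave ξ) := by
  unfold planeWave
  have : ContDiff ℝ 1 fun p => ((phase p ξ : ℝ) : ℂ) :=
    (Complex.ofRealCLM.comp (phaseCLM ξ)).contDiff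
  exact Complex.contDiff_exp.comp (contDiff_const.mul this).neg

lemma hasFDerivAt_exp_phase (c : ℂ) (ξ p : SpaceTime) :
    HasFDerivAt (fun p => Complex.exp (c * (phase p ξ : ℂ)))
      (Complex.exp (c * (phase p ξ : ℂ)) • (c • Complex.ofRealCLM.comp (phaseCLM ξ))) p := by
  have : HasFDerivAt (fun p => ((phase p ξ : ℝ) : ℂ)) (Complex.ofRealCLM.comp (phaseCLM ξ)) p :=
    (Complex.ofRealCLM.comp (phaseCLM ξ)).hasFDerivAt
  exact (this.const_mul c).cexp

lemma fderiv_planeWave (ξ p w : SpaceTime) :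
    fderiv ℝ (planeWave ξ) p w = -(Complex.I * phase w ξ) * planeWave ξ p := by
  have h : planeWave ξ = fun p => Complex.exp (-Complex.I * (phase p ξ : ℂ)) := by
    funext p
    rw [planeWave, neg_mul]
  rw [h, (hasFDerivAt_exp_phase _ ξ p).fderiv]
  simp
  ring

section

open scoped FourierTransform LineDeriv

/-- Space-time with the Euclidean norm. -/
abbrev EuclideanSpaceTime : Type := WithLp 2 (E3 × ℝ)

/-- The identification of Euclidean space-time with space-time. -/
def ofEuclidean : EuclideanSpaceTime ≃L[ℝ] SpaceTime := WithLp.prodContinuousLinearEquiv 2 ℝ E3 ℝ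

/-- The product `E3 × ℝ` carries the sup norm, while the Fourier transform of Schwartz functions is
taken on an inner product space, with kernel `e^{2πi⟨v,w⟩}`. This identity and the scaling by `2π`
translate between the two conventions. -/
lemma inner_ofEuclidean (v w : EuclideanSpaceTime) :
    inner ℝ v w = phase (ofEuclidean v) (ofEuclidean w) := by
  rw [WithLp.prod_inner_apply]
  simp [phase, PiLp.inner_apply, ofEuclidean, mul_comm]

lemma integral_ofEuclidean (G : SpaceTime → ℂ) :
    ∫ v : EuclideanSpaceTime, G (ofEuclidean v) = ∫ p, G p :=
  (WithLp.volume_preserving_ofLp E3 ℝ).integral_comp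
    (ofEuclidean.toHomeomorph.measurableEmbedding) G

lemma two_pi_ne_zero : (2 * Real.pi) ≠ 0 := by positivity

/-- The scaling `ξ ↦ ξ / 2π`. -/
def freqScale : SpaceTime ≃L[ℝ] EuclideanSpaceTime :=
  (ContinuousLinearEquiv.smulLeft (R₁ := ℝ) (M₁ := SpaceTime)
    (Units.mk0 (2 * Real.pi) two_pi_ne_zero)⁻¹).trans ofEuclidean.symm

lemma ofEuclidean_freqScale (ξ : SpaceTime) :
    ofEuclidean (freqScale ξ) = (2 * Real.pi)⁻¹ • ξ := by
  simp only [freqScale, ContinuousLinearEquiv.trans_apply, ContinuousLinearEquiv.apply_symm_apply]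
  rfl

/-- The inverse Fourier transform as a continuous linear map on Schwartz space. -/
def invFourierCLM : 𝓢(SpaceTime, ℂ) →L[ℂ] 𝓢(SpaceTime, ℂ) :=
  (((2 * Real.pi : ℝ) : ℂ)⁻¹ ^ 4) • (SchwartzMap.compCLMOfContinuousLinearEquiv ℂ freqScale ∘L
    FourierTransform.fourierInvCLM ℂ 𝓢(EuclideanSpaceTime, ℂ) ∘L
    SchwartzMap.compCLMOfContinuousLinearEquiv ℂ ofEuclidean)

lemma invFourierCLM_apply' (φ : 𝓢(SpaceTime, ℂ)) (ξ : SpaceTime) :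
    invFourierCLM φ ξ = ((2 * Real.pi : ℝ) : ℂ)⁻¹ ^ 4 *
      (𝓕⁻ (SchwartzMap.compCLMOfContinuousLinearEquiv ℂ ofEuclidean φ)) (freqScale ξ) := rfl

lemma invFourierCLM_apply (φ : 𝓢(SpaceTime, ℂ)) (ξ : SpaceTime) :
    invFourierCLM φ ξ = invFourierSchwartz φ ξ := by
  rw [invFourierCLM_apply', invFourierSchwartz, SchwartzMap.fourierInv_coe, Real.fourierInv_eq',
    ← integral_ofEuclidean]
  congr 1
  refine integral_congr_ae (ae_of_all _ fun v => ?_)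
  simp only [inner_ofEuclidean, ofEuclidean_freqScale, phase_smul_right, smul_eq_mul,
    SchwartzMap.compCLMOfContinuousLinearEquiv_apply, Function.comp_apply]
  rw [mul_inv_cancel_left₀ two_pi_ne_zero]
  ring_nf

lemma finrank_spaceTime : Module.finrank ℝ SpaceTime = 4 := by simp

/-- Fourier inversion. -/
theorem eq_integral_planeWave (φ : 𝓢(SpaceTime, ℂ)) (p : SpaceTime) :
    φ p = ∫ ξ, invFourierCLM φ ξ * planeWave ξ p := by
  set Φ := SchwartzMap.compCLMOfContinuousLinearEquiv ℂ ofEuclidean φ with hΦ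
  set G : 𝓢(EuclideanSpaceTime, ℂ) := 𝓕⁻ Φ with hG
  have h1 : φ p = (𝓕 G) (ofEuclidean.symm p) := by
    rw [hG, FourierTransform.fourier_fourierInv_eq, hΦ,
      SchwartzMap.compCLMOfContinuousLinearEquiv_apply, Function.comp_apply,
      ContinuousLinearEquiv.apply_symm_apply]
  rw [h1, SchwartzMap.fourier_coe, Real.fourier_eq']
  have h2 : ∀ v : EuclideanSpaceTime,
      Complex.exp (((-2 * Real.pi * inner ℝ v (ofEuclidean.symm p) : ℝ) : ℂ) * Complex.I) •
        G v = (fun q => planeWave ((2 * Real.pi) • q) p * G (ofEuclidean.symm q))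
          (ofEuclidean v) := by
    intro v
    simp only [ContinuousLinearEquiv.symm_apply_apply, inner_ofEuclidean,
      ContinuousLinearEquiv.apply_symm_apply, planeWave, phase_smul_right, smul_eq_mul]
    rw [phase_comm p]
    congr 2
    push_cast
    ring
  simp only [h2]
  rw [integral_ofEuclidean fun q =>
    planeWave ((2 * Real.pi) • q) p * G (ofEuclidean.symm q)]
  -- The substitution `q = ξ / 2π` has the Jacobian `(2π)⁴` in dimension four, which cancels the
  -- normalizing constant of `F⁻¹`.
  have h3 := Measure.integral_comp_inv_smul (volume : Measure SpaceTime)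
    (fun q => planeWave ((2 * Real.pi) • q) p * G (ofEuclidean.symm q)) (2 * Real.pi)
  rw [finrank_spaceTime, abs_of_pos (by positivity)] at h3
  have h4 : ∀ ξ : SpaceTime, invFourierCLM φ ξ * planeWave ξ p =
      (((2 * Real.pi : ℝ) : ℂ)⁻¹ ^ 4) *
      (planeWave ((2 * Real.pi) • (2 * Real.pi)⁻¹ • ξ) p *
        G (ofEuclidean.symm ((2 * Real.pi)⁻¹ • ξ))) := by
    intro ξ
    rw [smul_inv_smul₀ two_pi_ne_zero, invFourierCLM_apply', ← hΦ, ← hG, ← ofEuclidean_freqScale,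
      ContinuousLinearEquiv.symm_apply_apply]
    ring
  simp_rw [h4]
  rw [integral_const_mul, h3, Complex.real_smul]
  rw [← mul_assoc]
  have : (((2 * Real.pi : ℝ) : ℂ)⁻¹ ^ 4) * (((2 * Real.pi) ^ 4 : ℝ) : ℂ) = 1 := by
    rw [Complex.ofReal_pow, ← mul_pow, inv_mul_cancel₀, one_pow]
    exact Complex.ofReal_ne_zero.2 two_pi_ne_zero
  rw [this, one_mul]

theorem invFourierCLM_surjective : Function.Surjective invFourierCLM := by
  intro θ
  refine ⟨SchwartzMap.compCLMOfContinuousLinearEquiv ℂ ofEuclidean.symm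
    (𝓕 (SchwartzMap.compCLMOfContinuousLinearEquiv ℂ freqScale.symm
      ((((2 * Real.pi : ℝ) : ℂ) ^ 4) • θ))), ?_⟩
  ext ξ
  rw [invFourierCLM_apply']
  have h1 : ∀ Ψ : 𝓢(EuclideanSpaceTime, ℂ), SchwartzMap.compCLMOfContinuousLinearEquiv ℂ ofEuclidean
      (SchwartzMap.compCLMOfContinuousLinearEquiv ℂ ofEuclidean.symm Ψ) = Ψ := by
    intro Ψ
    ext v
    simp
  rw [h1, FourierTransform.fourierInv_fourier_eq]
  simp only [SchwartzMap.compCLMOfContinuousLinearEquiv_apply, Function.comp_apply,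
    ContinuousLinearEquiv.symm_apply_apply, smul_apply, smul_eq_mul]
  rw [← mul_assoc, ← mul_pow, inv_mul_cancel₀, one_pow, one_mul]
  exact Complex.ofReal_ne_zero.2 two_pi_ne_zero

/-- Translation becomes multiplication by a plane wave; this is what turns the convolution with `w₂`
into a product. -/
lemma invFourierCLM_compSubConst (φ : 𝓢(SpaceTime, ℂ)) (p ξ : SpaceTime) :
    invFourierCLM (SchwartzMap.compSubConstCLM ℂ (-p) φ) ξ =
      invFourierCLM φ ξ * planeWave ξ p := by
  rw [invFourierCLM_apply, invFourierCLM_apply, invFourierSchwartz, invFourierSchwartz, mul_assoc,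
    ← integral_mul_const]
  congr 1
  rw [← integral_add_right_eq_self (μ := volume) (fun q => φ q *
    Complex.exp (Complex.I * (phase q ξ : ℂ)) * planeWave ξ p) p]
  refine integral_congr_ae (ae_of_all _ fun q => ?_)
  simp only [SchwartzMap.compSubConstCLM_apply, sub_neg_eq_add, planeWave, mul_assoc,
    ← Complex.exp_add, phase_add]
  congr 2
  push_cast
  ring

lemma invFourierCLM_lineDeriv (φ : 𝓢(SpaceTime, ℂ)) (w ξ : SpaceTime) :
    invFourierCLM (∂_{w} φ) ξ = -(Complex.I * phase w ξ) * invFourierCLM φ ξ := by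
  rw [invFourierCLM_apply, invFourierCLM_apply, invFourierSchwartz, invFourierSchwartz,
    mul_left_comm]
  congr 1
  rw [← integral_const_mul]
  have hb : ∀ ψ : 𝓢(SpaceTime, ℂ),
      Integrable (fun p => Complex.exp (Complex.I * (phase p ξ : ℂ)) * ψ p) := by
    intro ψ
    refine ψ.integrable.bdd_mul (c := 1) ?_ (ae_of_all _ fun p => ?_)
    · have : Continuous fun p => phase p ξ := (phaseCLM ξ).continuous
      exact Continuous.aestronglyMeasurable (by fun_prop)
    · rw [Complex.norm_exp]
      simp
  have hd : ∀ p, fderiv ℝ (fun p => Complex.exp (Complex.I * (phase p ξ : ℂ))) p w =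
      (Complex.I * phase w ξ) * Complex.exp (Complex.I * (phase p ξ : ℂ)) := by
    intro p
    rw [(hasFDerivAt_exp_phase _ ξ p).fderiv]
    simp
    ring
  have h1 := integral_mul_fderiv_eq_neg_fderiv_mul_of_integrable (μ := volume) (v := w)
    (f := fun p => Complex.exp (Complex.I * (phase p ξ : ℂ))) (g := φ) ?_ ?_ (hb φ)
    (fun p _ => (hasFDerivAt_exp_phase _ ξ p).differentiableAt) (fun p _ => φ.differentiableAt)
  · rw [← integral_neg] at h1
    refine Eq.trans ?_ (h1.trans ?_)
    · refine integral_congr_ae (ae_of_all _ fun p => ?_)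
      simp only [SchwartzMap.lineDerivOp_apply_eq_fderiv]
      ring
    · refine integral_congr_ae (ae_of_all _ fun p => ?_)
      simp only [hd]
      ring
  · simp_rw [hd, mul_assoc]
    exact ((hb φ).const_mul _).const_mul _ |>.congr (ae_of_all _ fun p => by rfl)
  · refine (hb (∂_{w} φ)).congr (ae_of_all _ fun p => ?_)
    simp only [SchwartzMap.lineDerivOp_apply_eq_fderiv]

/-! ### Inverse Fourier transforms of functions -/

/-- A bounded function is a tempered distribution, and `F⁻¹` acts on it by duality. -/
theorem exists_hasInvFourier_of_bounded {h : SpaceTime → ℂ} (hh : AEStronglyMeasurable h)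
    {C : ℝ} (hC : ∀ ξ, ‖h ξ‖ ≤ C) : ∃ W, HasInvFourier h W := by
  have hm : MemLp h ∞ := memLp_top_of_bound hh C (ae_of_all _ hC)
  refine ⟨PointwiseConvergenceCLM.precomp ℂ invFourierCLM (Lp.toTemperedDistribution (hm.toLp h)),
    fun φ => ⟨?_, ?_⟩⟩
  · simp_rw [← invFourierCLM_apply]
    exact (invFourierCLM φ).integrable.bdd_mul hh (ae_of_all _ hC)
  · change Lp.toTemperedDistribution (hm.toLp h) (invFourierCLM φ) = _
    rw [Lp.toTemperedDistribution_apply]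
    refine integral_congr_ae ?_
    filter_upwards [hm.coeFn_toLp] with ξ hξ
    rw [hξ, invFourierCLM_apply, smul_eq_mul, mul_comm]

lemma HasInvFourier.add {h₁ h₂ : SpaceTime → ℂ} {W₁ W₂ : 𝓢'(SpaceTime, ℂ)}
    (H₁ : HasInvFourier h₁ W₁) (H₂ : HasInvFourier h₂ W₂) :
    HasInvFourier (fun ξ => h₁ ξ + h₂ ξ) (W₁ + W₂) := by
  intro φ
  simp only [add_mul]
  refine ⟨(H₁ φ).1.add (H₂ φ).1, ?_⟩
  rw [integral_add (H₁ φ).1 (H₂ φ).1, ← (H₁ φ).2, ← (H₂ φ).2]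
  rfl

/-- Multiplication by a linear phase is differentiation of the distribution. This handles the
symbols that carry an extra factor `iξ_k`. -/
lemma HasInvFourier.phase_mul {h : SpaceTime → ℂ} {W : 𝓢'(SpaceTime, ℂ)}
    (H : HasInvFourier h W) (w : SpaceTime) :
    HasInvFourier (fun ξ => Complex.I * phase w ξ * h ξ) (∂_{w} W) := by
  intro φ
  have h1 := H (-∂_{w} φ)
  have h2 : ∀ ξ, h ξ * invFourierSchwartz (-∂_{w} φ) ξ =
      Complex.I * phase w ξ * h ξ * invFourierSchwartz φ ξ := by
    intro ξ
    rw [← invFourierCLM_apply, ← invFourierCLM_apply, map_neg, neg_apply,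
      invFourierCLM_lineDeriv]
    ring
  simp only [h2] at h1
  exact h1

/-- A continuous function that annihilates all Schwartz functions vanishes. -/
theorem eq_zero_of_integral_mul_schwartz {h : SpaceTime → ℂ} (hh : Continuous h)
    (h0 : ∀ φ : 𝓢(SpaceTime, ℂ), ∫ ξ, h ξ * invFourierCLM φ ξ = 0) : h = 0 := by
  refine (Continuous.ae_eq_iff_eq volume hh continuous_const).1 ?_
  refine ae_eq_zero_of_integral_contDiff_smul_eq_zero hh.locallyIntegrable fun η hη hηs => ?_
  have hs : HasCompactSupport fun q => (η q : ℂ) := hηs.comp_left Complex.ofReal_zero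
  obtain ⟨φ, hφ⟩ := invFourierCLM_surjective
    (hs.toSchwartzMap (Complex.ofRealCLM.contDiff.comp hη))
  rw [← h0 φ]
  refine integral_congr_ae (ae_of_all _ fun ξ => ?_)
  simp only [hφ]
  rw [Complex.real_smul, mul_comm]
  rfl

end

/-! ### Fourier transforms of integrable functions -/

lemma continuous_planeWave_left (p : SpaceTime) : Continuous fun ξ => planeWave ξ p := by
  have h : Continuous fun ξ => phase p ξ := by
    simp_rw [phase_comm p]
    exact (phaseCLM p).continuous
  unfold planeWave
  fun_prop

section

variable {α : Type*} [MeasurableSpace α] {μ : Measure α} {π : α → SpaceTime} {G : α → ℂ}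

lemma measurable_planeWave (hπ : Measurable π) (ξ : SpaceTime) :
    Measurable fun x => planeWave ξ (π x) :=
  (contDiff_planeWave ξ).continuous.measurable.comp hπ

lemma integrable_mul_planeWave (hπ : Measurable π) (hG : Integrable G μ) (ξ : SpaceTime) :
    Integrable (fun x => G x * planeWave ξ (π x)) μ :=
  hG.mul_bdd (c := 1) (measurable_planeWave hπ ξ).aestronglyMeasurable
    (ae_of_all _ fun x => (norm_planeWave ξ (π x)).le)

lemma continuous_integral_planeWave (hπ : Measurable π) (hG : Integrable G μ) :
    Continuous fun ξ => ∫ x, G x * planeWave ξ (π x) ∂μ := by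
  refine continuous_of_dominated (bound := fun x => ‖G x‖)
    (fun ξ => (integrable_mul_planeWave hπ hG ξ).aestronglyMeasurable)
    (fun ξ => ae_of_all _ fun x => ?_) hG.norm (ae_of_all _ fun x => ?_)
  · rw [norm_mul, norm_planeWave, mul_one]
  · exact (continuous_planeWave_left (π x)).const_mul (G x)

lemma norm_integral_planeWave_le (ξ : SpaceTime) :
    ‖∫ x, G x * planeWave ξ (π x) ∂μ‖ ≤ ∫ x, ‖G x‖ ∂μ := by
  refine (norm_integral_le_integral_norm _).trans_eq (integral_congr_ae (ae_of_all _ fun x => ?_))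
  simp only [norm_mul, norm_planeWave, mul_one]

lemma integrable_mul_integral_planeWave (hπ : Measurable π) (hG : Integrable G μ)
    {H : SpaceTime → ℂ} (hH : Integrable H) :
    Integrable fun ξ => H ξ * ∫ x, G x * planeWave ξ (π x) ∂μ :=
  hH.mul_bdd (continuous_integral_planeWave hπ hG).aestronglyMeasurable
    (ae_of_all _ norm_integral_planeWave_le)

/-- Fubini's theorem, stated over an arbitrary measure space mapped into space-time so that it
serves the cylinder, the two time slices and the lateral boundary alike. -/
lemma integral_mul_integral_planeWave [SFinite μ] (hπ : Measurable π) (hG : Integrable G μ)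
    {H : SpaceTime → ℂ} (hH : Integrable H) :
    ∫ x, G x * (∫ ξ, H ξ * planeWave ξ (π x)) ∂μ =
      ∫ ξ, H ξ * ∫ x, G x * planeWave ξ (π x) ∂μ := by
  have hi : Integrable (fun q : α × SpaceTime => G q.1 * H q.2 * planeWave q.2 (π q.1))
      (μ.prod volume) := by
    refine (hG.mul_prod hH).mul_bdd (c := 1) ?_ (ae_of_all _ fun q => (norm_planeWave _ _).le)
    exact (continuous_planeWave.measurable.comp
      (measurable_snd.prodMk (hπ.comp measurable_fst))).aestronglyMeasurable
  have h1 := integral_integral_swap (f := fun x ξ => G x * H ξ * planeWave ξ (π x)) hi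
  simp_rw [← integral_const_mul]
  refine Eq.trans ?_ (h1.trans ?_)
  · simp only [mul_assoc]
  · simp only [mul_left_comm, mul_assoc]

end

/-- The Fourier transform of `v I_{Ω × (0, T)}`. -/
def cylFourier (Ω : Set E3) (T : ℝ) (v : SpaceTime → ℝ) (ξ : SpaceTime) : ℂ :=
  ∫ p in cyl Ω T, (v p : ℂ) * planeWave ξ p

section

variable {Ω : Set E3} {T : ℝ} {A₁ A₂ : E3 → ℝ} {A₃ : SpaceTime → ℝ}
  {Z : SpaceTime → Fin 4 → ℝ} {g v : SpaceTime → ℝ}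

lemma continuous_cylFourier (hv : IntegrableOn v (cyl Ω T)) : Continuous (cylFourier Ω T v) :=
  continuous_integral_planeWave measurable_id hv.ofReal

lemma integrable_mul_cylFourier (hv : IntegrableOn v (cyl Ω T)) {H : SpaceTime → ℂ}
    (hH : Integrable H) : Integrable fun ξ => H ξ * cylFourier Ω T v ξ :=
  integrable_mul_integral_planeWave measurable_id hv.ofReal hH

lemma indicatorPairing_eq (hv : IntegrableOn v (cyl Ω T)) (φ : 𝓢(SpaceTime, ℂ)) :
    indicatorPairing (cyl Ω T) v φ = ∫ ξ, invFourierCLM φ ξ * cylFourier Ω T v ξ := by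
  refine Eq.trans ?_ (integral_mul_integral_planeWave (μ := volume.restrict (cyl Ω T))
    measurable_id hv.ofReal (invFourierCLM φ).integrable)
  simp only [id, ← eq_integral_planeWave]
  rfl

/-- Each translate of `φ` contributes a plane wave factor under `F⁻¹`; integrating over the cylinder
first yields the transform of `v`. -/
lemma convPairing_eq {h : SpaceTime → ℂ} {W : 𝓢'(SpaceTime, ℂ)} (H : HasInvFourier h W)
    (hv : IntegrableOn v (cyl Ω T)) (φ : 𝓢(SpaceTime, ℂ)) :
    convPairing W (cyl Ω T) v φ = ∫ ξ, h ξ * invFourierCLM φ ξ * cylFourier Ω T v ξ := by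
  have hi := (H φ).1
  simp_rw [← invFourierCLM_apply] at hi
  refine Eq.trans ?_ (integral_mul_integral_planeWave (μ := volume.restrict (cyl Ω T))
    measurable_id hv.ofReal hi)
  refine integral_congr_ae (ae_of_all _ fun p => ?_)
  simp only [id, (H _).2, ← invFourierCLM_apply, invFourierCLM_compSubConst, mul_assoc]
  rfl

/-- The Fourier transformed system. -/
structure FourierIdentities (Ω : Set E3) (T : ℝ) (A₁ A₂ : E3 → ℝ) (A₃ : SpaceTime → ℝ)
    (Z : SpaceTime → Fin 4 → ℝ) (g : SpaceTime → ℝ) (ξ : SpaceTime) : Prop where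
  time : cylFourier Ω T g ξ - Complex.I * ξ.2 * cylFourier Ω T (fun p => Z p 0) ξ =
    dataTime Ω T A₁ A₂ ξ
  lateral (k : Fin 3) : cylFourier Ω T (fun p => Z p k.succ) ξ -
    Complex.I * ξ.1 k * cylFourier Ω T (fun p => Z p 0) ξ = dataLateral Ω T A₃ k ξ

lemma phase_time (ξ : SpaceTime) : phase (0, 1) ξ = ξ.2 := by simp [phase]

lemma phase_space (k : Fin 3) (ξ : SpaceTime) : phase (EuclideanSpace.single k 1, 0) ξ = ξ.1 k := by
  simp [phase]

lemma planeWave_terminal (x : E3) (T : ℝ) (ξ : SpaceTime) :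
    planeWave ξ (x, T) = Complex.exp (-(Complex.I * (T * ξ.2))) * planeWave ξ (x, 0) := by
  rw [planeWave, planeWave, ← Complex.exp_add]
  congr 1
  simp [phase]
  ring

lemma dataTime_eq (ξ : SpaceTime) : dataTime Ω T A₁ A₂ ξ =
    ∫ x in Ω, ((A₂ x : ℂ) * planeWave ξ (x, T) - (A₁ x : ℂ) * planeWave ξ (x, 0)) := by
  refine integral_congr_ae (ae_of_all _ fun x => ?_)
  simp only [planeWave_terminal x T ξ]
  simp only [planeWave]
  ring

/-- Differentiating the plane wave `e^{-i p·ξ}` produces the factors `-iξ₀` and `-iξ_k`. -/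
lemma WeakIdentities.fourierIdentities (h : ProblemData Ω T A₁ A₂ A₃) (hZ : StateData Ω T Z g)
    {ξ : SpaceTime} (hw : WeakIdentities Ω T A₁ A₂ A₃ Z g (planeWave ξ)) :
    FourierIdentities Ω T A₁ A₂ A₃ Z g ξ := by
  have key : ∀ v w : SpaceTime → ℝ, IntegrableOn v (cyl Ω T) → IntegrableOn w (cyl Ω T) →
      ∀ e, ∫ q in cyl Ω T, ((v q : ℂ) * planeWave ξ q + w q * fderiv ℝ (planeWave ξ) q e) =
        cylFourier Ω T v ξ - Complex.I * phase e ξ * cylFourier Ω T w ξ := by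
    intro v w hv hw e
    have i1 := integrable_mul_planeWave measurable_id hv.ofReal ξ
    have i2 := (integrable_mul_planeWave measurable_id hw.ofReal ξ).const_mul
      (Complex.I * phase e ξ)
    rw [cylFourier, cylFourier, ← integral_const_mul]
    refine Eq.trans ?_ (integral_sub i1 i2)
    refine integral_congr_ae (ae_of_all _ fun p => ?_)
    simp only [fderiv_planeWave]
    ring
  have i0 := fun k => h.integrableOn_cyl (hZ.memLp k)
  refine ⟨?_, fun k => ?_⟩
  · rw [← phase_time ξ, ← key _ _ (h.integrableOn_cyl hZ.memLp_time) (i0 0), hw.time, dataTime_eq]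
  · rw [← phase_space k ξ, ← key _ _ (i0 k.succ) (i0 0), hw.lateral k]
    rfl

lemma integrable_normal_lateral (h : ProblemData Ω T A₁ A₂ A₃) (k : Fin 3) :
    Integrable (fun q => (A₃ q : ℂ) * (outwardNormal Ω q.1 k : ℂ)) (lateralMeasure Ω T) := by
  have := h.isFiniteMeasure_surface
  simpa [EuclideanSpace.inner_single_right] using
    integrable_lateral_mul_test h.isOpen h.isBounded h.integrable_lateral
      (EuclideanSpace.single k 1) (φ := fun _ => 1) continuous_const

lemma measurable_slice (t : ℝ) : Measurable fun x : E3 => ((x, t) : SpaceTime) :=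
  measurable_id.prodMk measurable_const

lemma dataTime_eq_sub (h : ProblemData Ω T A₁ A₂ A₃) (ξ : SpaceTime) : dataTime Ω T A₁ A₂ ξ =
    (∫ x in Ω, (A₂ x : ℂ) * planeWave ξ (x, T)) - ∫ x in Ω, (A₁ x : ℂ) * planeWave ξ (x, 0) := by
  rw [dataTime_eq]
  exact integral_sub (integrable_mul_planeWave (measurable_slice T) h.integrable_terminal.ofReal ξ)
    (integrable_mul_planeWave (measurable_slice 0) h.integrable_initial.ofReal ξ)

lemma continuous_dataTime (h : ProblemData Ω T A₁ A₂ A₃) : Continuous (dataTime Ω T A₁ A₂) := by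
  rw [funext (dataTime_eq_sub h)]
  exact (continuous_integral_planeWave (measurable_slice T) h.integrable_terminal.ofReal).sub
    (continuous_integral_planeWave (measurable_slice 0) h.integrable_initial.ofReal)

lemma exists_bound_dataTime (h : ProblemData Ω T A₁ A₂ A₃) :
    ∃ C, ∀ ξ, ‖dataTime Ω T A₁ A₂ ξ‖ ≤ C := by
  refine ⟨(∫ x in Ω, ‖(A₂ x : ℂ)‖) + ∫ x in Ω, ‖(A₁ x : ℂ)‖, fun ξ => ?_⟩
  rw [dataTime_eq_sub h]
  exact (norm_sub_le _ _).trans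
    (add_le_add (norm_integral_planeWave_le ξ) (norm_integral_planeWave_le ξ))

lemma continuous_dataLateral (h : ProblemData Ω T A₁ A₂ A₃) (k : Fin 3) :
    Continuous (dataLateral Ω T A₃ k) :=
  continuous_integral_planeWave measurable_id (integrable_normal_lateral h k)

lemma exists_bound_dataLateral (k : Fin 3) : ∃ C, ∀ ξ, ‖dataLateral Ω T A₃ k ξ‖ ≤ C :=
  ⟨_, fun ξ => norm_integral_planeWave_le (π := id) ξ⟩

open scoped LineDeriv in
-- By Fourier inversion `φ` is a superposition of plane waves with weight `F⁻¹φ`. Integrating the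
-- identities at each `ξ` against this weight gives the identities for `φ`, boundary terms included.
theorem weakIdentities_of_fourierIdentities (h : ProblemData Ω T A₁ A₂ A₃)
    (hZ : StateData Ω T Z g) (hF : ∀ ξ, FourierIdentities Ω T A₁ A₂ A₃ Z g ξ)
    (φ : 𝓢(SpaceTime, ℂ)) : WeakIdentities Ω T A₁ A₂ A₃ Z g φ := by
  have := h.isFiniteMeasure_lateral
  have key : ∀ v w : SpaceTime → ℝ, IntegrableOn v (cyl Ω T) → IntegrableOn w (cyl Ω T) →
      ∀ e, ∫ q in cyl Ω T, ((v q : ℂ) * φ q + w q * fderiv ℝ φ q e) =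
        ∫ ξ, invFourierCLM φ ξ *
          (cylFourier Ω T v ξ - Complex.I * phase e ξ * cylFourier Ω T w ξ) := by
    intro v w hv hw e
    have i1 : IntegrableOn (fun q => (v q : ℂ) * φ q) (cyl Ω T) :=
      integrableOn_mul_test h.isOpen h.isBounded hv φ.continuous
    have i2 : IntegrableOn (fun q => (w q : ℂ) * (∂_{e} φ) q) (cyl Ω T) :=
      integrableOn_mul_test h.isOpen h.isBounded hw (∂_{e} φ).continuous
    have h1 := indicatorPairing_eq hv φ
    have h2 := indicatorPairing_eq hw (∂_{e} φ)
    simp only [← SchwartzMap.lineDerivOp_apply_eq_fderiv]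
    rw [indicatorPairing] at h1 h2
    rw [integral_add i1 i2, h1, h2, ← integral_add
      (integrable_mul_cylFourier hv (invFourierCLM φ).integrable)
      (integrable_mul_cylFourier hw (invFourierCLM (∂_{e} φ)).integrable)]
    refine integral_congr_ae (ae_of_all _ fun ξ => ?_)
    simp only [invFourierCLM_lineDeriv]
    ring
  have i0 := fun k => h.integrableOn_cyl (hZ.memLp k)
  have hi := (invFourierCLM φ).integrable (μ := volume)
  refine ⟨?_, fun k => ?_⟩
  · rw [key _ _ (h.integrableOn_cyl hZ.memLp_time) (i0 0)]
    simp only [phase_time, (hF _).time, dataTime_eq_sub h, mul_sub]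
    have e1 := integral_mul_integral_planeWave (measurable_slice T)
      h.integrable_terminal.ofReal hi
    have e2 := integral_mul_integral_planeWave (measurable_slice 0)
      h.integrable_initial.ofReal hi
    simp only [← eq_integral_planeWave, RCLike.ofReal_eq_complex_ofReal] at e1 e2
    rw [integral_sub, integral_sub, e1, e2]
    · refine h.integrable_terminal.ofReal.mul_bdd (c := ‖φ.toBoundedContinuousFunction‖)
        (φ.continuous.measurable.comp (measurable_slice T)).aestronglyMeasurable
        (ae_of_all _ fun x => φ.toBoundedContinuousFunction.norm_coe_le_norm _)
    · refine h.integrable_initial.ofReal.mul_bdd (c := ‖φ.toBoundedContinuousFunction‖)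
        (φ.continuous.measurable.comp (measurable_slice 0)).aestronglyMeasurable
        (ae_of_all _ fun x => φ.toBoundedContinuousFunction.norm_coe_le_norm _)
    · exact integrable_mul_integral_planeWave (measurable_slice T) h.integrable_terminal.ofReal hi
    · exact integrable_mul_integral_planeWave (measurable_slice 0) h.integrable_initial.ofReal hi
  · rw [key _ _ (i0 k.succ) (i0 0)]
    simp only [phase_space, (hF _).lateral]
    have e1 := integral_mul_integral_planeWave measurable_id (integrable_normal_lateral h k) hi
    simp only [id, ← eq_integral_planeWave] at e1
    exact e1.symm

end

/-! ### The symbols -/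

section

variable {a b c d : ℝ}

lemma symbolA_re (a b c d : ℝ) (ξ : SpaceTime) : (symbolA a b c d ξ).re = a := by
  simp [symbolA]

lemma continuous_symbolA (a b c d : ℝ) : Continuous (symbolA a b c d) := by
  unfold symbolA
  fun_prop

lemma symbolA_ne_zero (ha : a ≠ 0) (ξ : SpaceTime) : symbolA a b c d ξ ≠ 0 := fun h => ha (by
  rw [← symbolA_re a b c d ξ, h, Complex.zero_re])

lemma abs_le_norm_symbolA (a b c d : ℝ) (ξ : SpaceTime) : |a| ≤ ‖symbolA a b c d ξ‖ := by
  conv_lhs => rw [← symbolA_re a b c d ξ]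
  exact Complex.abs_re_le_norm _

lemma det_matB₁ (ξ : SpaceTime) : (matB₁ a b c d ξ).det = symbolA a b c d ξ := by
  rw [Matrix.det_succ_row_zero]
  simp [matB₁, symbolA, Fin.sum_univ_succ, Matrix.det_fin_three, Fin.succAbove]
  ring

lemma matB₁_mulVec (ξ : SpaceTime) (v : Fin 4 → ℂ) : (matB₁ a b c d ξ).mulVec v =
    ![(Complex.I * ξ.2 - a) * v 0 - b * v 1 - c * v 2 - d * v 3,
      Complex.I * ξ.1 0 * v 0 - v 1, Complex.I * ξ.1 1 * v 0 - v 2,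
      Complex.I * ξ.1 2 * v 0 - v 3] := by
  funext k
  fin_cases k <;> simp [matB₁, Matrix.mulVec, dotProduct, Fin.sum_univ_four] <;> ring

lemma inv_mulVec_eq_iff (ha : a ≠ 0) (ξ : SpaceTime) (r v : Fin 4 → ℂ) :
    (matB₁ a b c d ξ)⁻¹.mulVec r = v ↔ (matB₁ a b c d ξ).mulVec v = r := by
  have hu : IsUnit (matB₁ a b c d ξ).det := by
    rw [det_matB₁]
    exact (symbolA_ne_zero ha ξ).isUnit
  constructor
  · rintro rfl
    rw [Matrix.mulVec_mulVec, Matrix.mul_nonsing_inv _ hu, Matrix.one_mulVec]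
  · rintro rfl
    rw [Matrix.mulVec_mulVec, Matrix.nonsing_inv_mul _ hu, Matrix.one_mulVec]

/-- The first component of `B₁⁻¹ r`. -/
def solveZero (a b c d : ℝ) (r : Fin 4 → ℂ) (ξ : SpaceTime) : ℂ :=
  (b * r 1 + c * r 2 + d * r 3 - r 0) * (symbolA a b c d ξ)⁻¹

/-- The last three rows express `v_k` as `iξ_k v₀ - r_k`; inserted in the first row they leave `a₁
v₀ = b r₁ + c r₂ + d r₃ - r₀`. -/
lemma inv_mulVec_eq (ha : a ≠ 0) (ξ : SpaceTime) (r : Fin 4 → ℂ) :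
    (matB₁ a b c d ξ)⁻¹.mulVec r = Fin.cons (solveZero a b c d r ξ)
      (fun k : Fin 3 => Complex.I * ξ.1 k * solveZero a b c d r ξ - r k.succ) := by
  rw [inv_mulVec_eq_iff ha, matB₁_mulVec]
  have h1 : solveZero a b c d r ξ * symbolA a b c d ξ = b * r 1 + c * r 2 + d * r 3 - r 0 :=
    inv_mul_cancel_right₀ (symbolA_ne_zero ha ξ) _
  rw [symbolA] at h1
  set s := solveZero a b c d r ξ
  funext k
  fin_cases k
  · change (Complex.I * ξ.2 - a) * s - b * (Complex.I * ξ.1 0 * s - r 1) -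
      c * (Complex.I * ξ.1 1 * s - r 2) - d * (Complex.I * ξ.1 2 * s - r 3) = r 0
    linear_combination -h1
  · change Complex.I * ξ.1 0 * s - (Complex.I * ξ.1 0 * s - r 1) = r 1
    ring
  · change Complex.I * ξ.1 1 * s - (Complex.I * ξ.1 1 * s - r 2) = r 2
    ring
  · change Complex.I * ξ.1 2 * s - (Complex.I * ξ.1 2 * s - r 3) = r 3
    ring

lemma continuous_solveZero (ha : a ≠ 0) {r : SpaceTime → Fin 4 → ℂ}
    (hr : ∀ k, Continuous fun ξ => r ξ k) :
    Continuous fun ξ => solveZero a b c d (r ξ) ξ := by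
  have h1 := (continuous_symbolA a b c d).inv₀ (symbolA_ne_zero ha)
  have h0 := hr 0
  have h2 := hr 1
  have h3 := hr 2
  have h4 := hr 3
  unfold solveZero
  exact Continuous.mul (by fun_prop) h1

lemma continuous_inv_mulVec (ha : a ≠ 0) {r : SpaceTime → Fin 4 → ℂ}
    (hr : ∀ k, Continuous fun ξ => r ξ k) (k : Fin 4) :
    Continuous fun ξ => ((matB₁ a b c d ξ)⁻¹.mulVec (r ξ)) k := by
  have h0 := continuous_solveZero (b := b) (c := c) (d := d) ha hr
  simp only [inv_mulVec_eq ha]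
  refine Fin.cases ?_ (fun k => ?_) k
  · exact h0
  · simp only [Fin.cons_succ]
    have := hr k.succ
    fun_prop

/-- The first component is bounded because `|a₁| ≥ |a|`. The others need not be bounded, but they
are `iξ_k` times the first minus a bounded function, so differentiation supplies their inverse
transforms. -/
theorem exists_hasInvFourier_inv_mulVec (ha : a ≠ 0) {r : SpaceTime → Fin 4 → ℂ}
    (hr : ∀ k, Continuous fun ξ => r ξ k) (hb : ∀ k, ∃ C, ∀ ξ, ‖r ξ k‖ ≤ C) (k : Fin 4) :
    ∃ W, HasInvFourier (fun ξ => ((matB₁ a b c d ξ)⁻¹.mulVec (r ξ)) k) W := by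
  have h0 : ∃ W, HasInvFourier (fun ξ => solveZero a b c d (r ξ) ξ) W := by
    choose C hC using hb
    refine exists_hasInvFourier_of_bounded
      (continuous_solveZero ha hr).aestronglyMeasurable
      (C := (|b| * C 1 + |c| * C 2 + |d| * C 3 + C 0) * |a|⁻¹) fun ξ => ?_
    rw [solveZero, norm_mul, norm_inv]
    have hC0 : ∀ k, 0 ≤ C k := fun k => (norm_nonneg _).trans (hC k 0)
    have h2 : ‖(b : ℂ) * r ξ 1 + c * r ξ 2 + d * r ξ 3 - r ξ 0‖ ≤
        |b| * C 1 + |c| * C 2 + |d| * C 3 + C 0 := by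
      have hm : ∀ (x : ℝ) k, ‖(x : ℂ) * r ξ k‖ ≤ |x| * C k := fun x k => by
        rw [norm_mul, Complex.norm_real, Real.norm_eq_abs]
        exact mul_le_mul_of_nonneg_left (hC k ξ) (abs_nonneg x)
      refine (norm_sub_le _ _).trans (add_le_add ?_ (hC 0 ξ))
      exact (norm_add_le _ _).trans (add_le_add ((norm_add_le _ _).trans
        (add_le_add (hm b 1) (hm c 2))) (hm d 3))
    exact mul_le_mul h2 (inv_anti₀ (abs_pos.2 ha) (abs_le_norm_symbolA a b c d ξ))
      (by positivity) ((norm_nonneg _).trans h2)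
  simp only [inv_mulVec_eq ha]
  refine Fin.cases h0 (fun k => ?_) k
  simp only [Fin.cons_succ]
  obtain ⟨W, hW⟩ := h0
  obtain ⟨C, hC⟩ := hb k.succ
  obtain ⟨V, hV⟩ := exists_hasInvFourier_of_bounded (hr k.succ).neg.aestronglyMeasurable
    (C := C) fun ξ => by
      rw [Pi.neg_apply, norm_neg]
      exact hC ξ
  have h1 := (hW.phase_mul (EuclideanSpace.single k 1, 0)).add hV
  simp only [phase_space, Pi.neg_apply, ← sub_eq_add_neg] at h1
  exact ⟨_, h1⟩

/-- If the inverse Fourier transform of `1 / a₁` exists, then `a ≠ 0`: otherwise `1 / |a₁|` is not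
locally integrable. -/
theorem ne_zero_of_hasInvFourier {W : 𝓢'(SpaceTime, ℂ)}
    (h : HasInvFourier (fun ξ => (symbolA a b c d ξ)⁻¹) W) : a ≠ 0 := by
  rintro rfl
  -- Every compactly supported smooth function is some `F⁻¹φ`; a bump equal to `1` on a ball turns
  -- the hypothesis into integrability of `1/a₁` there.
  let χ : ContDiffBump (0 : SpaceTime) := ⟨2, 3, by norm_num, by norm_num⟩
  have hs : HasCompactSupport fun q => (χ q : ℂ) := χ.hasCompactSupport.comp_left
    Complex.ofReal_zero
  obtain ⟨φ, hφ⟩ := invFourierCLM_surjective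
    (hs.toSchwartzMap (Complex.ofRealCLM.contDiff.comp χ.contDiff))
  have h1 := (h φ).1
  simp only [← invFourierCLM_apply, hφ] at h1
  have hlin : Continuous fun x : E3 => b * x 0 + c * x 1 + d * x 2 := by fun_prop
  -- For small spatial frequency the zero `s` of `t ↦ a₁(x, t)` lies in `(-1, 1)`, that is, inside
  -- the interval of integration.
  obtain ⟨ε, hε, hεs⟩ := Metric.mem_nhds_iff.1
    (hlin.continuousAt.preimage_mem_nhds (x := 0) (Ioo_mem_nhds (a := -1) (b := 1)
      (by simp) (by simp)))
  set B : Set E3 := Metric.ball 0 (min ε 1) with hB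
  have hBs : B ×ˢ Ioo (-1 : ℝ) 1 ⊆ Metric.closedBall (0 : SpaceTime) 2 := by
    rintro ⟨x, t⟩ ⟨hx, ht⟩
    have hx1 : ‖x‖ < 1 := (mem_ball_zero_iff.1 hx).trans_le (min_le_right _ _)
    rw [mem_closedBall_zero_iff, Prod.norm_def]
    refine max_le (by simpa using by linarith) ?_
    have := abs_lt.2 ht
    simp only [Real.norm_eq_abs]
    linarith
  have hm : MeasurableSet (B ×ˢ Ioo (-1 : ℝ) 1) :=
    Metric.isOpen_ball.measurableSet.prod measurableSet_Ioo
  have h2 : IntegrableOn (fun ξ => (symbolA 0 b c d ξ)⁻¹) (B ×ˢ Ioo (-1 : ℝ) 1) := by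
    refine h1.integrableOn.congr_fun (fun ξ hξ => ?_) hm
    have : χ ξ = 1 := χ.one_of_mem_closedBall (hBs hξ)
    change (symbolA 0 b c d ξ)⁻¹ * (χ ξ : ℂ) = _
    rw [this]
    simp
  rw [IntegrableOn, Measure.volume_eq_prod, ← Measure.prod_restrict] at h2
  have h3 := h2.prod_right_ae
  have hne : NeBot (ae (volume.restrict B)) := by
    rw [ae_neBot, Ne, Measure.restrict_eq_zero]
    exact (Metric.measure_ball_pos volume _ (lt_min hε one_pos)).ne'
  obtain ⟨x, hx, hxB⟩ := (h3.and (ae_restrict_mem Metric.isOpen_ball.measurableSet)).exists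
  set s := b * x 0 + c * x 1 + d * x 2 with hsdef
  have hs : s ∈ Ioo (-1 : ℝ) 1 := hεs (Metric.ball_subset_ball (min_le_left _ _) hxB)
  -- For `a = 0` one has `a₁ = -i (t - s)`, so the imaginary part of `1/a₁` is `1/(t - s)`, which is
  -- not integrable across `s`.
  have h4 : IntervalIntegrable (fun t : ℝ => (t - s)⁻¹) volume (-1) 1 := by
    rw [intervalIntegrable_iff_integrableOn_Ioo_of_le (by norm_num)]
    refine hx.im.congr (ae_of_all _ fun t => ?_)
    have e1 : symbolA 0 b c d (x, t) = -Complex.I * ((t - s : ℝ) : ℂ) := by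
      simp only [symbolA, hsdef]
      push_cast
      ring
    change ((symbolA 0 b c d (x, t))⁻¹).im = _
    rw [e1, mul_inv, ← Complex.ofReal_inv, inv_neg, Complex.inv_I, neg_neg, Complex.I_mul_im,
      Complex.ofReal_re]
  rcases intervalIntegrable_sub_inv_iff.1 h4 with h5 | h5
  · norm_num at h5
  · refine h5 ?_
    rw [uIcc_of_le (by norm_num)]
    exact Ioo_subset_Icc_self hs

end

/-! ### The integral equation -/

section

variable {Ω : Set E3} {T : ℝ} {A₁ A₂ : E3 → ℝ} {A₃ : SpaceTime → ℝ}
  {f : (Fin 4 → ℝ) → SpaceTime → ℝ} {a b c d : ℝ} {Z : SpaceTime → Fin 4 → ℝ}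

lemma cylFourier_psi (h : ProblemData Ω T A₁ A₂ A₃)
    (hZ : ∀ k, MemLp (fun p => Z p k) 2 (volume.restrict (cyl Ω T)))
    (hψ : MemLp (psi f a b c d Z) 2 (volume.restrict (cyl Ω T))) (ξ : SpaceTime) :
    cylFourier Ω T (fun p => f (Z p) p) ξ = cylFourier Ω T (psi f a b c d Z) ξ +
      a * cylFourier Ω T (fun p => Z p 0) ξ + b * cylFourier Ω T (fun p => Z p 1) ξ +
      c * cylFourier Ω T (fun p => Z p 2) ξ + d * cylFourier Ω T (fun p => Z p 3) ξ := by
  have i := fun k => integrable_mul_planeWave measurable_id (h.integrableOn_cyl (hZ k)).ofReal ξ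
  have iψ := integrable_mul_planeWave measurable_id (h.integrableOn_cyl hψ).ofReal ξ
  have i0 := iψ.add ((i 0).const_mul (a : ℂ))
  have i1 := i0.add ((i 1).const_mul (b : ℂ))
  have i2 := i1.add ((i 2).const_mul (c : ℂ))
  simp only [cylFourier, ← integral_const_mul]
  refine Eq.trans ?_ ((integral_add i2 ((i 3).const_mul (d : ℂ))).trans ?_)
  · refine integral_congr_ae (ae_of_all _ fun p => ?_)
    simp only [psi, Pi.add_apply, id, RCLike.ofReal_eq_complex_ofReal]
    push_cast
    ring
  · congr 1
    refine (integral_add i1 ((i 2).const_mul (c : ℂ))).trans ?_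
    congr 1
    refine (integral_add i0 ((i 1).const_mul (b : ℂ))).trans ?_
    congr 1
    exact integral_add iψ ((i 0).const_mul (a : ℂ))

lemma symbolW₁_eq (ha : a ≠ 0) (k : Fin 4) : symbolW₁ Ω T A₁ A₂ A₃ a b c d k =
    fun ξ => ((matB₁ a b c d ξ)⁻¹.mulVec (beta₁ Ω T A₁ A₂ A₃ ξ)) k := by
  funext ξ
  exact indicator_of_mem (show ξ ∈ {ξ | symbolA a b c d ξ = 0}ᶜ from symbolA_ne_zero ha ξ) _

lemma continuous_beta₁ (h : ProblemData Ω T A₁ A₂ A₃) (k : Fin 4) :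
    Continuous fun ξ => beta₁ Ω T A₁ A₂ A₃ ξ k := by
  fin_cases k
  · exact (continuous_dataTime h).neg
  · exact (continuous_dataLateral h 0).neg
  · exact (continuous_dataLateral h 1).neg
  · exact (continuous_dataLateral h 2).neg

lemma exists_bound_beta₁ (h : ProblemData Ω T A₁ A₂ A₃) (k : Fin 4) :
    ∃ C, ∀ ξ, ‖beta₁ Ω T A₁ A₂ A₃ ξ k‖ ≤ C := by
  have hn : ∀ {F : SpaceTime → ℂ}, (∃ C, ∀ ξ, ‖F ξ‖ ≤ C) → ∃ C, ∀ ξ, ‖-F ξ‖ ≤ C := by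
    simp
  fin_cases k
  · exact hn (exists_bound_dataTime h)
  · exact hn (exists_bound_dataLateral 0)
  · exact hn (exists_bound_dataLateral 1)
  · exact hn (exists_bound_dataLateral 2)

theorem exists_hasInvFourier_symbolW₁ (h : ProblemData Ω T A₁ A₂ A₃) (ha : a ≠ 0) (k : Fin 4) :
    ∃ W, HasInvFourier (symbolW₁ Ω T A₁ A₂ A₃ a b c d k) W := by
  rw [symbolW₁_eq ha]
  exact exists_hasInvFourier_inv_mulVec ha (continuous_beta₁ h) (exists_bound_beta₁ h) k

theorem exists_hasInvFourier_symbolW₂ (ha : a ≠ 0) (k : Fin 4) :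
    ∃ W, HasInvFourier (symbolW₂ a b c d k) W :=
  exists_hasInvFourier_inv_mulVec ha (r := fun _ => vecB₂) (fun _ => continuous_const)
    (fun k => ⟨‖vecB₂ k‖, fun _ => le_rfl⟩) k

lemma continuous_symbolW₁ (h : ProblemData Ω T A₁ A₂ A₃) (ha : a ≠ 0) (k : Fin 4) :
    Continuous (symbolW₁ Ω T A₁ A₂ A₃ a b c d k) := by
  rw [symbolW₁_eq ha]
  exact continuous_inv_mulVec ha (continuous_beta₁ h) k

lemma continuous_symbolW₂ (ha : a ≠ 0) (k : Fin 4) : Continuous (symbolW₂ a b c d k) :=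
  continuous_inv_mulVec ha (r := fun _ => vecB₂) (fun _ => continuous_const) k

/-- Replacing the transform of `f(Z)` by `ψ̂ + a Ẑ₀ + b Ẑ₁ + c Ẑ₂ + d Ẑ₃` makes the four identities
the rows of `B₁ Ẑ = β₁ + ψ̂ B₂`, up to sign; then `B₁` is inverted. -/
theorem fourierIdentities_iff (h : ProblemData Ω T A₁ A₂ A₃) (ha : a ≠ 0)
    (hZ : ∀ k, MemLp (fun p => Z p k) 2 (volume.restrict (cyl Ω T)))
    (hψ : MemLp (psi f a b c d Z) 2 (volume.restrict (cyl Ω T))) (ξ : SpaceTime) :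
    FourierIdentities Ω T A₁ A₂ A₃ Z (fun p => f (Z p) p) ξ ↔
      ∀ k, cylFourier Ω T (fun p => Z p k) ξ = symbolW₁ Ω T A₁ A₂ A₃ a b c d k ξ +
        symbolW₂ a b c d k ξ * cylFourier Ω T (psi f a b c d Z) ξ := by
  set v : Fin 4 → ℂ := fun k => cylFourier Ω T (fun p => Z p k) ξ with hv
  set ψ := cylFourier Ω T (psi f a b c d Z) ξ with hψ'
  have hr : ∀ k, symbolW₁ Ω T A₁ A₂ A₃ a b c d k ξ + symbolW₂ a b c d k ξ * ψ =
      (matB₁ a b c d ξ)⁻¹.mulVec (beta₁ Ω T A₁ A₂ A₃ ξ + ψ • vecB₂) k := by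
    intro k
    rw [symbolW₁_eq ha, symbolW₂, Matrix.mulVec_add, Matrix.mulVec_smul]
    simp [mul_comm]
  have h1 : (∀ k, v k = symbolW₁ Ω T A₁ A₂ A₃ a b c d k ξ + symbolW₂ a b c d k ξ * ψ) ↔
      (matB₁ a b c d ξ).mulVec v = beta₁ Ω T A₁ A₂ A₃ ξ + ψ • vecB₂ := by
    rw [← inv_mulVec_eq_iff ha, funext_iff]
    exact forall_congr' fun k => by rw [hr k, eq_comm]
  have hg : cylFourier Ω T (fun p => f (Z p) p) ξ =
      ψ + a * v 0 + b * v 1 + c * v 2 + d * v 3 := cylFourier_psi h hZ hψ ξ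
  rw [h1, matB₁_mulVec]
  constructor
  · rintro ⟨ht, hl⟩
    rw [hg] at ht
    funext k
    fin_cases k
    · simp only [beta₁, vecB₂, Pi.add_apply, Pi.smul_apply, smul_eq_mul]
      simp
      linear_combination -ht
    · have hk : v 1 - Complex.I * ξ.1 0 * v 0 = dataLateral Ω T A₃ 0 ξ := hl 0
      simp only [beta₁, vecB₂, Pi.add_apply, Pi.smul_apply, smul_eq_mul]
      simp
      linear_combination -hk
    · have hk : v 2 - Complex.I * ξ.1 1 * v 0 = dataLateral Ω T A₃ 1 ξ := hl 1
      simp only [beta₁, vecB₂, Pi.add_apply, Pi.smul_apply, smul_eq_mul]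
      simp
      linear_combination -hk
    · have hk : v 3 - Complex.I * ξ.1 2 * v 0 = dataLateral Ω T A₃ 2 ξ := hl 2
      simp only [beta₁, vecB₂, Pi.add_apply, Pi.smul_apply, smul_eq_mul]
      simp
      linear_combination -hk
  · intro hk
    have e0 := congrFun hk 0
    have e1 := congrFun hk 1
    have e2 := congrFun hk 2
    have e3 := congrFun hk 3
    simp [beta₁, vecB₂] at e0 e1 e2 e3
    refine ⟨?_, fun k => ?_⟩
    · rw [hg]
      change _ - Complex.I * ξ.2 * v 0 = _
      linear_combination -e0
    · fin_cases k
      · change v 1 - Complex.I * ξ.1 0 * v 0 = dataLateral Ω T A₃ 0 ξ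
        linear_combination -e1
      · change v 2 - Complex.I * ξ.1 1 * v 0 = dataLateral Ω T A₃ 1 ξ
        linear_combination -e2
      · change v 3 - Complex.I * ξ.1 2 * v 0 = dataLateral Ω T A₃ 2 ξ
        linear_combination -e3

/-- Paired with `φ`, the equation says that the difference of the two sides on the Fourier side
annihilates `F⁻¹φ`. This difference is continuous in `ξ`, so it vanishes identically. -/
theorem integralEquation_iff (h : ProblemData Ω T A₁ A₂ A₃) (ha : a ≠ 0)
    (hZ : ∀ k, MemLp (fun p => Z p k) 2 (volume.restrict (cyl Ω T)))
    (hψ : MemLp (psi f a b c d Z) 2 (volume.restrict (cyl Ω T)))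
    {w₁ w₂ : Fin 4 → 𝓢'(SpaceTime, ℂ)}
    (h₁ : ∀ k, HasInvFourier (symbolW₁ Ω T A₁ A₂ A₃ a b c d k) (w₁ k))
    (h₂ : ∀ k, HasInvFourier (symbolW₂ a b c d k) (w₂ k)) :
    IntegralEquation Ω T f a b c d w₁ w₂ Z ↔
      ∀ ξ k, cylFourier Ω T (fun p => Z p k) ξ = symbolW₁ Ω T A₁ A₂ A₃ a b c d k ξ +
        symbolW₂ a b c d k ξ * cylFourier Ω T (psi f a b c d Z) ξ := by
  have hψi := h.integrableOn_cyl hψ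
  have hZi := fun k => h.integrableOn_cyl (hZ k)
  have i₁ : ∀ k (φ : 𝓢(SpaceTime, ℂ)),
      Integrable fun ξ => symbolW₁ Ω T A₁ A₂ A₃ a b c d k ξ * invFourierCLM φ ξ := fun k φ => by
    simpa only [invFourierCLM_apply] using (h₁ k φ).1
  have i₂ : ∀ k (φ : 𝓢(SpaceTime, ℂ)), Integrable fun ξ =>
      symbolW₂ a b c d k ξ * invFourierCLM φ ξ * cylFourier Ω T (psi f a b c d Z) ξ :=
    fun k φ => integrable_mul_cylFourier hψi (by
      simpa only [invFourierCLM_apply] using (h₂ k φ).1)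
  have iZ : ∀ k (φ : 𝓢(SpaceTime, ℂ)), Integrable fun ξ =>
      invFourierCLM φ ξ * cylFourier Ω T (fun p => Z p k) ξ := fun k φ =>
    integrable_mul_cylFourier (hZi k) (invFourierCLM φ).integrable
  have key : ∀ k (φ : 𝓢(SpaceTime, ℂ)),
      (indicatorPairing (cyl Ω T) (fun p => Z p k) φ =
        w₁ k φ + convPairing (w₂ k) (cyl Ω T) (psi f a b c d Z) φ) ↔
      ∫ ξ, (cylFourier Ω T (fun p => Z p k) ξ - (symbolW₁ Ω T A₁ A₂ A₃ a b c d k ξ +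
        symbolW₂ a b c d k ξ * cylFourier Ω T (psi f a b c d Z) ξ)) * invFourierCLM φ ξ = 0 := by
    intro k φ
    rw [indicatorPairing_eq (hZi k), convPairing_eq (h₂ k) hψi, (h₁ k φ).2, ← sub_eq_zero]
    simp only [← invFourierCLM_apply]
    have hs : Integrable fun ξ => symbolW₁ Ω T A₁ A₂ A₃ a b c d k ξ * invFourierCLM φ ξ +
        symbolW₂ a b c d k ξ * invFourierCLM φ ξ * cylFourier Ω T (psi f a b c d Z) ξ :=
      (i₁ k φ).add (i₂ k φ)
    rw [← integral_add (i₁ k φ) (i₂ k φ), ← integral_sub (iZ k φ) hs]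
    refine Eq.congr_left (integral_congr_ae (ae_of_all _ fun ξ => ?_))
    ring
  constructor
  · intro hI ξ k
    have hc : Continuous fun ξ => cylFourier Ω T (fun p => Z p k) ξ -
        (symbolW₁ Ω T A₁ A₂ A₃ a b c d k ξ +
        symbolW₂ a b c d k ξ * cylFourier Ω T (psi f a b c d Z) ξ) :=
      (continuous_cylFourier (hZi k)).sub ((continuous_symbolW₁ h ha k).add
        ((continuous_symbolW₂ ha k).mul (continuous_cylFourier hψi)))
    have h0 := eq_zero_of_integral_mul_schwartz hc fun φ => (key k φ).1 (hI k φ)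
    exact sub_eq_zero.1 (congrFun h0 ξ)
  · intro hF k φ
    rw [key k φ]
    simp [hF _ k]

/-- A solution is tested against plane waves; conversely the Fourier identities are tested against
smooth compactly supported functions, which suffice to recover the solution. -/
theorem isSolution_iff_integralEquation (h : ProblemData Ω T A₁ A₂ A₃) (ha : a ≠ 0)
    (hf : ContinuousOn (fun q : (Fin 4 → ℝ) × SpaceTime => f q.1 q.2) (univ ×ˢ cyl Ω T))
    (hZc : ContinuousOn Z (cyl Ω T))
    (hZ : ∀ k, MemLp (fun p => Z p k) 2 (volume.restrict (cyl Ω T)))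
    (hψ : MemLp (psi f a b c d Z) 2 (volume.restrict (cyl Ω T)))
    {w₁ w₂ : Fin 4 → 𝓢'(SpaceTime, ℂ)}
    (h₁ : ∀ k, HasInvFourier (symbolW₁ Ω T A₁ A₂ A₃ a b c d k) (w₁ k))
    (h₂ : ∀ k, HasInvFourier (symbolW₂ a b c d k) (w₂ k)) :
    (∃ u : SpaceTime → ℝ, IsSolution Ω T f A₁ A₂ A₃ u ∧ ∀ p ∈ cyl Ω T, Z p = jet u p) ↔
      IntegralEquation Ω T f a b c d w₁ w₂ Z := by
  have hg : MemLp (fun p => f (Z p) p) 2 (volume.restrict (cyl Ω T)) := by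
    refine ((((hψ.add ((hZ 0).const_mul a)).add ((hZ 1).const_mul b)).add
      ((hZ 2).const_mul c)).add ((hZ 3).const_mul d)).ae_eq (ae_of_all _ fun p => ?_)
    simp only [psi, Pi.add_apply]
    ring
  have hgc : ContinuousOn (fun p => f (Z p) p) (cyl Ω T) :=
    hf.comp (hZc.prodMk continuousOn_id) fun p hp => ⟨mem_univ _, hp⟩
  have hS : StateData Ω T Z (fun p => f (Z p) p) := ⟨hZc, hgc, hZ, hg⟩
  rw [integralEquation_iff h ha hZ hψ h₁ h₂]
  simp_rw [← fourierIdentities_iff h ha hZ hψ]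
  constructor
  · rintro ⟨u, hu, huZ⟩ ξ
    exact (weakIdentities_of_isSolution h hS (fun _ _ => rfl) hu huZ
      (contDiff_planeWave ξ)).fourierIdentities h hS
  · intro hF
    refine ⟨_, isSolution_of_weakIdentities h hS (fun _ _ => rfl) fun η hη hηs => ?_⟩
    have hs : HasCompactSupport fun q => (η q : ℂ) := hηs.comp_left Complex.ofReal_zero
    exact weakIdentities_of_fourierIdentities h hS hF
      (hs.toSchwartzMap (Complex.ofRealCLM.contDiff.comp hη))

end

end

end FirstOrderPDE

/-! ### The main theorem -/

theorem theorem2p1 (Ω : Set E3) (hΩ : IsOpen Ω) (hΩb : Bornology.IsBounded Ω)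
    (hΩs : HasPiecewiseSmoothBoundary Ω) (T : ℝ) (hT : 0 < T)
    (f : (Fin 4 → ℝ) → SpaceTime → ℝ)
    (hf : ContinuousOn (fun q : (Fin 4 → ℝ) × SpaceTime => f q.1 q.2) (univ ×ˢ cyl Ω T))
    (A₁ A₂ : E3 → ℝ) (A₃ : SpaceTime → ℝ)
    (hA₁ : MemLp A₁ 2 (volume.restrict Ω)) (hA₂ : MemLp A₂ 2 (volume.restrict Ω))
    (hA₃ : MemLp A₃ 2 (lateralMeasure Ω T))
    (a b c d : ℝ)
    (habcd : ∃ W : 𝓢'(SpaceTime, ℂ), HasInvFourier (fun ξ => (symbolA a b c d ξ)⁻¹) W) :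
    ∃ w₁ w₂ : Fin 4 → 𝓢'(SpaceTime, ℂ),
      (∀ k, HasInvFourier (symbolW₁ Ω T A₁ A₂ A₃ a b c d k) (w₁ k)) ∧
      (∀ k, HasInvFourier (symbolW₂ a b c d k) (w₂ k)) ∧
      ∀ Z : SpaceTime → Fin 4 → ℝ,
        ContinuousOn Z (cyl Ω T) →
        (∀ k, MemLp (fun p => Z p k) 2 (volume.restrict (cyl Ω T))) →
        MemLp (psi f a b c d Z) 2 (volume.restrict (cyl Ω T)) →
        ((∃ u : SpaceTime → ℝ, IsSolution Ω T f A₁ A₂ A₃ u ∧ ∀ p ∈ cyl Ω T, Z p = jet u p) ↔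
          IntegralEquation Ω T f a b c d w₁ w₂ Z) := by
  have ha : a ≠ 0 := habcd.elim fun _ hW => ne_zero_of_hasInvFourier hW
  have h : ProblemData Ω T A₁ A₂ A₃ := ⟨hΩ, hΩb, hΩs, hT, hA₁, hA₂, hA₃⟩
  choose w₁ h₁ using exists_hasInvFourier_symbolW₁ (b := b) (c := c) (d := d) h ha
  choose w₂ h₂ using exists_hasInvFourier_symbolW₂ (b := b) (c := c) (d := d) ha
  exact ⟨w₁, w₂, h₁, h₂, fun Z hZc hZ hψ =>
    isSolution_iff_integralEquation h ha hf hZc hZ hψ h₁ h₂⟩
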